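/- **Conventions.** Everything is smooth, metrics may have any signature. For a metric $g$ on a manifold $M$ of dimension $n\ge 3$, $\nabla^g$ is the Levi-Civita connection, $\mathsf P^g=\frac1{n-2}\big(\mathrm{Ric}^g-\frac{\mathrm{tr}_g\mathrm{Ric}^g}{2(n-1)}g\big)$ the Schouten tensor (with the sign for which $\mathrm{Ric}$ is positive on round spheres), and $(B_1\owedge B_2)(X,Y,Z,W)=B_1(X,Z)B_2(Y,W)+B_1(Y,W)B_2(X,Z)-B_1(X,W)B_2(Y,Z)-B_1(Y,Z)B_2(X,W)$. For a totally symmetric $(0,3)$-tensor field $T$ define endomorphisms $T_X$ by $g(T_XY,Z)=T(X,Y,Z)$. $\Pi_{\mathrm{Sym}^4_0}$ denotes the projection of $(0,4)$-tensors onto the totally symmetric $g$-trace-free ones, $\Pi_{\mathrm{Sym}^3_0}$ the projection onto the $(0,4)$-tensors that are totally symmetric and $g$-trace-free in the first three arguments. In $\nabla^gT$ the last argument is the direction of differentiation. **Abundant manifolds.** Let $(M,g)$ be a (locally) conformally flat pseudo-Riemannian manifold of dimension $n\ge3$ with a totally symmetric trace-free $(0,3)$-tensor field $S$ and a function $t$.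 Put $\mathscr S(X,Y)=\mathrm{tr}(S_XS_Y)$, $\mathfrak S(X,Y,Z,W)=g(S_XY,S_ZW)$ and $$S_1(X,Y,Z,W)=g(S_XS_YZ,W)+3S(X,Y,W)\,dt(Z)+S(X,Y,Z)\,dt(W)+\Big(\tfrac4{n-2}\mathscr S(Y,Z)-3S(Y,Z,\mathrm{grad}_g t)\Big)g(X,W).$$ $(M,g,S,t)$ is an *abundant manifold* if 1. $(\nabla^g)^2t=3\mathsf P^g+\frac13\big(dt^2-\frac12|\mathrm{grad}\,t|_g^2\,g\big)+\frac1{3(n-2)}\Big(\mathscr S+\frac{(n-6)|S|_g^2}{2(n-1)(n+2)}g\Big)$, 2. $\nabla^gS=\frac13\Pi_{\mathrm{Sym}^3_0}S_1$, 3. $\Pi_{\mathrm{Weyl}_0}\mathfrak S=0$, where $\Pi_{\mathrm{Weyl}_0}B=B_1-\big(\mathscr B-\frac{\mathrm{tr}_g\mathscr B}{2(n-1)}g\big)\owedge g$ with $B_1(X,Y,Z,W)=\frac14\big(B(X,Z,Y,W)-B(X,W,Y,Z)-B(Y,Z,X,W)+B(Y,W,X,Z)\big)$ and $\mathscr B(X,Y)=\frac1{n-2}\mathrm{tr}_g\,B_1(\cdot,X,\cdot,Y)$.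 **Abundant hypersurface co-normalisations.** Let $f:M^n\to\mathbb R^{n+1}$ be an immersion and $\Xi:M\to(\mathbb R^{n+1})^*$ a nowhere vanishing map with $\langle\Xi,df(X)\rangle=0$ for all $X\in TM$, such that $G(X,Y)=-\langle D_X\Xi,df(Y)\rangle$ is non-degenerate; $G$ is the associated metric. Let $\xi:M\to\mathbb R^{n+1}$ be the unique map with $\langle\Xi,\xi\rangle=1$ and $\langle D_X\Xi,\xi\rangle=0$ for all $X$, and let the associated connection $\nabla$ be given by $D_X(df(Y))=df(\nabla_XY)+G(X,Y)\xi$. Put $$C=-\tfrac12\nabla G,\qquad u=\tfrac1{n+2}\mathrm{tr}_GC,\qquad U(X,Y,Z)=C(X,Y,Z)-u(X)G(Y,Z)-u(Y)G(X,Z)-u(Z)G(X,Y).$$ For $n\ge3$, $(f,\Xi)$ is an *abundant hypersurface co-normalisation* if the Weyl tensor of $G$ vanishes and $$\Pi_{\mathrm{Sym}^4_0}(\nabla^GU)=\Pi_{\mathrm{Sym}^4_0}\big[\mathfrak U+4\,U\otimes u\big],\qquad \nabla^Gu=\mathsf P^G+u\otimes u-\tfrac{|u|^2}2G+\tfrac1{n-2}\Big(\mathscr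 U+\tfrac{n-6}{2(n+2)(n-1)}|U|^2G\Big),$$ where $\mathscr U(X,Y)=\mathrm{tr}(U_XU_Y)$, $\mathfrak U(X,Y,Z,W)=G(U_XU_YW,Z)$, and norms, traces and projections are taken with respect to $G$. **Theorem.** Let $M$ be a simply connected manifold of dimension $n\ge3$ and let $(f:M\to\mathbb R^{n+1},\Xi)$ be an abundant hypersurface co-normalisation, with $G$, $U$, $u$ as above. Then there is a function $t$ on $M$ such that $3u=dt$ and $(M,G,3U,t)$ is an abundant manifold. -/

import Mathlib

open scoped Manifold ContDiff

noncomputable section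

namespace Abundant

/-! ## Linear algebra at a point, in index notation

`g` is the Gram matrix of a non-degenerate symmetric bilinear form; `g⁻¹` raises indices. -/

section Pointwise

variable {n : ℕ}

/-- `g^{ij} B_{ij}`. -/
def tr₂ (g : Matrix (Fin n) (Fin n) ℝ) (B : Fin n → Fin n → ℝ) : ℝ :=
  ∑ i, ∑ j, g⁻¹ i j * B i j

/-- The squared norm `g^{ij} u_i u_j` of a covector (of either sign if `g` is indefinite). -/
def normSq₁ (g : Matrix (Fin n) (Fin n) ℝ) (u : Fin n → ℝ) : ℝ :=
  tr₂ g fun i j => u i * u j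

/-- The squared norm `g^{ia} g^{jb} g^{kc} T_{ijk} T_{abc}` of a `(0,3)`-tensor. -/
def normSq₃ (g : Matrix (Fin n) (Fin n) ℝ) (T : Fin n → Fin n → Fin n → ℝ) : ℝ :=
  ∑ i, ∑ j, ∑ k, ∑ a, ∑ b, ∑ c, g⁻¹ i a * g⁻¹ j b * g⁻¹ k c * T i j k * T a b c

/-- The matrix `(T_i)^a_b` of the endomorphism `T_i = \hat T(∂_i, ·)`, where
`g(\hat T(X, Y), Z) = T(X, Y, Z)`. -/
def endo (g : Matrix (Fin n) (Fin n) ℝ) (T : Fin n → Fin n → Fin n → ℝ) (i : Fin n) :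
    Matrix (Fin n) (Fin n) ℝ :=
  Matrix.of fun a b => ∑ c, g⁻¹ a c * T i b c

/-- The `(0,2)`-tensor `(X, Y) ↦ tr (T_X T_Y)`. -/
def trEndo (g : Matrix (Fin n) (Fin n) ℝ) (T : Fin n → Fin n → Fin n → ℝ)
    (i j : Fin n) : ℝ :=
  (endo g T i * endo g T j).trace

/-- The `(0,4)`-tensor `(X, Y, Z, W) ↦ g(T_X T_Y Z, W)`. -/
def compEndo (g : Matrix (Fin n) (Fin n) ℝ) (T : Fin n → Fin n → Fin n → ℝ)
    (i j k l : Fin n) : ℝ :=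
  ∑ a, g l a * (endo g T i * endo g T j) a k

/-- The `(0,4)`-tensor `(X, Y, Z, W) ↦ g(T_X Y, T_Z W)`. -/
def pairEndo (g : Matrix (Fin n) (Fin n) ℝ) (T : Fin n → Fin n → Fin n → ℝ)
    (i j k l : Fin n) : ℝ :=
  ∑ a, ∑ b, g a b * endo g T i a j * endo g T k b l

/-- The Kulkarni-Nomizu product. -/
def kulkarniNomizu (A B : Fin n → Fin n → ℝ) (i j k l : Fin n) : ℝ :=
  A i k * B j l + A j l * B i k - A i l * B j k - A j k * B i l

/-- Symmetrisation of a `(0,4)`-tensor in all its arguments. -/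
def sym₄ (B : Fin n → Fin n → Fin n → Fin n → ℝ) (i j k l : Fin n) : ℝ :=
  (1 / 24) * ∑ σ : Equiv.Perm (Fin 4),
    B (![i, j, k, l] (σ 0)) (![i, j, k, l] (σ 1)) (![i, j, k, l] (σ 2)) (![i, j, k, l] (σ 3))

/-- The trace of the symmetrisation of a `(0,4)`-tensor. -/
def trSym₄ (g : Matrix (Fin n) (Fin n) ℝ) (B : Fin n → Fin n → Fin n → Fin n → ℝ)
    (k l : Fin n) : ℝ :=
  tr₂ g fun i j => sym₄ B i j k l

/-- The projection of `(0,4)`-tensors onto totally symmetric trace-free ones. -/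
def sym₄TraceFree (g : Matrix (Fin n) (Fin n) ℝ) (B : Fin n → Fin n → Fin n → Fin n → ℝ) :
    Fin n → Fin n → Fin n → Fin n → ℝ :=
  sym₄ fun i j k l => B i j k l - 6 / ((n : ℝ) + 4) *
    ((trSym₄ g B i j - tr₂ g (trSym₄ g B) * g i j / (2 * ((n : ℝ) + 2))) * g k l)

/-- Symmetrisation of a `(0,4)`-tensor in its first three arguments. -/
def sym₃ (B : Fin n → Fin n → Fin n → Fin n → ℝ) (i j k l : Fin n) : ℝ :=
  (1 / 6) * ∑ σ : Equiv.Perm (Fin 3),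
    B (![i, j, k] (σ 0)) (![i, j, k] (σ 1)) (![i, j, k] (σ 2)) l

/-- The projection of `(0,4)`-tensors onto those which are totally symmetric and trace-free in
their first three arguments. -/
def sym₃TraceFree (g : Matrix (Fin n) (Fin n) ℝ) (B : Fin n → Fin n → Fin n → Fin n → ℝ)
    (i j k l : Fin n) : ℝ :=
  sym₃ B i j k l - 3 / ((n : ℝ) + 2) *
    sym₃ (fun a b c d => g a b * tr₂ g fun p q => sym₃ B p q c d) i j k l

/-- The curvature-type part `B₁` of a `(0,4)`-tensor `B` that is symmetric in its first and in
its last pair of arguments. -/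
def curvPart (B : Fin n → Fin n → Fin n → Fin n → ℝ) (i j k l : Fin n) : ℝ :=
  (1 / 4) * (B i k j l - B i l j k - B j k i l + B j l i k)

/-- `𝓑(X, Y) = (n - 2)⁻¹ tr_g B₁(·, X, ·, Y)`. -/
def curvPartTrace (g : Matrix (Fin n) (Fin n) ℝ) (B : Fin n → Fin n → Fin n → Fin n → ℝ)
    (i j : Fin n) : ℝ :=
  1 / ((n : ℝ) - 2) * tr₂ g fun a b => curvPart B a i b j

/-- The algebraic Weyl part (totally trace-free part of `B₁`) of `B`. -/
def weylPart (g : Matrix (Fin n) (Fin n) ℝ) (B : Fin n → Fin n → Fin n → Fin n → ℝ)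
    (i j k l : Fin n) : ℝ :=
  curvPart B i j k l - kulkarniNomizu
    (fun a b => curvPartTrace g B a b - tr₂ g (curvPartTrace g B) / (2 * ((n : ℝ) - 1)) * g a b)
    g i j k l

/-- The `(0,4)`-tensor `S₁` built from `S` and `τ = dt`:
`S₁(X, Y, Z)(W) = g(S_X S_Y Z, W) + 3 S(X, Y, W) dt(Z) + S(X, Y, Z) dt(W)
  + (4 / (n - 2) 𝒮(Y, Z) - 3 S(Y, Z, grad t)) g(X, W)`. -/
def S₁ (g : Matrix (Fin n) (Fin n) ℝ) (S : Fin n → Fin n → Fin n → ℝ) (τ : Fin n → ℝ)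
    (i j k l : Fin n) : ℝ :=
  compEndo g S i j k l + 3 * S i j l * τ k + S i j k * τ l
    + (4 / ((n : ℝ) - 2) * trEndo g S j k - 3 * tr₂ g (fun a b => S j k a * τ b)) * g i l

end Pointwise

/-! ## Pseudo-Riemannian geometry in local coordinates

`g x` is the Gram matrix of the metric in the coordinate frame at the point with coordinates `x`.
-/

section Local

variable {n : ℕ}

/-- The partial derivative `∂_i F`. -/
def pd (i : Fin n) (F : EuclideanSpace ℝ (Fin n) → ℝ) (x : EuclideanSpace ℝ (Fin n)) : ℝ :=
  fderiv ℝ F x (EuclideanSpace.single i 1)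

/-- The Christoffel symbols `Γ^k_{ij}` of the Levi-Civita connection of `g`. -/
def christoffel (g : EuclideanSpace ℝ (Fin n) → Matrix (Fin n) (Fin n) ℝ) (k i j : Fin n)
    (x : EuclideanSpace ℝ (Fin n)) : ℝ :=
  (1 / 2) * ∑ l, (g x)⁻¹ k l *
    (pd i (fun y => g y j l) x + pd j (fun y => g y i l) x - pd l (fun y => g y i j) x)

/-- The curvature components `R^l_{kij}`, i.e. `R(∂_i, ∂_j) ∂_k = R^l_{kij} ∂_l` with
`R(X, Y) = [∇_X, ∇_Y] - ∇_{[X, Y]}`. -/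
def riemann (g : EuclideanSpace ℝ (Fin n) → Matrix (Fin n) (Fin n) ℝ) (l k i j : Fin n)
    (x : EuclideanSpace ℝ (Fin n)) : ℝ :=
  pd i (christoffel g l j k) x - pd j (christoffel g l i k) x
    + ∑ m, (christoffel g l i m x * christoffel g m j k x
      - christoffel g l j m x * christoffel g m i k x)

/-- The Ricci tensor `Ric(X, Y) = tr (Z ↦ R(Z, X) Y)`. -/
def ricci (g : EuclideanSpace ℝ (Fin n) → Matrix (Fin n) (Fin n) ℝ)
    (x : EuclideanSpace ℝ (Fin n)) (i j : Fin n) : ℝ :=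
  ∑ a, riemann g a j a i x

/-- The Schouten tensor `P = (n - 2)⁻¹ (Ric - tr_g Ric / (2 (n - 1)) g)`. -/
def schouten (g : EuclideanSpace ℝ (Fin n) → Matrix (Fin n) (Fin n) ℝ)
    (x : EuclideanSpace ℝ (Fin n)) (i j : Fin n) : ℝ :=
  1 / ((n : ℝ) - 2) *
    (ricci g x i j - tr₂ (g x) (ricci g x) / (2 * ((n : ℝ) - 1)) * g x i j)

/-- The `(0,4)` Weyl tensor `Riem - P ∧ g` (Kulkarni-Nomizu product), where
`Riem(X, Y, Z, W) = g(R(X, Y) W, Z)`; with this order of the arguments the unit sphere has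
`Riem = (1 / 2) g ∧ g`. -/
def weyl (g : EuclideanSpace ℝ (Fin n) → Matrix (Fin n) (Fin n) ℝ)
    (x : EuclideanSpace ℝ (Fin n)) (i j k l : Fin n) : ℝ :=
  ∑ a, g x k a * riemann g a l i j x - kulkarniNomizu (schouten g x) (g x) i j k l

/-- `(∇_i u)_j` for a one-form `u`. -/
def covDeriv₁ (g : EuclideanSpace ℝ (Fin n) → Matrix (Fin n) (Fin n) ℝ)
    (u : EuclideanSpace ℝ (Fin n) → Fin n → ℝ) (x : EuclideanSpace ℝ (Fin n))
    (i j : Fin n) : ℝ :=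
  pd i (fun y => u y j) x - ∑ a, christoffel g a i j x * u x a

/-- `(∇_l T)_{ijk}` for a `(0,3)`-tensor `T`; the last index is the direction of
differentiation. -/
def covDeriv₃ (g : EuclideanSpace ℝ (Fin n) → Matrix (Fin n) (Fin n) ℝ)
    (T : EuclideanSpace ℝ (Fin n) → Fin n → Fin n → Fin n → ℝ) (x : EuclideanSpace ℝ (Fin n))
    (i j k l : Fin n) : ℝ :=
  pd l (fun y => T y i j k) x
    - ∑ a, (christoffel g a l i x * T x a j k + christoffel g a l j x * T x i a k
      + christoffel g a l k x * T x i j a)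

end Local

/-! ## Tensor fields on a manifold and their components in charts -/

section Manifold

variable {n : ℕ} {M : Type*} [TopologicalSpace M] [ChartedSpace (EuclideanSpace ℝ (Fin n)) M]

/-- The coordinate vector `∂_i` of the chart `e`, at the point with coordinates `x`. -/
def coordVec (e : OpenPartialHomeomorph M (EuclideanSpace ℝ (Fin n)))
    (x : EuclideanSpace ℝ (Fin n)) (i : Fin n) : TangentSpace (𝓡 n) (e.symm x) :=
  mfderiv (𝓡 n) (𝓡 n) e.symm x (EuclideanSpace.single i (1 : ℝ))

/-- The components of a one-form in the chart `e`. -/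
def comp₁ (u : ∀ p : M, TangentSpace (𝓡 n) p → ℝ)
    (e : OpenPartialHomeomorph M (EuclideanSpace ℝ (Fin n))) (x : EuclideanSpace ℝ (Fin n))
    (i : Fin n) : ℝ :=
  u (e.symm x) (coordVec e x i)

/-- The components of a `(0,2)`-tensor field in the chart `e`. -/
def comp₂ (g : ∀ p : M, TangentSpace (𝓡 n) p → TangentSpace (𝓡 n) p → ℝ)
    (e : OpenPartialHomeomorph M (EuclideanSpace ℝ (Fin n))) (x : EuclideanSpace ℝ (Fin n)) :
    Matrix (Fin n) (Fin n) ℝ :=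
  Matrix.of fun i j => g (e.symm x) (coordVec e x i) (coordVec e x j)

/-- The components of a `(0,3)`-tensor field in the chart `e`. -/
def comp₃
    (T : ∀ p : M, TangentSpace (𝓡 n) p → TangentSpace (𝓡 n) p → TangentSpace (𝓡 n) p → ℝ)
    (e : OpenPartialHomeomorph M (EuclideanSpace ℝ (Fin n))) (x : EuclideanSpace ℝ (Fin n))
    (i j k : Fin n) : ℝ :=
  T (e.symm x) (coordVec e x i) (coordVec e x j) (coordVec e x k)

/-- The trace of a bilinear form `B` on `T_pM` with respect to `g`, computed in the standard
basis of the model space `T_pM = ℝⁿ` (it does not depend on the basis). -/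
def trAt (g : ∀ p : M, TangentSpace (𝓡 n) p → TangentSpace (𝓡 n) p → ℝ) (p : M)
    (B : TangentSpace (𝓡 n) p → TangentSpace (𝓡 n) p → ℝ) : ℝ :=
  let b : Fin n → TangentSpace (𝓡 n) p := fun i => EuclideanSpace.single i (1 : ℝ)
  tr₂ (Matrix.of fun i j => g p (b i) (b j)) fun i j => B (b i) (b j)

/-- `g` is a smooth pseudo-Riemannian metric (of any signature). -/
structure IsPseudoRiemannianMetric
    (g : ∀ p : M, TangentSpace (𝓡 n) p → TangentSpace (𝓡 n) p → ℝ) : Prop where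
  linear : ∀ p X, IsLinearMap ℝ (g p X)
  symm : ∀ p X Y, g p X Y = g p Y X
  nondegenerate : ∀ p X, (∀ Y, g p X Y = 0) → X = 0
  smooth : ∀ e ∈ IsManifold.maximalAtlas (𝓡 n) ∞ M, ∀ i j,
    ContDiffOn ℝ ∞ (fun x => comp₂ g e x i j) e.target

/-- `T` is a smooth totally symmetric `(0,3)`-tensor field. -/
structure IsSymmetricCubicTensor
    (T : ∀ p : M, TangentSpace (𝓡 n) p → TangentSpace (𝓡 n) p → TangentSpace (𝓡 n) p → ℝ) :
    Prop where
  linear : ∀ p X Y, IsLinearMap ℝ (T p X Y)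
  symm₁₂ : ∀ p X Y Z, T p X Y Z = T p Y X Z
  symm₂₃ : ∀ p X Y Z, T p X Y Z = T p X Z Y
  smooth : ∀ e ∈ IsManifold.maximalAtlas (𝓡 n) ∞ M, ∀ i j k,
    ContDiffOn ℝ ∞ (fun x => comp₃ T e x i j k) e.target

/-- `g` is (locally) conformally flat: near every point there is a smooth function `φ` such that
`e^{2φ} g` is flat. -/
def IsConformallyFlat (g : ∀ p : M, TangentSpace (𝓡 n) p → TangentSpace (𝓡 n) p → ℝ) : Prop :=
  ∀ p : M, ∃ e ∈ IsManifold.maximalAtlas (𝓡 n) ∞ M, p ∈ e.source ∧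
    ∃ φ : EuclideanSpace ℝ (Fin n) → ℝ, ContDiffOn ℝ ∞ φ e.target ∧
      ∀ x ∈ e.target, ∀ l k i j,
        riemann (fun y => Real.exp (2 * φ y) • comp₂ g e y) l k i j x = 0

/-- The Weyl tensor of `g` vanishes. -/
def IsWeylFlat (g : ∀ p : M, TangentSpace (𝓡 n) p → TangentSpace (𝓡 n) p → ℝ) : Prop :=
  ∀ e ∈ IsManifold.maximalAtlas (𝓡 n) ∞ M, ∀ x ∈ e.target, ∀ i j k l,
    weyl (comp₂ g e) x i j k l = 0

/-- `(M, g, S, t)` is an abundant manifold (`n = dim M ≥ 3`). -/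
structure IsAbundantManifold
    (g : ∀ p : M, TangentSpace (𝓡 n) p → TangentSpace (𝓡 n) p → ℝ)
    (S : ∀ p : M, TangentSpace (𝓡 n) p → TangentSpace (𝓡 n) p → TangentSpace (𝓡 n) p → ℝ)
    (t : M → ℝ) : Prop where
  metric : IsPseudoRiemannianMetric g
  conformallyFlat : IsConformallyFlat g
  cubic : IsSymmetricCubicTensor S
  traceFree : ∀ p X, trAt g p (S p X) = 0
  smooth : ContMDiff (𝓡 n) 𝓘(ℝ, ℝ) ∞ t
  /-- `∇²t = 3 P + (1/3) (dt² - (1/2) |grad t|² g)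
    + (1 / (3 (n - 2))) (𝒮 + (n - 6) |S|² g / (2 (n - 1) (n + 2)))`. -/
  hessian : ∀ e ∈ IsManifold.maximalAtlas (𝓡 n) ∞ M, ∀ x ∈ e.target, ∀ i j,
    let γ := comp₂ g e
    let σ := comp₃ S e
    let τ := comp₁ (fun p => mvfderiv (𝓡 n) t p) e
    covDeriv₁ γ τ x i j =
      3 * schouten γ x i j
      + 1 / 3 * (τ x i * τ x j - 1 / 2 * normSq₁ (γ x) (τ x) * γ x i j)
      + 1 / (3 * ((n : ℝ) - 2)) * (trEndo (γ x) (σ x) i j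
        + ((n : ℝ) - 6) * normSq₃ (γ x) (σ x) * γ x i j / (2 * ((n : ℝ) - 1) * ((n : ℝ) + 2)))
  /-- `∇S = (1/3) Π S₁`, with `Π` the projection onto tensors that are totally symmetric and
  trace-free in the first three arguments. -/
  covDeriv : ∀ e ∈ IsManifold.maximalAtlas (𝓡 n) ∞ M, ∀ x ∈ e.target, ∀ i j k l,
    let γ := comp₂ g e
    let σ := comp₃ S e
    let τ := comp₁ (fun p => mvfderiv (𝓡 n) t p) e
    covDeriv₃ γ σ x i j k l =
      1 / 3 * sym₃TraceFree (γ x) (S₁ (γ x) (σ x) (τ x)) i j k l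
  /-- The algebraic Weyl part of `(X, Y, Z, W) ↦ g(S_X Y, S_Z W)` vanishes. -/
  weyl : ∀ e ∈ IsManifold.maximalAtlas (𝓡 n) ∞ M, ∀ x ∈ e.target, ∀ i j k l,
    let γ := comp₂ g e
    let σ := comp₃ S e
    weylPart (γ x) (pairEndo (γ x) (σ x)) i j k l = 0

/-! ## Affine hypersurfaces with a co-normal field -/

/-- The affine fundamental form `G(X, Y) = -(D_X Ξ)(df Y)`. -/
def affineMetric (f : M → EuclideanSpace ℝ (Fin (n + 1)))
    (Ξ : M → EuclideanSpace ℝ (Fin (n + 1)) →L[ℝ] ℝ) (p : M) (X Y : TangentSpace (𝓡 n) p) : ℝ :=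
  -(mvfderiv (𝓡 n) Ξ p X) (mvfderiv (𝓡 n) f p Y)

/-- `(f, Ξ)` is a smooth non-degenerate hypersurface immersion with a nowhere vanishing
co-normal field. -/
structure IsCoNormalisation (f : M → EuclideanSpace ℝ (Fin (n + 1)))
    (Ξ : M → EuclideanSpace ℝ (Fin (n + 1)) →L[ℝ] ℝ) : Prop where
  smooth_f : ContMDiff (𝓡 n) 𝓘(ℝ, EuclideanSpace ℝ (Fin (n + 1))) ∞ f
  smooth_Ξ : ContMDiff (𝓡 n) 𝓘(ℝ, EuclideanSpace ℝ (Fin (n + 1)) →L[ℝ] ℝ) ∞ Ξ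
  immersion : ∀ p, Function.Injective (mvfderiv (𝓡 n) f p)
  ne_zero : ∀ p, Ξ p ≠ 0
  conormal : ∀ p X, Ξ p (mvfderiv (𝓡 n) f p X) = 0
  nondegenerate : ∀ p X, (∀ Y, affineMetric f Ξ p X Y = 0) → X = 0

/-- The relative transversal field `ξ` dual to `Ξ`, i.e. the unique one such that
`⟨Ξ, ξ⟩ = 1` and `⟨D_X Ξ, ξ⟩ = 0` for all tangent vectors `X`. -/
def transversal (Ξ : M → EuclideanSpace ℝ (Fin (n + 1)) →L[ℝ] ℝ) (p : M) :
    EuclideanSpace ℝ (Fin (n + 1)) :=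
  Classical.epsilon fun v => Ξ p v = 1 ∧ ∀ X, mvfderiv (𝓡 n) Ξ p X v = 0

/-- The induced connection: `∇_X Y` at `p` is the unique tangent vector such that
`D_X (df Y) = df (∇_X Y) + G(X, Y) ξ`. -/
def inducedConnection (f : M → EuclideanSpace ℝ (Fin (n + 1)))
    (Ξ : M → EuclideanSpace ℝ (Fin (n + 1)) →L[ℝ] ℝ) (p : M) (X : TangentSpace (𝓡 n) p)
    (Y : ∀ q : M, TangentSpace (𝓡 n) q) : TangentSpace (𝓡 n) p :=
  Classical.epsilon fun V : TangentSpace (𝓡 n) p =>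
    mvfderiv (𝓡 n) (fun q => mvfderiv (𝓡 n) f q (Y q)) p X =
      mvfderiv (𝓡 n) f p V + affineMetric f Ξ p X (Y p) • transversal Ξ p

variable [IsManifold (𝓡 n) ∞ M]

/-- The vector `X ∈ T_pM` extended to a vector field that is smooth near `p`. -/
def extendVec {p : M} (X : TangentSpace (𝓡 n) p) (q : M) : TangentSpace (𝓡 n) q :=
  haveI : IsManifold (𝓡 n) 1 M := .of_le (n := ∞) (by simp)
  FiberBundle.extend (EuclideanSpace ℝ (Fin n)) X q

/-- `(∇_X G)(Y, Z) = X (G(Y, Z)) - G(∇_X Y, Z) - G(Y, ∇_X Z)`. -/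
def nablaMetric (f : M → EuclideanSpace ℝ (Fin (n + 1)))
    (Ξ : M → EuclideanSpace ℝ (Fin (n + 1)) →L[ℝ] ℝ) (p : M)
    (X Y Z : TangentSpace (𝓡 n) p) : ℝ :=
  mvfderiv (𝓡 n) (fun q => affineMetric f Ξ q (extendVec Y q) (extendVec Z q)) p X
    - affineMetric f Ξ p (inducedConnection f Ξ p X (extendVec Y)) Z
    - affineMetric f Ξ p Y (inducedConnection f Ξ p X (extendVec Z))

/-- The cubic `C = -(1/2) ∇G`. -/
def cubicForm (f : M → EuclideanSpace ℝ (Fin (n + 1)))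
    (Ξ : M → EuclideanSpace ℝ (Fin (n + 1)) →L[ℝ] ℝ) (p : M)
    (X Y Z : TangentSpace (𝓡 n) p) : ℝ :=
  -(1 / 2) * nablaMetric f Ξ p X Y Z

/-- The trace part `u = (n + 2)⁻¹ tr_G C` of the cubic. -/
def cubicTrace (f : M → EuclideanSpace ℝ (Fin (n + 1)))
    (Ξ : M → EuclideanSpace ℝ (Fin (n + 1)) →L[ℝ] ℝ) (p : M) (X : TangentSpace (𝓡 n) p) : ℝ :=
  1 / ((n : ℝ) + 2) * trAt (affineMetric f Ξ) p (cubicForm f Ξ p X)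

/-- The trace-free part `U` of the cubic:
`U(X, Y, Z) = C(X, Y, Z) - u(X) G(Y, Z) - u(Y) G(X, Z) - u(Z) G(X, Y)`. -/
def cubicTraceFree (f : M → EuclideanSpace ℝ (Fin (n + 1)))
    (Ξ : M → EuclideanSpace ℝ (Fin (n + 1)) →L[ℝ] ℝ) (p : M)
    (X Y Z : TangentSpace (𝓡 n) p) : ℝ :=
  cubicForm f Ξ p X Y Z - (cubicTrace f Ξ p X * affineMetric f Ξ p Y Z
    + cubicTrace f Ξ p Y * affineMetric f Ξ p X Z + cubicTrace f Ξ p Z * affineMetric f Ξ p X Y)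

/-- `(f, Ξ)` is an abundant hypersurface co-normalisation (`n = dim M ≥ 3`). -/
structure IsAbundantCoNormalisation (f : M → EuclideanSpace ℝ (Fin (n + 1)))
    (Ξ : M → EuclideanSpace ℝ (Fin (n + 1)) →L[ℝ] ℝ) : Prop where
  coNormalisation : IsCoNormalisation f Ξ
  weylFlat : IsWeylFlat (affineMetric f Ξ)
  /-- `Π (∇U) = Π (𝔘 + 4 U ⊗ u)`, with `Π` the projection onto totally symmetric trace-free
  tensors and `𝔘(X, Y, Z, W) = G(U_X U_Y W, Z)`. -/
  covDeriv_U : ∀ e ∈ IsManifold.maximalAtlas (𝓡 n) ∞ M, ∀ x ∈ e.target, ∀ i j k l,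
    let γ := comp₂ (affineMetric f Ξ) e
    let U := comp₃ (cubicTraceFree f Ξ) e
    let u := comp₁ (cubicTrace f Ξ) e
    sym₄TraceFree (γ x) (covDeriv₃ γ U x) i j k l =
      sym₄TraceFree (γ x)
        (fun a b c d => compEndo (γ x) (U x) a b d c + 4 * (U x a b c * u x d)) i j k l
  /-- `∇u = P + u ⊗ u - (1/2) |u|² G
    + (1 / (n - 2)) (𝒰 + (n - 6) / (2 (n + 2) (n - 1)) |U|² G)`. -/
  covDeriv_u : ∀ e ∈ IsManifold.maximalAtlas (𝓡 n) ∞ M, ∀ x ∈ e.target, ∀ i j,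
    let γ := comp₂ (affineMetric f Ξ) e
    let U := comp₃ (cubicTraceFree f Ξ) e
    let u := comp₁ (cubicTrace f Ξ) e
    covDeriv₁ γ u x i j =
      schouten γ x i j + u x i * u x j - normSq₁ (γ x) (u x) / 2 * γ x i j
      + 1 / ((n : ℝ) - 2) * (trEndo (γ x) (U x) i j
        + ((n : ℝ) - 6) / (2 * ((n : ℝ) + 2) * ((n : ℝ) - 1))
          * normSq₃ (γ x) (U x) * γ x i j)

end Manifold

end Abundant

end

noncomputable section

namespace Abundant

variable {n : ℕ}

/-! In a chart, `(f, Ξ)` is a pair of vector-valued functions, and the flatness of `ℝⁿ⁺¹` gives the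
Gauss and Codazzi equations for `G` and `C` (`codazzi_and_gauss`). Besides `G` and `C` they contain
one symmetric tensor `b`, the component of the second derivatives of `Ξ` along the transversal
field.

Weyl condition. As the Weyl tensor of `G` vanishes, the curvature is the Kulkarni-Nomizu product `P
∧ G`. The trace part of `C` also contributes only products with `G` (`withTrace_commutator`). So the
Gauss equation says that the commutator of the endomorphisms of `U` is a product `-Q ∧ G`, which is
the algebraic Weyl condition on `𝔖` (`weylPart_pairEndo`). A contraction then expresses `Q`, and
with it `b`, through `𝒰`, `P` and `u` up to multiples of `G` (`gram_eq_of_commutator`).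

Derivative of `U`. The Codazzi equation prescribes the skew part of `∇U` through `b / 2 + ∇u`; on
inserting the equation for `∇u`, the Schouten tensor cancels. The other hypothesis prescribes the
totally symmetric trace-free part. A tensor which is symmetric and trace-free in its first three
arguments is determined by these two parts, and the right-hand side required for `S = 3U`, `dt = 3u`
has the same ones (`eq_structureDeriv`, `commutator_and_covDeriv_U`). The Hessian equation is three
times the equation for `∇u`.

Conformal flatness. In dimension three the Weyl tensor carries no information, so the Cotton tensor
is shown to vanish, uniformly in `n` (`covDeriv_schouten_symm`). Solve the equation for `∇u` for `P`
and take the skew part of its derivative. The Ricci identity evaluates the part `∇∇u`; what remains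
is the algebraic identity `gramDeriv_antisymm`, which uses both the value of `∇U` and the product
form of the commutator. With vanishing Weyl and Cotton tensors the linear system `dσ = μ`, `∇μ = -σ
P + ρ G`, `dρ = -P(μ, ·)` is integrable, and the solution starting at `(σ, μ, ρ) = (1, 0, 0)` makes
`σ⁻² G` flat (`exists_conformal_flat`). The Frobenius theorem needed here is obtained by solving
ordinary differential equations along rays.

The function `t`. The covector `u` is, up to a constant, the logarithmic derivative of the quotient
of two volume densities, that of `G` and that of the coframe `(Ξ, dΞ)` (`pd_localPotential`). This
quotient does not depend on the frame (`potential_symm`), so it gives a global function by an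
explicit formula. -/

theorem sum_perm_fin_three {β : Type*} [AddCommMonoid β] (F : Equiv.Perm (Fin 3) → β) :
    ∑ σ, F σ = F 1 + F (Equiv.swap 0 1) + F (Equiv.swap 0 2) + F (Equiv.swap 1 2)
      + F (Equiv.swap 0 1 * Equiv.swap 0 2) + F (Equiv.swap 0 2 * Equiv.swap 0 1) := by
  have h : (Finset.univ : Finset (Equiv.Perm (Fin 3))) =
      {1, Equiv.swap 0 1, Equiv.swap 0 2, Equiv.swap 1 2,
     Equiv.swap 0 1 * Equiv.swap 0 2, Equiv.swap 0 2 * Equiv.swap 0 1} := by decide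
  rw [h]
  rw [Finset.sum_insert (by decide), Finset.sum_insert (by decide), Finset.sum_insert (by decide),
      Finset.sum_insert (by decide), Finset.sum_insert (by decide), Finset.sum_singleton]
  simp only [add_assoc]

/-! ### Symmetrisations written out. -/

theorem sym₃_apply (B : Fin n → Fin n → Fin n → Fin n → ℝ) (i j k l : Fin n) :
    sym₃ B i j k l = (B i j k l + B j i k l + B k j i l + B i k j l + B j k i l + B k i j l) / 6 :=
        by
  rw [sym₃, sum_perm_fin_three]
  simp [Equiv.swap_apply_def]
  ring

/-- The sum of a `(0,3)`-tensor over all permutations of its arguments. -/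
def permSum₃ (B : Fin n → Fin n → Fin n → ℝ) (i j k : Fin n) : ℝ :=
  B i j k + B j i k + B k j i + B i k j + B j k i + B k i j

/-- A permutation of four letters is the image of `0` together with a permutation of the other three
(`Equiv.Perm.decomposeFin`); this groups the 24 terms by their first argument. -/
theorem sym₄_apply (B : Fin n → Fin n → Fin n → Fin n → ℝ) (i j k l : Fin n) :
    sym₄ B i j k l = (permSum₃ (B i) j k l + permSum₃ (B j) i k l + permSum₃ (B k) j i l
      + permSum₃ (B l) j k i) / 24 := by
  have h (F : Equiv.Perm (Fin 4) → ℝ) : ∑ σ, F σ = ∑ p : Fin 4, ∑ τ : Equiv.Perm (Fin 3), F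
      (Equiv.Perm.decomposeFin.symm (p, τ)) := by
    rw [← Equiv.sum_comp Equiv.Perm.decomposeFin.symm, Fintype.sum_prod_type]
  have e2 (p : Fin 4) (τ : Equiv.Perm (Fin 3)) : Equiv.Perm.decomposeFin.symm (p, τ) 2 = Equiv.swap
      0 p (τ 1).succ :=
    Equiv.Perm.decomposeFin_symm_apply_succ τ p 1
  have e3 (p : Fin 4) (τ : Equiv.Perm (Fin 3)) : Equiv.Perm.decomposeFin.symm (p, τ) 3 = Equiv.swap
      0 p (τ 2).succ :=
    Equiv.Perm.decomposeFin_symm_apply_succ τ p 2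
  rw [sym₄, h]
  simp only [sum_perm_fin_three, Fin.sum_univ_four, Equiv.Perm.decomposeFin_symm_apply_zero,
      Equiv.Perm.decomposeFin_symm_apply_one, e2, e3]
  simp [Equiv.swap_apply_def, permSum₃, Fin.ext_iff]
  ring

/-! ### Contractions with a metric -/

/-- The bilinear form `g^{ab} α_a β_b` on covectors. -/
def ip (g : Matrix (Fin n) (Fin n) ℝ) (α β : Fin n → ℝ) : ℝ := tr₂ g fun a b => α a * β b

/-- The bilinear form `g^{ab} g^{cd} A_{ac} B_{bd}` on `(0,2)`-tensors. -/
def ip₂ (g : Matrix (Fin n) (Fin n) ℝ) (A B : Fin n → Fin n → ℝ) : ℝ :=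
  tr₂ g fun a b => ip g (A a) (B b)

section Contractions

variable {g : Matrix (Fin n) (Fin n) ℝ}

theorem tr₂_add (A B : Fin n → Fin n → ℝ) :
    tr₂ g (fun i j => A i j + B i j) = tr₂ g (fun i j => A i j) + tr₂ g (fun i j => B i j) := by
  simp only [tr₂, mul_add, Finset.sum_add_distrib]

theorem tr₂_sub (A B : Fin n → Fin n → ℝ) :
    tr₂ g (fun i j => A i j - B i j) = tr₂ g (fun i j => A i j) - tr₂ g (fun i j => B i j) := by
  simp only [tr₂, mul_sub, Finset.sum_sub_distrib]

theorem tr₂_neg (A : Fin n → Fin n → ℝ) :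
    tr₂ g (fun i j => -A i j) = -tr₂ g (fun i j => A i j) := by
  simp only [tr₂, mul_neg, Finset.sum_neg_distrib]

theorem tr₂_const_mul (c : ℝ) (A : Fin n → Fin n → ℝ) :
    tr₂ g (fun i j => c * A i j) = c * tr₂ g (fun i j => A i j) := by
  simp only [tr₂, Finset.mul_sum]
  exact Finset.sum_congr rfl fun _ _ => Finset.sum_congr rfl fun _ _ => by ring

theorem tr₂_mul_const (c : ℝ) (A : Fin n → Fin n → ℝ) :
    tr₂ g (fun i j => A i j * c) = tr₂ g (fun i j => A i j) * c := by
  simp only [mul_comm _ c, tr₂_const_mul]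

theorem tr₂_zero : tr₂ g (fun _ _ => 0) = 0 := by simp [tr₂]

theorem tr₂_sum {ι : Type*} (s : Finset ι) (A : ι → Fin n → Fin n → ℝ) :
    tr₂ g (fun i j => ∑ c ∈ s, A c i j) = ∑ c ∈ s, tr₂ g (A c) := by
  simp only [tr₂, Finset.mul_sum]
  rw [Finset.sum_comm]
  conv_rhs => rw [Finset.sum_comm]
  rw [Finset.sum_comm]
  refine Finset.sum_congr rfl fun _ _ => ?_
  rw [Finset.sum_comm]

theorem tr₂_comm (A : Fin n → Fin n → Fin n → Fin n → ℝ) :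
    tr₂ g (fun a b => tr₂ g fun c d => A a b c d) =
      tr₂ g (fun c d => tr₂ g fun a b => A a b c d) := by
  have h1 (a b : Fin n) : tr₂ g (fun c d => A a b c d) = ∑ c, ∑ d, g⁻¹ c d * A a b c d := rfl
  simp only [h1, tr₂_sum, tr₂_const_mul]
  rfl

theorem inv_symm (hs : ∀ i j, g i j = g j i) (i j : Fin n) : g⁻¹ i j = g⁻¹ j i := by
  have h : g.transpose = g := by ext i j; exact hs j i
  conv_lhs => rw [← h, ← Matrix.transpose_nonsing_inv]
  rfl

theorem tr₂_swap (hs : ∀ i j, g i j = g j i) (A : Fin n → Fin n → ℝ) :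
    tr₂ g (fun i j => A j i) = tr₂ g A := by
  simp only [tr₂]
  rw [Finset.sum_comm]
  simp only [inv_symm hs]

theorem ip_comm (hs : ∀ i j, g i j = g j i) (α β : Fin n → ℝ) : ip g α β = ip g β α := by
  rw [ip, ip, ← tr₂_swap hs]
  simp only [mul_comm]

theorem ip_add_left (α β γ : Fin n → ℝ) : ip g (α + β) γ = ip g α γ + ip g β γ := by
  simp only [ip, Pi.add_apply, add_mul, tr₂_add]

theorem ip_add_right (α β γ : Fin n → ℝ) : ip g α (β + γ) = ip g α β + ip g α γ := by
  simp only [ip, Pi.add_apply, mul_add, tr₂_add]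

theorem ip_sub_left (α β γ : Fin n → ℝ) : ip g (α - β) γ = ip g α γ - ip g β γ := by
  simp only [ip, Pi.sub_apply, sub_mul, tr₂_sub]

theorem ip_sub_right (α β γ : Fin n → ℝ) : ip g α (β - γ) = ip g α β - ip g α γ := by
  simp only [ip, Pi.sub_apply, mul_sub, tr₂_sub]

theorem ip_smul_left (c : ℝ) (α β : Fin n → ℝ) : ip g (c • α) β = c * ip g α β := by
  simp only [ip, Pi.smul_apply, smul_eq_mul, mul_assoc, tr₂_const_mul]

theorem ip_smul_right (c : ℝ) (α β : Fin n → ℝ) : ip g α (c • β) = c * ip g α β := by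
  simp only [ip, Pi.smul_apply, smul_eq_mul, mul_left_comm, tr₂_const_mul]

theorem ip_zero_right (α : Fin n → ℝ) : ip g α 0 = 0 := by
  simp [ip, tr₂]

/-- The row `g i` is the coordinate vector `∂_i` with its index lowered, so pairing with it
evaluates the other covector at `i`. Together with bilinearity this does most of the index raising
and lowering below. -/
theorem ip_metric_left (hd : IsUnit g.det) (i : Fin n)
    (β : Fin n → ℝ) : ip g (g i) β = β i := by
  have h (b : Fin n) : ∑ a, g i a * g⁻¹ a b = if i = b then 1 else 0 := by
    rw [← Matrix.mul_apply, Matrix.mul_nonsing_inv _ hd, Matrix.one_apply]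
  rw [ip, tr₂, Finset.sum_comm]
  have (b : Fin n) : ∑ a, g⁻¹ a b * (g i a * β b) = (if i = b then 1 else 0) * β b := by
    rw [← h, Finset.sum_mul]
    exact Finset.sum_congr rfl fun _ _ => by ring
  simp [this]

theorem ip_metric_right (hs : ∀ i j, g i j = g j i) (hd : IsUnit g.det) (i : Fin n)
    (β : Fin n → ℝ) : ip g β (g i) = β i := by
  rw [ip_comm hs, ip_metric_left hd]

theorem tr₂_metric (hs : ∀ i j, g i j = g j i) (hd : IsUnit g.det) : tr₂ g g = n := by
  have h (a : Fin n) : ∑ b, g⁻¹ a b * g a b = 1 := by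
    simp only [hs a]
    rw [← Matrix.mul_apply, Matrix.nonsing_inv_mul _ hd, Matrix.one_apply_eq]
  simp [tr₂, h]

theorem ip₂_comm (hs : ∀ i j, g i j = g j i) (A B : Fin n → Fin n → ℝ) :
    ip₂ g A B = ip₂ g B A := by
  rw [ip₂, ip₂, ← tr₂_swap hs]
  simp only [ip_comm hs]

theorem ip₂_add_left (A B D : Fin n → Fin n → ℝ) : ip₂ g (A + B) D = ip₂ g A D + ip₂ g B D := by
  simp only [ip₂, Pi.add_apply, ip_add_left, tr₂_add]

theorem ip₂_sub_left (A B D : Fin n → Fin n → ℝ) : ip₂ g (A - B) D = ip₂ g A D - ip₂ g B D := by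
  simp only [ip₂, Pi.sub_apply, ip_sub_left, tr₂_sub]

theorem ip₂_smul_left (c : ℝ) (A B : Fin n → Fin n → ℝ) : ip₂ g (c • A) B = c * ip₂ g A B := by
  simp only [ip₂, Pi.smul_apply, ip_smul_left, tr₂_const_mul]

theorem ip₂_transpose (A B : Fin n → Fin n → ℝ) :
    ip₂ g (fun a b => A b a) (fun a b => B b a) = ip₂ g A B := by
  simp only [ip₂, ip]
  rw [tr₂_comm]

theorem ip₂_metric_left (hs : ∀ i j, g i j = g j i) (hd : IsUnit g.det)
    (B : Fin n → Fin n → ℝ) : ip₂ g g B = tr₂ g B := by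
  simp only [ip₂, ip_metric_left hd]
  exact tr₂_swap hs B

theorem ip₂_mul_left (α β : Fin n → ℝ) (B : Fin n → Fin n → ℝ) :
    ip₂ g (fun a b => α a * β b) B = ip g α fun a => ip g β (B a) := by
  simp only [ip₂, ip, mul_assoc, tr₂_const_mul]

theorem tr₂_ip (α : Fin n → ℝ) (V : Fin n → Fin n → Fin n → ℝ) :
    tr₂ g (fun a b => ip g α (V a b)) = ip g α fun d => tr₂ g fun a b => V a b d := by
  simp only [ip]
  rw [tr₂_comm]
  simp only [tr₂_const_mul]

theorem ip₂_ip_left (α : Fin n → ℝ) (V : Fin n → Fin n → Fin n → ℝ)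
    (B : Fin n → Fin n → ℝ) :
    ip₂ g (fun a b => ip g α (V a b)) B = ip g α fun d => ip₂ g (fun a b => V a b d) B := by
  have h1 (a b : Fin n) : ip g (fun c => ip g α (V a c)) (B b) =
      ip g α fun d => ip g (fun c => V a c d) (B b) := by
    simp only [ip, ← tr₂_mul_const]
    rw [tr₂_comm]
    simp only [mul_assoc, tr₂_const_mul]
  simp only [ip₂, h1]
  rw [tr₂_ip]

end Contractions

/-! ### Symmetric cubic tensors at a point. -/

section CubicAlgebra

variable {g : Matrix (Fin n) (Fin n) ℝ} {U : Fin n → Fin n → Fin n → ℝ}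

/-- The bridge from explicitly raised indices, as in `endo` and `christoffel`, to the pairing `ip`.
-/
theorem sum_raise_mul (hs : ∀ i j, g i j = g j i) (α β : Fin n → ℝ) :
    ∑ a, (∑ c, g⁻¹ a c * α c) * β a = ip g α β := by
  simp only [ip, tr₂, Finset.sum_mul]
  rw [Finset.sum_comm]
  refine Finset.sum_congr rfl fun c _ => Finset.sum_congr rfl fun a _ => ?_
  rw [inv_symm hs c a]
  ring

theorem trEndo_eq (hs : ∀ i j, g i j = g j i) (h₂₃ : ∀ i j k, U i j k = U i k j) (i j : Fin n) :
    trEndo g U i j = ip₂ g (U i) (U j) := by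
  simp only [trEndo, Matrix.trace, Matrix.diag, Matrix.mul_apply, ip₂, ← sum_raise_mul hs, endo,
    Matrix.of_apply]
  rw [Finset.sum_comm]
  simp only [tr₂]
  refine Finset.sum_congr rfl fun b _ => ?_
  simp only [Finset.mul_sum, Finset.sum_mul]
  rw [Finset.sum_comm]
  conv_rhs => rw [Finset.sum_comm]
  rw [Finset.sum_comm]
  refine Finset.sum_congr rfl fun a _ => ?_
  refine Finset.sum_congr rfl fun c _ => Finset.sum_congr rfl fun d _ => ?_
  rw [h₂₃ j a]
  ring

theorem compEndo_eq (hs : ∀ i j, g i j = g j i) (hd : IsUnit g.det)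
    (h₂₃ : ∀ i j k, U i j k = U i k j) (i j k l : Fin n) :
    compEndo g U i j k l = ip g (U i l) (U j k) := by
  have h (b : Fin n) : ∑ a, g l a * ∑ c, g⁻¹ a c * U i b c = U i l b := by
    rw [h₂₃ i l b, ← ip_metric_right hs hd l (U i b), ← sum_raise_mul hs]
    exact Finset.sum_congr rfl fun _ _ => mul_comm _ _
  simp only [compEndo, Matrix.mul_apply, endo, Matrix.of_apply, Finset.mul_sum]
  rw [Finset.sum_comm, ip_comm hs, ← sum_raise_mul hs]
  refine Finset.sum_congr rfl fun b _ => ?_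
  rw [← h b, Finset.mul_sum]
  refine Finset.sum_congr rfl fun a _ => ?_
  rw [Finset.mul_sum]
  simp only [Finset.sum_mul, Finset.mul_sum]
  rw [Finset.sum_comm]
  refine Finset.sum_congr rfl fun c _ => Finset.sum_congr rfl fun d _ => ?_
  ring

theorem pairEndo_eq (hs : ∀ i j, g i j = g j i) (hd : IsUnit g.det) (i j k l : Fin n) :
    pairEndo g U i j k l = ip g (U i j) (U k l) := by
  have h (b : Fin n) : ∑ a, g a b * ∑ c, g⁻¹ a c * U i j c = U i j b := by
    rw [← ip_metric_right hs hd b (U i j), ← sum_raise_mul hs]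
    exact Finset.sum_congr rfl fun a _ => by rw [hs a b, mul_comm]
  simp only [pairEndo, endo, Matrix.of_apply]
  rw [Finset.sum_comm, ip_comm hs, ← sum_raise_mul hs]
  refine Finset.sum_congr rfl fun b _ => ?_
  rw [← Finset.sum_mul, h, mul_comm]

theorem normSq₃_eq : normSq₃ g U = tr₂ g fun i j => ip₂ g (U i) (U j) := by
  simp only [normSq₃, ip₂, ip, tr₂, Finset.mul_sum]
  refine Finset.sum_congr rfl fun i _ => ?_
  have (F : Fin n → Fin n → Fin n → Fin n → Fin n → ℝ) :
      ∑ j, ∑ k, ∑ a, ∑ b, ∑ c, F j k a b c = ∑ a, ∑ j, ∑ b, ∑ k, ∑ c, F j k a b c := by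
    rw [Finset.sum_congr rfl fun j _ => Finset.sum_comm, Finset.sum_comm]
    refine Finset.sum_congr rfl fun a _ => Finset.sum_congr rfl fun j _ => ?_
    rw [Finset.sum_comm]
  rw [this]
  refine Finset.sum_congr rfl fun i _ => Finset.sum_congr rfl fun _ _ =>
    Finset.sum_congr rfl fun _ _ => Finset.sum_congr rfl fun _ _ =>
    Finset.sum_congr rfl fun _ _ => by ring

/-- The contraction of `U` with a covector. -/
def contr (g : Matrix (Fin n) (Fin n) ℝ) (U : Fin n → Fin n → Fin n → ℝ) (u : Fin n → ℝ)
    (i j : Fin n) : ℝ := ip g (U i j) u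

/-- The tensor `tr (T_X T_Y)` as a double contraction. -/
def gram (g : Matrix (Fin n) (Fin n) ℝ) (U : Fin n → Fin n → Fin n → ℝ) (i j : Fin n) : ℝ :=
  ip₂ g (U i) (U j)

theorem gram_symm (hs : ∀ i j, g i j = g j i) (i j : Fin n) : gram g U i j = gram g U j i :=
  ip₂_comm hs _ _

/-- `U` with its trace part `u` added back. -/
def withTrace (g : Matrix (Fin n) (Fin n) ℝ) (U : Fin n → Fin n → Fin n → ℝ) (u : Fin n → ℝ)
    (i j k : Fin n) : ℝ := U i j k + (u i * g j k + u j * g i k + u k * g i j)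

/-- Each row of the full cubic is a row of `U` plus multiples of rows of `g` and of `u`. Pairing
with a row of `g` is an evaluation, so after skewing all cross terms are products with `g`: the
trace part alters the commutator only by a Kulkarni-Nomizu product. -/
theorem withTrace_commutator (hs : ∀ i j, g i j = g j i) (hd : IsUnit g.det)
    (h₁₂ : ∀ i j k, U i j k = U j i k) (h₂₃ : ∀ i j k, U i j k = U i k j) (u : Fin n → ℝ)
    (i j k l : Fin n) :
    ip g (withTrace g U u k i) (withTrace g U u l j)
        - ip g (withTrace g U u k j) (withTrace g U u l i) =
      ip g (U k i) (U l j) - ip g (U k j) (U l i)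
        + kulkarniNomizu (fun a b => contr g U u a b + u a * u b + normSq₁ g u / 2 * g a b)
          g i j k l := by
  have e (i j : Fin n) : withTrace g U u i j = U i j + u i • g j + u j • g i + g i j • u := by
    funext k
    simp only [withTrace, Pi.add_apply, Pi.smul_apply, smul_eq_mul]
    ring
  have hu : normSq₁ g u = ip g u u := rfl
  have h₁₃ (i j k : Fin n) : U i j k = U k j i := by rw [h₂₃, h₁₂, h₂₃]
  simp only [e, ip_add_left, ip_add_right, ip_smul_left, ip_smul_right, ip_metric_left hd,
    ip_metric_right hs hd, kulkarniNomizu, contr, hu, Pi.add_apply, Pi.smul_apply, smul_eq_mul]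
  have e₁ (i j : Fin n) : U i j = U j i := funext (h₁₂ i j)
  rw [ip_comm hs u (U l j), ip_comm hs u (U l i), e₁ l j, e₁ k i, e₁ k j, e₁ l i]
  grind

end CubicAlgebra

/-! ### Consequences of a commutator of the form `-Q ∧ g`. -/

section CubicAlgebra

variable {g : Matrix (Fin n) (Fin n) ℝ} {U : Fin n → Fin n → Fin n → ℝ}

theorem tr₂_mul_metric (hs : ∀ i j, g i j = g j i) (hd : IsUnit g.det) (α : Fin n → ℝ)
    (k : Fin n) : tr₂ g (fun j l => α l * g j k) = α k := by
  rw [← ip_metric_right hs hd k α, ip, ← tr₂_swap hs]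
  simp only [hs k]

theorem tr₂_kulkarniNomizu (hs : ∀ i j, g i j = g j i) (hd : IsUnit g.det)
    (Q : Fin n → Fin n → ℝ) (i k : Fin n) :
    tr₂ g (fun j l => kulkarniNomizu Q g i j k l) = (n - 2) * Q i k + tr₂ g Q * g i k := by
  have h₁ : tr₂ g (fun j l => Q i l * g j k) = Q i k := tr₂_mul_metric hs hd (Q i) k
  have h₂ : tr₂ g (fun j l => Q j k * g i l) = Q i k := by
    rw [← tr₂_swap hs, ← tr₂_mul_metric hs hd (fun a => Q a k) i]
    simp only [hs i]
  have h₃ : tr₂ g (fun j l => Q i k * g j l) = Q i k * n := by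
    rw [← tr₂_metric hs hd]
    exact tr₂_const_mul (Q i k) fun j l => g j l
  simp only [kulkarniNomizu, tr₂_sub, tr₂_add, tr₂_mul_const, h₁, h₂, h₃]
  ring

/-- Contract the commutator over `j`, `l`. The first product contains a trace of `U` and drops out,
the second becomes the Gram tensor. For `n ≠ 2` this recovers `Q` from `𝒰` up to a multiple of `g`.
-/
theorem gram_eq_of_commutator (hs : ∀ i j, g i j = g j i) (hd : IsUnit g.det)
    (h₁₂ : ∀ i j k, U i j k = U j i k) (h₂₃ : ∀ i j k, U i j k = U i k j)
    (htr : ∀ i, tr₂ g (U i) = 0) {Q : Fin n → Fin n → ℝ}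
    (hW : ∀ i j k l, ip g (U k i) (U l j) - ip g (U k j) (U l i) = -kulkarniNomizu Q g i j k l)
    (i k : Fin n) : gram g U i k = (n - 2) * Q i k + tr₂ g Q * g i k := by
  rw [← tr₂_kulkarniNomizu hs hd]
  have h₀ (d : Fin n) : tr₂ g (fun a b => U b a d) = 0 := by
    rw [← htr d, ← tr₂_swap hs]
    congr 1
    funext a b
    rw [h₂₃, h₁₂]
  have h₁ : tr₂ g (fun j l => ip g (U k i) (U l j)) = 0 := by
    rw [tr₂_ip]
    simp only [h₀]
    exact ip_zero_right _
  have h₂ : tr₂ g (fun j l => ip g (U k j) (U l i)) = gram g U i k := by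
    rw [gram_symm hs, gram, ip₂]
    congr 1
    funext j l
    rw [funext (h₁₂ l i)]
  have h₃ := congrArg (fun F => tr₂ g F) (funext fun j => funext fun l => hW i j k l)
  simp only [tr₂_sub, tr₂_neg, h₁, h₂] at h₃
  linarith

/-- The full contraction `U_{abm} U^{bc}_k U_{ci}^a`. -/
def tripleContr (g : Matrix (Fin n) (Fin n) ℝ) (U : Fin n → Fin n → Fin n → ℝ) (m k i : Fin n) :
    ℝ := ip₂ g (U m) fun j l => ip g (U k j) (U i l)

theorem tripleContr_swap₂₃ (hs : ∀ i j, g i j = g j i) (h₂₃ : ∀ i j k, U i j k = U i k j)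
    (m k i : Fin n) : tripleContr g U m k i = tripleContr g U m i k := by
  rw [tripleContr, tripleContr, ← ip₂_transpose]
  simp only [ip_comm hs, h₂₃ m]

/-- The contraction is a triangle with a copy of `U` at each vertex and the free indices at the
vertices. All vertices play the same role, so together with `tripleContr_swap₂₃` this gives symmetry
under all permutations. -/
theorem tripleContr_swap₁₂ (hs : ∀ i j, g i j = g j i) (h₂₃ : ∀ i j k, U i j k = U i k j)
    (m k i : Fin n) : tripleContr g U m k i = tripleContr g U k m i := by
  have h (m k : Fin n) : tripleContr g U m k i = tr₂ g fun j j' => tr₂ g fun l l' =>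
      tr₂ g fun p p' => U m j l * U k j' p * U i l' p' := by
    simp only [tripleContr, ip₂, ip, mul_assoc, tr₂_const_mul]
  rw [h, h, ← tr₂_swap hs]
  congr 1
  funext j j'
  rw [tr₂_comm]
  congr 1
  funext l l'
  congr 1
  funext p p'
  rw [h₂₃ i p' l']
  ring

/-- The covector `U_m^{ab} 𝒰_{ab}`. -/
def gramContr (g : Matrix (Fin n) (Fin n) ℝ) (U : Fin n → Fin n → Fin n → ℝ) (m : Fin n) : ℝ :=
  ip₂ g (gram g U) (U m)

theorem ip₂_mul_metric (hs : ∀ i j, g i j = g j i) (hd : IsUnit g.det) (α : Fin n → ℝ)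
    (B : Fin n → Fin n → ℝ) (k : Fin n) : ip₂ g (fun a b => g a k * α b) B = ip g α (B k) := by
  simp only [hs _ k]
  rw [ip₂_mul_left, ip_metric_left hd]

/-- Contract the commutator identity with `U m` over `j`, `l`, and express `Q` through `𝒰`. The only
term not built from `𝒰` and `U` alone is the triple contraction, which is symmetric in `m`, `k` and
disappears on skewing. The right-hand side contributes one more copy of the difference in question,
which turns the factor `n - 2` into `n - 1`. -/
theorem gram_contr_antisymm (hn : 3 ≤ n) (hs : ∀ i j, g i j = g j i) (hd : IsUnit g.det)
    (h₁₂ : ∀ i j k, U i j k = U j i k) (h₂₃ : ∀ i j k, U i j k = U i k j)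
    (htr : ∀ i, tr₂ g (U i) = 0) {Q : Fin n → Fin n → ℝ}
    (hW : ∀ i j k l, ip g (U k i) (U l j) - ip g (U k j) (U l i) = -kulkarniNomizu Q g i j k l)
    (m i k : Fin n) :
    ip g (gram g U m) (U i k) - ip g (gram g U k) (U i m) =
      1 / (n - 1) * (gramContr g U k * g i m - gramContr g U m * g i k) := by
  have hn' : (3 : ℝ) ≤ n := by exact_mod_cast hn
  have hQ := gram_eq_of_commutator hs hd h₁₂ h₂₃ htr hW
  have key (m k : Fin n) : (n - 2) * ip g (gram g U m) (U i k) - (n - 2) * tripleContr g U m k i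
      = -(gramContr g U m * g i k - ip g (gram g U i) (U k m) - ip g (gram g U k) (U m i)
        + 2 * tr₂ g Q * U m i k) := by
    have e₁ : ip₂ g (fun j l => ip g (U k i) (U l j)) (U m) = ip g (gram g U m) (U i k) := by
      rw [ip₂_ip_left, ip_comm hs, funext (h₁₂ k i)]
      congr 1
      funext d
      rw [gram, ip₂_comm hs, ← ip₂_transpose]
      congr 1
      · funext a b; exact h₂₃ _ _ _
      · funext a b; rw [h₂₃, h₁₂]
    have e₂ : ip₂ g (fun j l => ip g (U k j) (U l i)) (U m) = tripleContr g U m k i := by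
      rw [tripleContr, ip₂_comm hs]
      simp only [funext (h₁₂ _ i)]
    have e₃ (a b : Fin n) : (n - 2) * Q a b = gram g U a b - tr₂ g Q * g a b := by
      rw [hQ]; ring
    have e₄ : ip₂ g (fun j l => (n - 2) * kulkarniNomizu Q g i j k l) (U m) =
        gramContr g U m * g i k - ip g (gram g U i) (U k m) - ip g (gram g U k) (U m i)
        + 2 * tr₂ g Q * U m i k := by
      -- `G` is `g` regarded as a plain function instead of a `Matrix`, so that sums and scalar
      -- multiples below are those of functions.
      obtain ⟨G, hG, hG'⟩ : ∃ G : Fin n → Fin n → ℝ, (∀ a b, G a b = g a b) ∧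
          ∀ B, ip₂ g G B = tr₂ g B := ⟨g, fun _ _ => rfl, ip₂_metric_left hs hd⟩
      have : (fun j l => (n - 2) * kulkarniNomizu Q g i j k l) =
          (gram g U i k) • G + g i k • gram g U - (fun j l => g j k * gram g U i l)
          - (fun j l => gram g U j k * g i l) + (2 * tr₂ g Q) •
            ((fun j l => g j k * g i l) - g i k • G) := by
        funext j l
        simp only [kulkarniNomizu, Pi.add_apply, Pi.sub_apply, Pi.smul_apply, smul_eq_mul, hG]
        linear_combination g j l * e₃ i k + g i k * e₃ j l - g j k * e₃ i l - g i l * e₃ j k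
      rw [this]
      simp only [ip₂_add_left, ip₂_sub_left, ip₂_smul_left, hG', htr,
        ip₂_mul_metric hs hd, ip₂_mul_left, ip_metric_left hd]
      have f₁ : (fun j => gram g U j k) = gram g U k := funext fun j => gram_symm hs _ _
      have f₂ : (fun a => U m a i) = U m i := funext fun a => h₂₃ _ _ _
      rw [f₁, f₂, gramContr, h₂₃ m i k, funext (h₁₂ m k)]
      ring
    have e₅ := congrArg (fun F => ip₂ g F (U m)) (funext fun j => funext fun l =>
      congrArg (fun z => ((n : ℝ) - 2) * z) (hW i j k l))
    have e₆ : (fun j l => ((n : ℝ) - 2) * (ip g (U k i) (U l j) - ip g (U k j) (U l i))) =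
      ((n : ℝ) - 2) • ((fun j l => ip g (U k i) (U l j)) - fun j l => ip g (U k j) (U l i)) := rfl
    have e₇ : (fun j l => ((n : ℝ) - 2) * -kulkarniNomizu Q g i j k l) =
      (-1 : ℝ) • (fun j l => ((n : ℝ) - 2) * kulkarniNomizu Q g i j k l) := by
      funext j l; simp
    simp only [e₆, e₇, ip₂_smul_left, ip₂_sub_left, e₁, e₂, e₄] at e₅
    linarith
  have k₁ := key m k
  have k₂ := key k m
  rw [tripleContr_swap₁₂ hs h₂₃ m k i] at k₁
  rw [funext (h₁₂ k m)] at k₁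
  rw [funext (h₁₂ m i), h₂₃, h₁₂] at k₁
  rw [funext (h₁₂ k i)] at k₂
  have h1 : (n : ℝ) - 1 ≠ 0 := by linarith
  field_simp
  have : U k i m = U i k m := h₁₂ _ _ _
  grind

end CubicAlgebra

/-! ### The value that `∇U` must take. -/

section CubicDerivative

variable {g : Matrix (Fin n) (Fin n) ℝ} {U : Fin n → Fin n → Fin n → ℝ}

/-- The `(0,2)`-tensor `4 / (n - 2) 𝒰 - 3 U(·, ·, u^♯)`. -/
def hookTensor (g : Matrix (Fin n) (Fin n) ℝ) (U : Fin n → Fin n → Fin n → ℝ) (u : Fin n → ℝ)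
    (i j : Fin n) : ℝ := 4 / ((n : ℝ) - 2) * gram g U i j - 3 * contr g U u i j

/-- The `(0,2)`-tensor subtracted from the symmetrised structure tensor to make it trace-free. -/
def traceTensor (g : Matrix (Fin n) (Fin n) ℝ) (U : Fin n → Fin n → Fin n → ℝ)
    (i j : Fin n) : ℝ :=
  2 / 3 * ((n + 2) / ((n : ℝ) - 2)) * gram g U i j
    + 4 / (3 * ((n : ℝ) - 2)) * tr₂ g (gram g U) * g i j

/-- The covariant derivative of `U` on an abundant manifold with structure tensor `3 U` and
`dt = 3 u`. -/
def structureDeriv (g : Matrix (Fin n) (Fin n) ℝ) (U : Fin n → Fin n → Fin n → ℝ)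
    (u : Fin n → ℝ) (i j k l : Fin n) : ℝ :=
  (ip g (U i l) (U j k) + ip g (U j l) (U i k) + ip g (U k l) (U i j)) / 3
    + (u k * U i j l + u i * U j k l + u j * U i k l + u l * U i j k)
    + (hookTensor g U u j k * g i l + hookTensor g U u i k * g j l
      + hookTensor g U u i j * g k l) / 3
    - 1 / (n + 2) * (g i j * traceTensor g U k l + g i k * traceTensor g U j l
      + g j k * traceTensor g U i l)

theorem contr_symm (h₁₂ : ∀ i j k, U i j k = U j i k) (u : Fin n → ℝ) (i j : Fin n) :
    contr g U u i j = contr g U u j i := by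
  rw [contr, contr, funext (h₁₂ i j)]

theorem hookTensor_symm (hs : ∀ i j, g i j = g j i) (h₁₂ : ∀ i j k, U i j k = U j i k)
    (u : Fin n → ℝ) (i j : Fin n) : hookTensor g U u i j = hookTensor g U u j i := by
  rw [hookTensor, hookTensor, gram_symm hs, contr_symm h₁₂]

theorem traceTensor_symm (hs : ∀ i j, g i j = g j i) (i j : Fin n) :
    traceTensor g U i j = traceTensor g U j i := by
  rw [traceTensor, traceTensor, gram_symm hs, hs i j]

/-- Each term of `S₁` is quadratic in the pair `(S, dt)`, so scaling both by `3` produces the factor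
`9`. -/
theorem S₁_smul (hs : ∀ i j, g i j = g j i) (hd : IsUnit g.det)
    (h₂₃ : ∀ i j k, U i j k = U i k j) (u : Fin n → ℝ) (i j k l : Fin n) :
    S₁ g (fun i j k => 3 * U i j k) (fun i => 3 * u i) i j k l =
      9 * (ip g (U i l) (U j k) + 3 * U i j l * u k + U i j k * u l
        + hookTensor g U u j k * g i l) := by
  have e (i j : Fin n) : (fun k => 3 * U i j k) = (3 : ℝ) • U i j := rfl
  have e' (i : Fin n) : (fun j k => 3 * U i j k) = (3 : ℝ) • U i := rfl
  have e₁ : compEndo g (fun i j k => 3 * U i j k) i j k l = 9 * ip g (U i l) (U j k) := by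
    rw [compEndo_eq hs hd (fun i j k => by rw [h₂₃])]
    simp only [e, ip_smul_left, ip_smul_right]
    ring
  have e₂ : trEndo g (fun i j k => 3 * U i j k) j k = 9 * gram g U j k := by
    rw [trEndo_eq hs (fun i j k => by rw [h₂₃])]
    simp only [e', ip₂_smul_left, gram]
    rw [ip₂_comm hs, ip₂_smul_left, ip₂_comm hs]
    ring
  have e₃ : tr₂ g (fun a b => 3 * U j k a * (3 * u b)) = 9 * contr g U u j k := by
    rw [contr, ip, ← tr₂_const_mul]
    congr 1
    funext a b
    ring
  rw [S₁, e₁, e₂, e₃, hookTensor]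
  ring

theorem tr₂_contr (hs : ∀ i j, g i j = g j i) (h₁₂ : ∀ i j k, U i j k = U j i k)
    (h₂₃ : ∀ i j k, U i j k = U i k j)
    (htr : ∀ i, tr₂ g (U i) = 0) (u : Fin n → ℝ) : tr₂ g (contr g U u) = 0 := by
  have : tr₂ g (contr g U u) = tr₂ g fun a b => ip g u (U a b) := by
    simp only [ip_comm hs u]
    rfl
  rw [this, tr₂_ip]
  have h₀ (d : Fin n) : tr₂ g (fun a b => U a b d) = 0 := by
    rw [← htr d]
    congr 1
    funext a b
    rw [h₂₃, h₁₂]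
  simp only [h₀]
  exact ip_zero_right _

/-- The origin of `traceTensor`: the summand `-3 U(·, ·, u^♯)` of `hookTensor` cancels the
contractions of `U` with `u` coming from the other terms, so only `𝒰` and its trace survive. -/
theorem tr₂_sym₃_S₁ (hn : 3 ≤ n) (hs : ∀ i j, g i j = g j i) (hd : IsUnit g.det)
    (h₁₂ : ∀ i j k, U i j k = U j i k) (h₂₃ : ∀ i j k, U i j k = U i k j)
    (htr : ∀ i, tr₂ g (U i) = 0) (u : Fin n → ℝ) (k l : Fin n) :
    tr₂ g (fun i j => sym₃ (S₁ g (fun i j k => 3 * U i j k) (fun i => 3 * u i)) i j k l) =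
      9 * traceTensor g U k l := by
  have hn' : (3 : ℝ) ≤ n := by exact_mod_cast hn
  have h₁₃ (i j k : Fin n) : U i j k = U k j i := by rw [h₂₃, h₁₂, h₂₃]
  have e (i j : Fin n) : U i j = U j i := funext (h₁₂ i j)
  have h (i j : Fin n) : sym₃ (S₁ g (fun i j k => 3 * U i j k) (fun i => 3 * u i)) i j k l =
      3 * (ip g (U l i) (U k j) + ip g (U l j) (U k i) + ip g (U k l) (U i j))
      + 9 * u k * U l i j + 9 * (u i * U k l j) + 9 * (u j * U k l i) + 9 * u l * U k i j
      + 3 * (hookTensor g U u k j * g i l + hookTensor g U u k i * g j l)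
      + hookTensor g U u i j * (3 * g k l) := by
    rw [sym₃_apply]
    simp only [S₁_smul hs hd h₂₃, hookTensor_symm hs h₁₂ u j i, hookTensor_symm hs h₁₂ u i k,
      hookTensor_symm hs h₁₂ u j k, e i l, e j l, e k l, e i k, e j k, e j i]
    have s (a b c : Fin n) : U a b c = U c a b := by rw [h₂₃, h₁₂]
    rw [s i j l, s k j l, s k i l, h₂₃ k j i, s i j k]
    ring
  simp only [h, tr₂_add, tr₂_const_mul, tr₂_mul_const]
  have t₁ : tr₂ g (fun i j => ip g (U l i) (U k j)) = gram g U k l := by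
    rw [gram_symm hs]; rfl
  have t₂ : tr₂ g (fun i j => ip g (U l j) (U k i)) = gram g U k l := by
    rw [← t₁, ← tr₂_swap hs]
  have t₃ : tr₂ g (fun i j => ip g (U k l) (U i j)) = 0 := by
    rw [tr₂_ip]
    have h₀ (d : Fin n) : tr₂ g (fun a b => U a b d) = 0 := by
      rw [← htr d]
      congr 1
      funext a b
      rw [h₂₃, h₁₂]
    simp only [h₀]
    exact ip_zero_right _
  have t₄ (m : Fin n) : tr₂ g (fun i j => U m i j) = 0 := htr m
  have t₅ : tr₂ g (fun i j => u i * U k l j) = contr g U u k l := by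
    rw [contr, ip_comm hs]; rfl
  have t₆ : tr₂ g (fun i j => u j * U k l i) = contr g U u k l := by
    rw [← t₅, ← tr₂_swap hs]
  have t₇ : tr₂ g (fun i j => hookTensor g U u k j * g i l) = hookTensor g U u k l :=
    tr₂_mul_metric hs hd _ _
  have t₈ : tr₂ g (fun i j => hookTensor g U u k i * g j l) = hookTensor g U u k l := by
    rw [← t₇, ← tr₂_swap hs]
  have t₉ : tr₂ g (fun i j => hookTensor g U u i j) = 4 / (n - 2) * tr₂ g (gram g U) := by
    have e₁ : tr₂ g (fun i j => gram g U i j) = tr₂ g (gram g U) := rfl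
    have e₂ : tr₂ g (fun i j => contr g U u i j) = 0 := tr₂_contr hs h₁₂ h₂₃ htr u
    simp only [hookTensor, tr₂_sub, tr₂_const_mul, e₁, e₂]
    ring
  rw [t₁, t₂, t₃, t₄, t₄, t₅, t₆, t₇, t₈, t₉, traceTensor, hookTensor]
  have : (n : ℝ) - 2 ≠ 0 := by linarith
  field_simp
  ring

theorem sym₃TraceFree_S₁ (hn : 3 ≤ n) (hs : ∀ i j, g i j = g j i) (hd : IsUnit g.det)
    (h₁₂ : ∀ i j k, U i j k = U j i k) (h₂₃ : ∀ i j k, U i j k = U i k j)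
    (htr : ∀ i, tr₂ g (U i) = 0) (u : Fin n → ℝ) (i j k l : Fin n) :
    sym₃TraceFree g (S₁ g (fun i j k => 3 * U i j k) (fun i => 3 * u i)) i j k l =
      9 * structureDeriv g U u i j k l := by
  have hn' : (3 : ℝ) ≤ n := by exact_mod_cast hn
  have e (i j : Fin n) : U i j = U j i := funext (h₁₂ i j)
  have s (a b c : Fin n) : U a b c = U c a b := by rw [h₂₃, h₁₂]
  rw [sym₃TraceFree]
  simp only [tr₂_sym₃_S₁ hn hs hd h₁₂ h₂₃ htr u]
  rw [sym₃_apply, sym₃_apply]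
  simp only [S₁_smul hs hd h₂₃, hookTensor_symm hs h₁₂ u j i, hookTensor_symm hs h₁₂ u k i,
      hookTensor_symm hs h₁₂ u k j, e k j, e k i, e j i, structureDeriv, hs j i, hs k j, hs k i]
  rw [h₂₃ i k j, s j k i]
  field_simp
  ring

theorem structureDeriv_swap₁₂ (hs : ∀ i j, g i j = g j i) (h₁₂ : ∀ i j k, U i j k = U j i k)
    (u : Fin n → ℝ) (i j k l : Fin n) :
    structureDeriv g U u i j k l = structureDeriv g U u j i k l := by
  simp only [structureDeriv]
  rw [hookTensor_symm hs h₁₂ u j i, hs j i, funext (h₁₂ j i)]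
  ring

theorem structureDeriv_swap₂₃ (hs : ∀ i j, g i j = g j i) (h₁₂ : ∀ i j k, U i j k = U j i k)
    (h₂₃ : ∀ i j k, U i j k = U i k j) (u : Fin n → ℝ) (i j k l : Fin n) :
    structureDeriv g U u i j k l = structureDeriv g U u i k j l := by
  simp only [structureDeriv]
  rw [hookTensor_symm hs h₁₂ u k j, hs k j, funext (h₁₂ k j), h₂₃ i k j]
  ring

/-- The three products of `g` with `traceTensor` have trace `n + 1 + 1` times `traceTensor`, which
accounts for the factor `1 / (n + 2)` in the projection. -/
theorem tr₂_structureDeriv (hn : 3 ≤ n) (hs : ∀ i j, g i j = g j i) (hd : IsUnit g.det)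
    (h₁₂ : ∀ i j k, U i j k = U j i k) (h₂₃ : ∀ i j k, U i j k = U i k j)
    (htr : ∀ i, tr₂ g (U i) = 0) (u : Fin n → ℝ) (k l : Fin n) :
    tr₂ g (fun i j => structureDeriv g U u i j k l) = 0 := by
  have hn' : (3 : ℝ) ≤ n := by exact_mod_cast hn
  have e := tr₂_sym₃_S₁ hn hs hd h₁₂ h₂₃ htr u k l
  have h (i j : Fin n) : 9 * structureDeriv g U u i j k l =
      sym₃ (S₁ g (fun i j k => 3 * U i j k) (fun i => 3 * u i)) i j k l
      - 9 / (n + 2) * (g i j * traceTensor g U k l + (traceTensor g U l j * g i k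
        + traceTensor g U l i * g j k)) := by
    rw [← sym₃TraceFree_S₁ hn hs hd h₁₂ h₂₃ htr, sym₃TraceFree]
    simp only [tr₂_sym₃_S₁ hn hs hd h₁₂ h₂₃ htr u]
    rw [sym₃_apply (fun a b c d => g a b * (9 * traceTensor g U c d))]
    rw [hs j i, hs k j, hs k i, traceTensor_symm hs l i, traceTensor_symm hs l j]
    field_simp
    ring
  have h' : 9 * tr₂ g (fun i j => structureDeriv g U u i j k l) = 0 := by
    rw [← tr₂_const_mul]
    simp only [h, tr₂_sub, tr₂_add, tr₂_const_mul, e]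
    have t₁ : tr₂ g (fun i j => g i j * traceTensor g U k l) = n * traceTensor g U k l := by
      rw [← tr₂_metric hs hd]
      exact tr₂_mul_const _ fun a b => g a b
    have t₂ : tr₂ g (fun i j => traceTensor g U l j * g i k) = traceTensor g U l k :=
      tr₂_mul_metric hs hd _ _
    have t₃ : tr₂ g (fun i j => traceTensor g U l i * g j k) = traceTensor g U l k := by
      rw [← t₂, ← tr₂_swap hs]
    rw [t₁, t₂, t₃, traceTensor_symm hs l k]
    field_simp
    ring
  linarith

/-- The terms quadratic in `U` without a factor `g`, and the products of `U` with `u`, are symmetric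
in `k`, `l`. The rest contributes `hookTensor / 3 + traceTensor / (n + 2)`, in which the
coefficients of `𝒰` add up to `2 / (n - 2)`. The number `r` is arbitrary because a multiple of `g`
in `q` cancels on the right. -/
theorem structureDeriv_antisymm (hn : 3 ≤ n) (hs : ∀ i j, g i j = g j i)
    (h₁₂ : ∀ i j k, U i j k = U j i k) (h₂₃ : ∀ i j k, U i j k = U i k j)
    (u : Fin n → ℝ) {q : Fin n → Fin n → ℝ} {r : ℝ}
    (hq : ∀ i j, q i j = 2 / (n - 2) * gram g U i j - contr g U u i j + r * g i j)
    (i j k l : Fin n) :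
    structureDeriv g U u i j k l - structureDeriv g U u i j l k =
      g i l * q j k + g j l * q i k - g i k * q j l - g j k * q i l := by
  have hn' : (3 : ℝ) ≤ n := by exact_mod_cast hn
  have : (n : ℝ) - 2 ≠ 0 := by linarith
  have e (i j : Fin n) : U i j = U j i := funext (h₁₂ i j)
  simp only [structureDeriv, hq, hookTensor, traceTensor]
  rw [e l k, hs l k, ip_comm hs (U j k), ip_comm hs (U i k), gram_symm hs l k, h₂₃ i l k, h₂₃ j l k]
  field_simp
  ring

end CubicDerivative

/-! ### The projection onto totally symmetric trace-free tensors. -/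

section SymmetricProjection

variable {g : Matrix (Fin n) (Fin n) ℝ}

theorem sym₄_add (A B : Fin n → Fin n → Fin n → Fin n → ℝ) (i j k l : Fin n) :
    sym₄ (fun i j k l => A i j k l + B i j k l) i j k l = sym₄ A i j k l + sym₄ B i j k l := by
  simp only [sym₄, Finset.sum_add_distrib, mul_add]

theorem sym₄_sub (A B : Fin n → Fin n → Fin n → Fin n → ℝ) (i j k l : Fin n) :
    sym₄ (fun i j k l => A i j k l - B i j k l) i j k l = sym₄ A i j k l - sym₄ B i j k l := by
  simp only [sym₄, Finset.sum_sub_distrib, mul_sub]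

theorem sym₄_const_mul (c : ℝ) (B : Fin n → Fin n → Fin n → Fin n → ℝ) (i j k l : Fin n) :
    sym₄ (fun i j k l => c * B i j k l) i j k l = c * sym₄ B i j k l := by
  simp only [sym₄, ← Finset.mul_sum]
  ring

theorem sym₄TraceFree_eq (B : Fin n → Fin n → Fin n → Fin n → ℝ) (i j k l : Fin n) :
    sym₄TraceFree g B i j k l = sym₄ B i j k l - 6 / ((n : ℝ) + 4) * sym₄ (fun i j k l =>
      (trSym₄ g B i j - tr₂ g (trSym₄ g B) * g i j / (2 * ((n : ℝ) + 2))) * g k l) i j k l := by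
  rw [sym₄TraceFree, sym₄_sub, sym₄_const_mul]

theorem sym₄TraceFree_congr {A B : Fin n → Fin n → Fin n → Fin n → ℝ} (h : sym₄ A = sym₄ B) :
    sym₄TraceFree g A = sym₄TraceFree g B := by
  have ht : trSym₄ g A = trSym₄ g B := by
    funext k l
    simp only [trSym₄, h]
  funext i j k l
  rw [sym₄TraceFree_eq, sym₄TraceFree_eq, ht, h]

theorem trSym₄_add (A B : Fin n → Fin n → Fin n → Fin n → ℝ) (k l : Fin n) :
    trSym₄ g (fun i j k l => A i j k l + B i j k l) k l = trSym₄ g A k l + trSym₄ g B k l := by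
  rw [trSym₄, trSym₄, trSym₄, ← tr₂_add]
  congr 1
  funext a b
  exact sym₄_add A B a b k l

theorem sym₄TraceFree_add (A B : Fin n → Fin n → Fin n → Fin n → ℝ) (i j k l : Fin n) :
    sym₄TraceFree g (fun i j k l => A i j k l + B i j k l) i j k l =
      sym₄TraceFree g A i j k l + sym₄TraceFree g B i j k l := by
  have h : tr₂ g (trSym₄ g fun i j k l => A i j k l + B i j k l) =
      tr₂ g (trSym₄ g A) + tr₂ g (trSym₄ g B) := by
    have : (trSym₄ g fun i j k l => A i j k l + B i j k l) =
      fun k l => trSym₄ g A k l + trSym₄ g B k l := by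
      funext k l; exact trSym₄_add A B k l
    rw [this, tr₂_add]
  simp only [sym₄TraceFree_eq, sym₄_add, trSym₄_add, h]
  have : (fun i j k l : Fin n => (trSym₄ g A i j + trSym₄ g B i j -
      (tr₂ g (trSym₄ g A) + tr₂ g (trSym₄ g B)) * g i j / (2 * ((n : ℝ) + 2))) * g k l) =
    fun i j k l => (trSym₄ g A i j - tr₂ g (trSym₄ g A) * g i j / (2 * ((n : ℝ) + 2))) * g k l
     + (trSym₄ g B i j - tr₂ g (trSym₄ g B) * g i j / (2 * ((n : ℝ) + 2))) * g k l := by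
    funext i j k l; ring
  rw [this, sym₄_add]
  ring

theorem sym₄_metric_mul (hs : ∀ i j, g i j = g j i) {e : Fin n → Fin n → ℝ}
    (he : ∀ i j, e i j = e j i) (i j k l : Fin n) :
    sym₄ (fun i j k l => e i j * g k l) i j k l =
      (e i j * g k l + e i k * g j l + e i l * g j k + e j k * g i l + e j l * g i k
        + e k l * g i j) / 6 := by
  rw [sym₄_apply]
  simp only [permSum₃]
  rw [hs l k, hs l j, hs l i, hs k j, hs k i, hs j i, he l k, he l j, he l i, he k j, he k i,
    he j i]
  ring

/-- The symmetrisation of `e ⊗ g` has trace `((n + 4) e + (tr e) g) / 6`. The constants in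
`sym₄TraceFree` invert this map, so the correction term recovers `e` and removes the tensor
completely. -/
theorem sym₄TraceFree_metric_mul (hs : ∀ i j, g i j = g j i) (hd : IsUnit g.det)
    {e : Fin n → Fin n → ℝ} (he : ∀ i j, e i j = e j i) (i j k l : Fin n) :
    sym₄TraceFree g (fun i j k l => e i j * g k l) i j k l = 0 := by
  have h₁ (k l : Fin n) : trSym₄ g (fun i j k l => e i j * g k l) k l =
      ((n + 4) * e k l + tr₂ g e * g k l) / 6 := by
    rw [trSym₄]
    have (i j : Fin n) : sym₄ (fun i j k l => e i j * g k l) i j k l =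
       1 / 6 * (e i j * g k l + e k i * g j l + e l i * g j k + e k j * g i l + e l j * g i k
        + e k l * g i j) := by
      rw [sym₄_metric_mul hs he, he k i, he l i, he k j, he l j]
      ring
    simp only [this, tr₂_const_mul, tr₂_add]
    have t₁ (k l : Fin n) : tr₂ g (fun i j => e k j * g i l) = e k l := tr₂_mul_metric hs hd _ _
    have t₂ (k l : Fin n) : tr₂ g (fun i j => e k i * g j l) = e k l := by
      rw [← t₁ k l, ← tr₂_swap hs]
    have t₃ : tr₂ g (fun i j => e k l * g i j) = e k l * n := by
      rw [← tr₂_metric hs hd]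
      exact tr₂_const_mul _ fun a b => g a b
    rw [t₁, t₁, t₂, t₂, t₃, tr₂_mul_const, he l k]
    ring
  have h₂ : tr₂ g (trSym₄ g fun i j k l => e i j * g k l) = (n + 2) / 3 * tr₂ g e := by
    have : (trSym₄ g fun i j k l => e i j * g k l) = fun k l =>
        1 / 6 * ((n + 4) * e k l + tr₂ g e * g k l) := by
      funext k l
      rw [h₁]
      ring
    have t₃ : tr₂ g (fun i j => tr₂ g e * g i j) = tr₂ g e * n := by
      rw [← tr₂_metric hs hd]
      exact tr₂_const_mul _ fun a b => g a b
    rw [this, tr₂_const_mul, tr₂_add, tr₂_const_mul, t₃]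
    ring
  rw [sym₄TraceFree_eq, h₂]
  have h₃ : (fun i j k l => (trSym₄ g (fun i j k l => e i j * g k l) i j
      - (n + 2) / 3 * tr₂ g e * g i j / (2 * ((n : ℝ) + 2))) * g k l) =
      fun i j k l => (n + 4) / 6 * (e i j * g k l) := by
    funext i j k l
    rw [h₁]
    field_simp
    ring
  rw [h₃, sym₄_const_mul]
  have : (n : ℝ) + 4 ≠ 0 := by positivity
  field_simp
  ring

/-- A totally symmetric trace-free tensor is its own projection. -/
theorem sym₄TraceFree_self {D : Fin n → Fin n → Fin n → Fin n → ℝ}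
    (h₁ : ∀ i j k l, D i j k l = D j i k l) (h₂ : ∀ i j k l, D i j k l = D i k j l)
    (h₃ : ∀ i j k l, D i j k l = D i j l k) (htr : ∀ k l, tr₂ g (fun i j => D i j k l) = 0) :
    sym₄TraceFree g D = D := by
  have hD : sym₄ D = D := by
    funext i j k l
    have p (i j k l) : permSum₃ (D i) j k l = 6 * D i j k l := by
      simp only [permSum₃]
      rw [h₂ i k j l, (h₂ i l k j).trans ((h₃ i k l j).trans (h₂ i k j l)), h₃ i j l k,
        (h₃ i k l j).trans (h₂ i k j l), (h₂ i l j k).trans (h₃ i j l k)]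
      ring
    rw [sym₄_apply, p, p, p, p, h₁ j i, (h₁ k j i l).trans ((h₂ j k i l).trans (h₁ j i k l)),
      (h₁ l j k i).trans ((h₂ j l k i).trans ((h₃ j k l i).trans ((h₂ j k i l).trans
        (h₁ j i k l))))]
    ring
  have ht (k l : Fin n) : trSym₄ g D k l = 0 := by
    rw [trSym₄, hD, htr]
  have ht' : trSym₄ g D = fun _ _ => 0 := by
    funext k l; exact ht k l
  funext i j k l
  rw [sym₄TraceFree_eq, hD, ht', tr₂_zero]
  simp [sym₄]

end SymmetricProjection

/-! ### The algebraic Weyl condition. -/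

section WeylPart

variable {g : Matrix (Fin n) (Fin n) ℝ} {U : Fin n → Fin n → Fin n → ℝ}

/-- The curvature part of `𝔖` is, up to a factor, the commutator of `U`, hence a Kulkarni-Nomizu
product with `g`; such a product has no totally trace-free part. -/
theorem weylPart_pairEndo (hn : 3 ≤ n) (hs : ∀ i j, g i j = g j i) (hd : IsUnit g.det)
    (h₁₂ : ∀ i j k, U i j k = U j i k) {Q : Fin n → Fin n → ℝ}
    (hW : ∀ i j k l, ip g (U k i) (U l j) - ip g (U k j) (U l i) = -kulkarniNomizu Q g i j k l)
    (i j k l : Fin n) : weylPart g (pairEndo g fun i j k => 3 * U i j k) i j k l = 0 := by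
  have hn' : (3 : ℝ) ≤ n := by exact_mod_cast hn
  have e (i j : Fin n) : (fun k => 3 * U i j k) = (3 : ℝ) • U i j := rfl
  have e₁ (i j : Fin n) : U i j = U j i := funext (h₁₂ i j)
  -- The factor `9` comes from `S = 3U`, and `1 / 2` because in `curvPart` each of the two products
  -- of the commutator occurs twice with weight `1 / 4`.
  have hc : curvPart (pairEndo g fun i j k => 3 * U i j k) =
      kulkarniNomizu (fun a b => -(9 / 2) * Q a b) g := by
    funext i j k l
    have h := hW i j k l
    simp only [kulkarniNomizu] at h
    simp only [curvPart, pairEndo_eq hs hd, e, ip_smul_left, ip_smul_right, kulkarniNomizu]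
    rw [ip_comm hs (U j k), ip_comm hs (U j l)]
    rw [e₁ l j, e₁ l i, e₁ k i, e₁ k j, ip_comm hs (U j k)] at h
    linear_combination 9 / 2 * h
  have h2 : (n : ℝ) - 2 ≠ 0 := by linarith
  have hctr : curvPartTrace g (pairEndo g fun i j k => 3 * U i j k) = fun i j =>
      -(9 / 2) * Q i j + 1 / (n - 2) * (-(9 / 2) * tr₂ g Q) * g i j := by
    funext i j
    have h₁ (a b : Fin n) : kulkarniNomizu (fun a b => -(9 / 2) * Q a b) g a i b j =
        kulkarniNomizu (fun a b => -(9 / 2) * Q a b) g i a j b := by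
      simp only [kulkarniNomizu]
      ring
    simp only [curvPartTrace, hc, h₁]
    rw [tr₂_kulkarniNomizu hs hd, tr₂_const_mul]
    field_simp
  have htr : tr₂ g (fun i j => -(9 / 2) * Q i j + 1 / (n - 2) * (-(9 / 2) * tr₂ g Q) * g i j) =
      -(9 / 2) * tr₂ g Q + 1 / (n - 2) * (-(9 / 2) * tr₂ g Q) * n := by
    rw [tr₂_add, tr₂_const_mul, ← tr₂_metric hs hd]
    congr 1
    exact tr₂_const_mul _ fun a b => g a b
  rw [weylPart, hc, hctr, htr]
  simp only [kulkarniNomizu]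
  have h1 : (n : ℝ) - 1 ≠ 0 := by linarith
  field_simp
  ring

end WeylPart

/-! ### `∇U` is determined by its skew and its totally symmetric trace-free parts. -/

section Determination

variable {g : Matrix (Fin n) (Fin n) ℝ} {U : Fin n → Fin n → Fin n → ℝ}

/-- Under symmetrisation the positions of the arguments are irrelevant, so the terms of each kind
merge: one `𝔘`, four `U ⊗ u`, and a product of a symmetric tensor with `g`, which the trace-free
projection kills. -/
theorem sym₄_structureDeriv (hs : ∀ i j, g i j = g j i) (hd : IsUnit g.det)
    (h₂₃ : ∀ i j k, U i j k = U i k j) (u : Fin n → ℝ) :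
    sym₄ (structureDeriv g U u) = sym₄ fun i j k l =>
      (compEndo g U i j l k + 4 * (U i j k * u l))
        + (hookTensor g U u i j - 3 / (n + 2) * traceTensor g U i j) * g k l := by
  -- Invariance of `sym₄` under the rearrangements of arguments that occur in `structureDeriv`.
  have p₁ (F : Fin n → Fin n → Fin n → Fin n → ℝ) (i j k l) :
      sym₄ (fun i j k l => F j i k l) i j k l = sym₄ F i j k l := by
    simp only [sym₄_apply, permSum₃]; ring
  have p₂ (F : Fin n → Fin n → Fin n → Fin n → ℝ) (i j k l) :
      sym₄ (fun i j k l => F k i j l) i j k l = sym₄ F i j k l := by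
    simp only [sym₄_apply, permSum₃]; ring
  have p₃ (F : Fin n → Fin n → Fin n → Fin n → ℝ) (i j k l) :
      sym₄ (fun i j k l => F i j l k) i j k l = sym₄ F i j k l := by
    simp only [sym₄_apply, permSum₃]; ring
  have p₄ (F : Fin n → Fin n → Fin n → Fin n → ℝ) (i j k l) :
      sym₄ (fun i j k l => F j k l i) i j k l = sym₄ F i j k l := by
    simp only [sym₄_apply, permSum₃]; ring
  have p₅ (F : Fin n → Fin n → Fin n → Fin n → ℝ) (i j k l) :
      sym₄ (fun i j k l => F i k l j) i j k l = sym₄ F i j k l := by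
    simp only [sym₄_apply, permSum₃]; ring
  have p₆ (F : Fin n → Fin n → Fin n → Fin n → ℝ) (i j k l) :
      sym₄ (fun i j k l => F j k i l) i j k l = sym₄ F i j k l := by
    simp only [sym₄_apply, permSum₃]; ring
  have p₇ (F : Fin n → Fin n → Fin n → Fin n → ℝ) (i j k l) :
      sym₄ (fun i j k l => F i k j l) i j k l = sym₄ F i j k l := by
    simp only [sym₄_apply, permSum₃]; ring
  have p₈ (F : Fin n → Fin n → Fin n → Fin n → ℝ) (i j k l) :
      sym₄ (fun i j k l => F k l i j) i j k l = sym₄ F i j k l := by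
    simp only [sym₄_apply, permSum₃]; ring
  have p₉ (F : Fin n → Fin n → Fin n → Fin n → ℝ) (i j k l) :
      sym₄ (fun i j k l => F j l i k) i j k l = sym₄ F i j k l := by
    simp only [sym₄_apply, permSum₃]; ring
  have p₀ (F : Fin n → Fin n → Fin n → Fin n → ℝ) (i j k l) :
      sym₄ (fun i j k l => F i l j k) i j k l = sym₄ F i j k l := by
    simp only [sym₄_apply, permSum₃]; ring
  set F₁ : Fin n → Fin n → Fin n → Fin n → ℝ := fun i j k l => ip g (U i l) (U j k) with hF₁
  set F₂ : Fin n → Fin n → Fin n → Fin n → ℝ := fun i j k l => U i j k * u l with hF₂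
  set F₃ : Fin n → Fin n → Fin n → Fin n → ℝ := fun i j k l => hookTensor g U u i j * g k l
    with hF₃
  set F₄ : Fin n → Fin n → Fin n → Fin n → ℝ := fun i j k l => traceTensor g U i j * g k l
    with hF₄
  have e₁ : structureDeriv g U u = fun i j k l =>
      1 / 3 * (F₁ i j k l + F₁ j i k l + F₁ k i j l)
      + (F₂ i j l k + F₂ j k l i + F₂ i k l j + F₂ i j k l)
      + 1 / 3 * (F₃ j k i l + F₃ i k j l + F₃ i j k l)
      - 1 / (n + 2) * (F₄ k l i j + F₄ j l i k + F₄ i l j k) := by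
    funext i j k l
    simp only [structureDeriv, hF₁, hF₂, hF₃, hF₄]
    ring
  have e₂ : (fun i j k l : Fin n => (compEndo g U i j l k + 4 * (U i j k * u l))
        + (hookTensor g U u i j - 3 / (n + 2) * traceTensor g U i j) * g k l) = fun i j k l =>
      F₁ i j l k + 4 * F₂ i j k l + (F₃ i j k l - 3 / (n + 2) * F₄ i j k l) := by
    funext i j k l
    simp only [compEndo_eq hs hd h₂₃, hF₁, hF₂, hF₃, hF₄]
    ring
  rw [e₁, e₂]
  funext i j k l
  simp only [sym₄_add, sym₄_sub, sym₄_const_mul]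
  rw [p₁ F₁, p₂ F₁, p₃ F₁, p₃ F₂, p₄ F₂, p₅ F₂, p₆ F₃, p₇ F₃, p₈ F₄, p₉ F₄, p₀ F₄]
  ring

/-- A tensor with the symmetries of `∇U` is determined by its totally symmetric trace-free part
and its antisymmetrisation. -/
theorem eq_structureDeriv (hn : 3 ≤ n) (hs : ∀ i j, g i j = g j i) (hd : IsUnit g.det)
    (h₁₂ : ∀ i j k, U i j k = U j i k) (h₂₃ : ∀ i j k, U i j k = U i k j)
    (htr : ∀ i, tr₂ g (U i) = 0) (u : Fin n → ℝ) {q : Fin n → Fin n → ℝ} {r : ℝ}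
    (hq : ∀ i j, q i j = 2 / (n - 2) * gram g U i j - contr g U u i j + r * g i j)
    {N : Fin n → Fin n → Fin n → Fin n → ℝ}
    (hN₁₂ : ∀ i j k l, N i j k l = N j i k l) (hN₂₃ : ∀ i j k l, N i j k l = N i k j l)
    (hNtr : ∀ k l, tr₂ g (fun i j => N i j k l) = 0)
    (hNa : ∀ i j k l, N i j k l - N i j l k =
      g i l * q j k + g j l * q i k - g i k * q j l - g j k * q i l)
    (hNs : ∀ i j k l, sym₄TraceFree g N i j k l = sym₄TraceFree g
      (fun a b c d => compEndo g U a b d c + 4 * (U a b c * u d)) i j k l)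
    (i j k l : Fin n) : N i j k l = structureDeriv g U u i j k l := by
  set T := structureDeriv g U u with hT
  -- Equal skew parts make the difference symmetric in its last two arguments too, hence totally
  -- symmetric. It is also trace-free, so it equals its own projection, which vanishes because the
  -- projections of `N` and `T` agree.
  have hD : sym₄TraceFree g (fun i j k l => N i j k l - T i j k l) =
      fun i j k l => N i j k l - T i j k l := by
    refine sym₄TraceFree_self (fun i j k l => ?_) (fun i j k l => ?_) (fun i j k l => ?_)
      (fun k l => ?_)
    · rw [hN₁₂, hT, structureDeriv_swap₁₂ hs h₁₂]
    · rw [hN₂₃, hT, structureDeriv_swap₂₃ hs h₁₂ h₂₃]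
    · linarith [hNa i j k l, structureDeriv_antisymm hn hs h₁₂ h₂₃ u hq i j k l]
    · rw [tr₂_sub, hNtr, hT, tr₂_structureDeriv hn hs hd h₁₂ h₂₃ htr, sub_zero]
  have hTs : sym₄TraceFree g T = sym₄TraceFree g
      (fun a b c d => compEndo g U a b d c + 4 * (U a b c * u d)) := by
    rw [sym₄TraceFree_congr (sym₄_structureDeriv hs hd h₂₃ u)]
    funext i j k l
    rw [sym₄TraceFree_add (fun i j k l => compEndo g U i j l k + 4 * (U i j k * u l)),
      sym₄TraceFree_metric_mul hs hd, add_zero]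
    intro i j
    rw [hookTensor_symm hs h₁₂, traceTensor_symm hs]
  have hsum := sym₄TraceFree_add (g := g) (fun i j k l => N i j k l - T i j k l) T i j k l
  simp only [sub_add_cancel] at hsum
  have h := hNs i j k l
  rw [← hTs] at h
  rw [hD] at hsum
  have : sym₄TraceFree g N i j k l = sym₄TraceFree g (fun i j k l => N i j k l) i j k l := rfl
  linarith

end Determination

/-! ### The derivative of the Gram tensor. -/

section GramDerivative

variable {g : Matrix (Fin n) (Fin n) ℝ} {U : Fin n → Fin n → Fin n → ℝ}

theorem ip₂_flip (h₂₃ : ∀ i j k, U i j k = U i k j) (A : Fin n → Fin n → ℝ) (j : Fin n) :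
    ip₂ g (fun a b => A b a) (U j) = ip₂ g A (U j) := by
  rw [← ip₂_transpose A]
  congr 1
  funext a b
  exact h₂₃ _ _ _

theorem ip₂_cubic_left (hs : ∀ i j, g i j = g j i) (h₁₂ : ∀ i j k, U i j k = U j i k)
    (h₂₃ : ∀ i j k, U i j k = U i k j) (j d : Fin n) :
    ip₂ g (fun a b => U a b d) (U j) = gram g U j d := by
  rw [gram_symm hs, gram]
  congr 1
  funext a b
  rw [h₂₃, h₁₂]

theorem ip₂_contr (hs : ∀ i j, g i j = g j i) (h₁₂ : ∀ i j k, U i j k = U j i k)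
    (h₂₃ : ∀ i j k, U i j k = U i k j) (u : Fin n → ℝ) (j : Fin n) :
    ip₂ g (contr g U u) (U j) = ip g u (gram g U j) := by
  have : contr g U u = fun a b => ip g u (U a b) := by
    funext a b; exact ip_comm hs _ _
  rw [this, ip₂_ip_left]
  simp only [ip₂_cubic_left hs h₁₂ h₂₃]

/-- One of the two terms of the product rule for `∇_k 𝒰_{ij}`; the other arises by exchanging `i`
and `j`. -/
theorem ip₂_structureDeriv (hs : ∀ i j, g i j = g j i) (hd : IsUnit g.det)
    (h₁₂ : ∀ i j k, U i j k = U j i k) (h₂₃ : ∀ i j k, U i j k = U i k j)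
    (htr : ∀ i, tr₂ g (U i) = 0) (u : Fin n → ℝ) (i j k : Fin n) :
    ip₂ g (fun a b => structureDeriv g U u i a b k) (U j) =
      1 / 3 * (ip g (gram g U j) (U i k) + 2 * tripleContr g U j k i)
      + 2 * ip g (U i k) (contr g U u j) + u i * gram g U j k + u k * gram g U i j
      + 1 / 3 * ((4 / (n - 2) * gramContr g U j - 3 * ip g u (gram g U j)) * g i k
        + 2 * ip g (hookTensor g U u i) (U j k))
      - 2 / (n + 2) * ip g (traceTensor g U k) (U i j) := by
  obtain ⟨G, hG, hG'⟩ : ∃ G : Fin n → Fin n → ℝ, (∀ a b, G a b = g a b) ∧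
      ∀ B, ip₂ g G B = tr₂ g B := ⟨g, fun _ _ => rfl, ip₂_metric_left hs hd⟩
  have e : (fun a b => structureDeriv g U u i a b k) =
      (1 / 3 : ℝ) • ((fun a b => ip g (U i k) (U a b)) + (fun a b => ip g (U k a) (U i b))
        + (fun a b => ip g (U k b) (U i a)))
      + ((fun a b => U i k a * u b) + u i • (fun a b => U a b k) + (fun a b => U i k b * u a)
        + u k • U i)
      + (1 / 3 : ℝ) • (g i k • hookTensor g U u + (fun a b => g a k * hookTensor g U u i b)
        + (fun a b => g b k * hookTensor g U u i a))
      - (1 / (n + 2) : ℝ) • ((fun a b => g a i * traceTensor g U k b)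
        + (fun a b => g b i * traceTensor g U k a) + traceTensor g U i k • G) := by
    funext a b
    simp only [structureDeriv, Pi.add_apply, Pi.sub_apply, Pi.smul_apply, smul_eq_mul, hG]
    rw [funext (h₁₂ a k), funext (h₁₂ b k), traceTensor_symm hs b k, traceTensor_symm hs a k,
      hs i a, hs i b, h₂₃ i a k, h₂₃ i b k]
    ring
  have t₁ : ip₂ g (fun a b => ip g (U i k) (U a b)) (U j) = ip g (gram g U j) (U i k) := by
    rw [ip₂_ip_left, ip_comm hs]
    simp only [ip₂_cubic_left hs h₁₂ h₂₃]
  have t₂ : ip₂ g (fun a b => ip g (U k a) (U i b)) (U j) = tripleContr g U j k i := ip₂_comm hs _ _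
  have t₃ : ip₂ g (fun a b => ip g (U k b) (U i a)) (U j) = tripleContr g U j k i := by
    rw [← t₂]
    exact ip₂_flip h₂₃ (fun a b => ip g (U k a) (U i b)) j
  have t₄ : ip₂ g (fun a b => U i k a * u b) (U j) = ip g (U i k) (contr g U u j) := by
    rw [ip₂_mul_left]
    simp only [ip_comm hs u]
    rfl
  have t₅ : ip₂ g (fun a b => U i k b * u a) (U j) = ip g (U i k) (contr g U u j) := by
    rw [← t₄]
    exact ip₂_flip h₂₃ (fun a b => U i k a * u b) j
  have t₆ : ip₂ g (hookTensor g U u) (U j) =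
      4 / (n - 2) * gramContr g U j - 3 * ip g u (gram g U j) := by
    have : hookTensor g U u = (4 / ((n : ℝ) - 2)) • gram g U - (3 : ℝ) • contr g U u := rfl
    rw [this, ip₂_sub_left, ip₂_smul_left, ip₂_smul_left, ip₂_contr hs h₁₂ h₂₃, gramContr]
  have t₇ : ip₂ g (fun a b => g a k * hookTensor g U u i b) (U j) =
      ip g (hookTensor g U u i) (U j k) := ip₂_mul_metric hs hd _ _ _
  have t₈ : ip₂ g (fun a b => g b k * hookTensor g U u i a) (U j) =
      ip g (hookTensor g U u i) (U j k) := by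
    rw [← t₇]
    exact ip₂_flip h₂₃ (fun a b => g a k * hookTensor g U u i b) j
  have t₉ : ip₂ g (fun a b => g a i * traceTensor g U k b) (U j) =
      ip g (traceTensor g U k) (U i j) := by
    rw [ip₂_mul_metric hs hd, funext (h₁₂ j i)]
  have t₀ : ip₂ g (fun a b => g b i * traceTensor g U k a) (U j) =
      ip g (traceTensor g U k) (U i j) := by
    rw [← t₉]
    exact ip₂_flip h₂₃ (fun a b => g a i * traceTensor g U k b) j
  rw [e]
  simp only [ip₂_add_left, ip₂_sub_left, ip₂_smul_left, t₁, t₂, t₃, t₄, t₅, t₆, t₇, t₈, t₉, t₀, hG',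
    htr, ip₂_cubic_left hs h₁₂ h₂₃]
  rw [show ip₂ g (U i) (U j) = gram g U i j from rfl]
  ring

/-- Half of the differential of `tr 𝒰 = |U|²`. -/
theorem tr₂_ip₂_structureDeriv (hn : 3 ≤ n) (hs : ∀ i j, g i j = g j i) (hd : IsUnit g.det)
    (h₁₂ : ∀ i j k, U i j k = U j i k) (h₂₃ : ∀ i j k, U i j k = U i k j)
    (htr : ∀ i, tr₂ g (U i) = 0) (u : Fin n → ℝ) (k : Fin n) :
    tr₂ g (fun i j => ip₂ g (fun a b => structureDeriv g U u i a b k) (U j)) =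
      (n + 2) / (n - 2) * gramContr g U k + tr₂ g (gram g U) * u k := by
  have hn' : (3 : ℝ) ≤ n := by exact_mod_cast hn
  have h₂ : (n : ℝ) - 2 ≠ 0 := by linarith
  have t₁ : tr₂ g (fun i j => ip g (gram g U j) (U i k)) = gramContr g U k := by
    rw [gramContr, ip₂, ← tr₂_swap hs]
    simp only [funext (h₁₂ _ k)]
  have t₂ : tr₂ g (fun i j => tripleContr g U j k i) = gramContr g U k := by
    have : (fun i j => tripleContr g U j k i) =
        fun i j => tr₂ g fun a b => ip g (U k a) fun d => ip g (U j b) (U i d) := by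
      funext i j
      rw [tripleContr_swap₁₂ hs h₂₃]
      rfl
    rw [this, tr₂_comm]
    have : ∀ a b, tr₂ g (fun i j => ip g (U k a) fun d => ip g (U j b) (U i d)) =
        ip g (U k a) (gram g U b) := by
      intro a b
      rw [tr₂_ip]
      congr 1
      funext d
      rw [gram, ip₂, ← tr₂_swap hs]
      simp only [funext (h₁₂ _ b), funext (h₁₂ _ d)]
    simp only [this]
    rw [gramContr, ip₂_comm hs]
    rfl
  have t₃ : tr₂ g (fun i j => ip g (U i k) (contr g U u j)) = ip g u (gram g U k) := by
    rw [← ip₂_contr hs h₁₂ h₂₃, ip₂_comm hs]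
    simp only [funext (h₁₂ _ k)]
    rfl
  have t₄ : tr₂ g (fun i j => u i * gram g U j k) = ip g u (gram g U k) := by
    simp only [gram_symm hs _ k]
    rfl
  have t₅ : tr₂ g (fun i j => (4 / (n - 2) * gramContr g U j - 3 * ip g u (gram g U j)) * g i k) =
      4 / (n - 2) * gramContr g U k - 3 * ip g u (gram g U k) :=
    tr₂_mul_metric hs hd (fun j => 4 / (n - 2) * gramContr g U j - 3 * ip g u (gram g U j)) k
  have t₆ : tr₂ g (fun i j => ip g (hookTensor g U u i) (U j k)) =
      4 / (n - 2) * gramContr g U k - 3 * ip g u (gram g U k) := by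
    have : hookTensor g U u = (4 / ((n : ℝ) - 2)) • gram g U - (3 : ℝ) • contr g U u := rfl
    have h : tr₂ g (fun i j => ip g (hookTensor g U u i) (U j k)) =
        ip₂ g (hookTensor g U u) (U k) := by
      simp only [funext (h₁₂ _ k)]
      rfl
    rw [h, this, ip₂_sub_left, ip₂_smul_left, ip₂_smul_left, ip₂_contr hs h₁₂ h₂₃, gramContr]
  have t₇ : tr₂ g (fun i j => ip g (traceTensor g U k) (U i j)) = 0 := by
    rw [tr₂_ip]
    have h₀ (d : Fin n) : tr₂ g (fun a b => U a b d) = 0 := by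
      rw [← htr d]
      congr 1
      funext a b
      rw [h₂₃, h₁₂]
    simp only [h₀]
    exact ip_zero_right _
  have t₈ : tr₂ g (fun i j => gram g U i j) = tr₂ g (gram g U) := rfl
  simp only [ip₂_structureDeriv hs hd h₁₂ h₂₃ htr, tr₂_add, tr₂_sub, tr₂_const_mul, t₁, t₂, t₃, t₄,
    t₅, t₆, t₇, t₈]
  field_simp
  ring

/-- The algebraic identity behind the vanishing of the Cotton tensor. -/
theorem gramDeriv_antisymm (hn : 3 ≤ n) (hs : ∀ i j, g i j = g j i) (hd : IsUnit g.det)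
    (h₁₂ : ∀ i j k, U i j k = U j i k) (h₂₃ : ∀ i j k, U i j k = U i k j)
    (htr : ∀ i, tr₂ g (U i) = 0) (u : Fin n → ℝ) {Q : Fin n → Fin n → ℝ}
    (hW : ∀ i j k l, ip g (U k i) (U l j) - ip g (U k j) (U l i) = -kulkarniNomizu Q g i j k l)
    {D : Fin n → Fin n → Fin n → ℝ}
    (hD : ∀ i j k, D i j k = ip₂ g (fun a b => structureDeriv g U u i a b k) (U j)
      + ip₂ g (fun a b => structureDeriv g U u j a b k) (U i))
    {c : ℝ} (hc : c = (n - 6) / (2 * (n + 2) * (n - 1))) (i j k : Fin n) :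
    gram g U i j * u k - gram g U i k * u j + ip g u (gram g U k) * g i j
      - ip g u (gram g U j) * g i k
      + 2 * c * tr₂ g (gram g U) * (g i j * u k - g i k * u j)
      - (D i j k - D i k j)
      - c * (tr₂ g (fun a b => D a b k) * g i j - tr₂ g (fun a b => D a b j) * g i k) = 0 := by
  have hn' : (3 : ℝ) ≤ n := by exact_mod_cast hn
  have h1 : (n : ℝ) - 1 ≠ 0 := by linarith
  have h2 : (n : ℝ) - 2 ≠ 0 := by linarith
  have h2' : (n : ℝ) + 2 ≠ 0 := by linarith
  have hDt (k : Fin n) : tr₂ g (fun a b => D a b k) =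
      2 * ((n + 2) / (n - 2) * gramContr g U k + tr₂ g (gram g U) * u k) := by
    have : tr₂ g (fun a b => ip₂ g (fun c d => structureDeriv g U u b c d k) (U a)) =
        tr₂ g (fun a b => ip₂ g (fun c d => structureDeriv g U u a c d k) (U b)) := by
      rw [← tr₂_swap hs]
    simp only [hD, tr₂_add]
    rw [this, tr₂_ip₂_structureDeriv hn hs hd h₁₂ h₂₃ htr]
    ring
  -- The contractions of `𝒰` with `U` do not cancel by symmetry alone. With this identity they and
  -- the terms of `gramContr` in the skew part of `D` add up to the coefficient `(6 - n) / ((n - 1)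
  -- (n - 2))`, which the trace term balances exactly for the given `c`.
  have Y := gram_contr_antisymm hn hs hd h₁₂ h₂₃ htr hW j i k
  have hh (i : Fin n) (β : Fin n → ℝ) : ip g (hookTensor g U u i) β =
      4 / (n - 2) * ip g (gram g U i) β - 3 * ip g β (contr g U u i) := by
    have : hookTensor g U u i = (4 / ((n : ℝ) - 2)) • gram g U i - (3 : ℝ) • contr g U u i := rfl
    rw [this, ip_sub_left, ip_smul_left, ip_smul_left, ip_comm hs β]
  have ht (i j k : Fin n) : ip g (traceTensor g U i) (U j k) =
      2 / 3 * ((n + 2) / (n - 2)) * ip g (gram g U i) (U j k)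
      + 4 / (3 * (n - 2)) * tr₂ g (gram g U) * U j k i := by
    have : traceTensor g U i = (2 / 3 * ((n + 2) / ((n : ℝ) - 2))) • gram g U i
        + (4 / (3 * ((n : ℝ) - 2)) * tr₂ g (gram g U)) • g i := rfl
    rw [this, ip_add_left, ip_smul_left, ip_smul_left, ip_metric_left hd]
  rw [hDt, hDt, hD, hD, hc]
  simp only [ip₂_structureDeriv hs hd h₁₂ h₂₃ htr, hh, ht]
  rw [tripleContr_swap₂₃ hs h₂₃ j k i, tripleContr_swap₁₂ hs h₂₃ j i k,
    tripleContr_swap₂₃ hs h₂₃ i j k,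
    tripleContr_swap₂₃ hs h₂₃ k j i, tripleContr_swap₁₂ hs h₂₃ k i j,
    gram_symm hs j i, gram_symm hs k i, gram_symm hs k j,
    funext (h₁₂ j i), funext (h₁₂ k i), funext (h₁₂ k j), hs k j, h₂₃ i k j]
  have Y' : ip g (gram g U j) (U i k) = ip g (gram g U k) (U i j) +
    1 / (n - 1) * (gramContr g U k * g i j - gramContr g U j * g i k) := by linarith
  rw [Y']
  field_simp
  ring

end GramDerivative

/-! ### Calculus of partial derivatives. -/

section PartialDerivatives

variable {Ω : Set (EuclideanSpace ℝ (Fin n))} {F G : EuclideanSpace ℝ (Fin n) → ℝ}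
  {x : EuclideanSpace ℝ (Fin n)}

theorem differentiableAt_of_contDiffOn {V : Type*} [NormedAddCommGroup V] [NormedSpace ℝ V]
    {F : EuclideanSpace ℝ (Fin n) → V} (hΩ : IsOpen Ω) (hF : ContDiffOn ℝ ∞ F Ω)
    (hx : x ∈ Ω) : DifferentiableAt ℝ F x :=
  (hF.contDiffAt (hΩ.mem_nhds hx)).differentiableAt (by simp)

theorem pd_congr (hΩ : IsOpen Ω) (h : ∀ y ∈ Ω, F y = G y) (hx : x ∈ Ω) (i : Fin n) :
    pd i F x = pd i G x := by
  have : F =ᶠ[nhds x] G := Filter.eventuallyEq_of_mem (hΩ.mem_nhds hx) h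
  rw [pd, pd, this.fderiv_eq]

theorem pd_const (c : ℝ) (i : Fin n) : pd i (fun _ => c) x = 0 := by simp [pd]

theorem pd_add (hF : DifferentiableAt ℝ F x) (hG : DifferentiableAt ℝ G x) (i : Fin n) :
    pd i (fun y => F y + G y) x = pd i F x + pd i G x := by
  simp only [pd, fderiv_fun_add hF hG]; rfl

theorem pd_sub (hF : DifferentiableAt ℝ F x) (hG : DifferentiableAt ℝ G x) (i : Fin n) :
    pd i (fun y => F y - G y) x = pd i F x - pd i G x := by
  simp only [pd, fderiv_fun_sub hF hG]; rfl

theorem pd_neg (i : Fin n) : pd i (fun y => -F y) x = -pd i F x := by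
  simp only [pd, fderiv_fun_neg]; rfl

theorem pd_mul (hF : DifferentiableAt ℝ F x) (hG : DifferentiableAt ℝ G x) (i : Fin n) :
    pd i (fun y => F y * G y) x = pd i F x * G x + F x * pd i G x := by
  simp only [pd, fderiv_fun_mul hF hG, add_apply,
    smul_apply, smul_eq_mul]
  ring

theorem pd_const_mul (hF : DifferentiableAt ℝ F x) (c : ℝ) (i : Fin n) :
    pd i (fun y => c * F y) x = c * pd i F x := by
  rw [pd_mul (differentiableAt_const c) hF, pd_const]
  ring

theorem pd_sum {ι : Type*} (s : Finset ι) {F : ι → EuclideanSpace ℝ (Fin n) → ℝ}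
    (hF : ∀ a ∈ s, DifferentiableAt ℝ (F a) x) (i : Fin n) :
    pd i (fun y => ∑ a ∈ s, F a y) x = ∑ a ∈ s, pd i (F a) x := by
  simp only [pd, fderiv_fun_sum hF, sum_apply]

theorem contDiffOn_pd (hΩ : IsOpen Ω) (hF : ContDiffOn ℝ ∞ F Ω) (i : Fin n) :
    ContDiffOn ℝ ∞ (pd i F) Ω :=
  (hF.fderiv_of_isOpen hΩ (by simp)).clm_apply contDiffOn_const

theorem pd_pd {V : Type*} [NormedAddCommGroup V] [NormedSpace ℝ V]
    {F : EuclideanSpace ℝ (Fin n) → V} (hΩ : IsOpen Ω) (hF : ContDiffOn ℝ ∞ F Ω) (hx : x ∈ Ω)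
    (v w : EuclideanSpace ℝ (Fin n)) :
    fderiv ℝ (fun y => fderiv ℝ F y v) x w = fderiv ℝ (fderiv ℝ F) x w v := by
  have : DifferentiableAt ℝ (fderiv ℝ F) x :=
    differentiableAt_of_contDiffOn hΩ (hF.fderiv_of_isOpen hΩ (by simp)) hx
  rw [fderiv_clm_apply this (differentiableAt_const _)]
  simp

theorem fderiv_fderiv_comm {V : Type*} [NormedAddCommGroup V] [NormedSpace ℝ V]
    {F : EuclideanSpace ℝ (Fin n) → V} (hΩ : IsOpen Ω) (hF : ContDiffOn ℝ ∞ F Ω) (hx : x ∈ Ω)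
    (v w : EuclideanSpace ℝ (Fin n)) :
    fderiv ℝ (fderiv ℝ F) x v w = fderiv ℝ (fderiv ℝ F) x w v :=
  ((hF.contDiffAt (hΩ.mem_nhds hx)).isSymmSndFDerivAt (by simpa using
      (WithTop.coe_le_coe.2 le_top : ((2 : ℕ∞) : WithTop ℕ∞) ≤ ∞))).eq v w

theorem pd_comm (hΩ : IsOpen Ω) (hF : ContDiffOn ℝ ∞ F Ω) (hx : x ∈ Ω) (i j : Fin n) :
    pd i (pd j F) x = pd j (pd i F) x := by
  have h (i j : Fin n) : pd i (pd j F) x = fderiv ℝ (fderiv ℝ F) x (EuclideanSpace.single i 1)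
      (EuclideanSpace.single j 1) := pd_pd hΩ hF hx _ _
  rw [h, h, fderiv_fderiv_comm hΩ hF hx]

end PartialDerivatives

/-! ### Smoothness and derivative of the inverse metric. -/

section InverseMatrix

variable {Ω : Set (EuclideanSpace ℝ (Fin n))}

theorem contDiffOn_det {m : ℕ} {A : EuclideanSpace ℝ (Fin n) → Matrix (Fin m) (Fin m) ℝ}
    (hA : ∀ i j, ContDiffOn ℝ ∞ (fun x => A x i j) Ω) :
    ContDiffOn ℝ ∞ (fun x => (A x).det) Ω := by
  simp only [Matrix.det_apply]
  refine ContDiffOn.sum fun σ _ => ContDiffOn.const_smul _ ?_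
  exact contDiffOn_prod fun i _ => hA _ _

/-- Cramer's rule: the entries of the adjugate are determinants of matrices with smooth entries. -/
theorem contDiffOn_inv {m : ℕ} {A : EuclideanSpace ℝ (Fin n) → Matrix (Fin m) (Fin m) ℝ}
    (hA : ∀ i j, ContDiffOn ℝ ∞ (fun x => A x i j) Ω) (hd : ∀ x ∈ Ω, IsUnit (A x).det)
    (i j : Fin m) : ContDiffOn ℝ ∞ (fun x => (A x)⁻¹ i j) Ω := by
  have h : ∀ x ∈ Ω, (A x)⁻¹ i j = (A x).det⁻¹ * (A x).adjugate i j := fun x _ => by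
    rw [Matrix.inv_def, Ring.inverse_eq_inv', Matrix.smul_apply, smul_eq_mul]
  refine ContDiffOn.congr (ContDiffOn.mul (ContDiffOn.inv (contDiffOn_det hA) fun x hx =>
    (hd x hx).ne_zero) ?_) h
  simp only [Matrix.adjugate_apply]
  refine contDiffOn_det fun k l => ?_
  by_cases hk : k = j
  · subst hk; simpa using contDiffOn_const
  · simpa [Matrix.updateRow_ne hk] using hA k l

theorem pd_inv {m : ℕ} {A : EuclideanSpace ℝ (Fin n) → Matrix (Fin m) (Fin m) ℝ} (hΩ : IsOpen Ω)
    (hA : ∀ i j, ContDiffOn ℝ ∞ (fun x => A x i j) Ω) (hd : ∀ x ∈ Ω, IsUnit (A x).det)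
    {x : EuclideanSpace ℝ (Fin n)} (hx : x ∈ Ω) (k : Fin n) (i j : Fin m) :
    pd k (fun y => (A y)⁻¹ i j) x =
      -∑ a, ∑ b, (A x)⁻¹ i a * pd k (fun y => A y a b) x * (A x)⁻¹ b j := by
  have hdA (i j) := differentiableAt_of_contDiffOn hΩ (hA i j) hx
  have hdI (i j) := differentiableAt_of_contDiffOn hΩ (contDiffOn_inv hA hd i j) hx
  set A' : Matrix (Fin m) (Fin m) ℝ := Matrix.of fun i j => pd k (fun y => A y i j) x with hA'
  set I' : Matrix (Fin m) (Fin m) ℝ := Matrix.of fun i j => pd k (fun y => (A y)⁻¹ i j) x with hI'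
  have h₁ : A' * (A x)⁻¹ + A x * I' = 0 := by
    ext a c
    have h : pd k (fun y => ∑ b, A y a b * (A y)⁻¹ b c) x = 0 := by
      rw [← pd_const (x := x) ((1 : Matrix (Fin m) (Fin m) ℝ) a c) k]
      refine pd_congr hΩ (fun y hy => ?_) hx k
      rw [← Matrix.mul_apply, Matrix.mul_nonsing_inv _ (hd y hy)]
    rw [pd_sum (F := fun b y => A y a b * (A y)⁻¹ b c) _
      (fun b _ => (hdA a b).mul (hdI b c))] at h
    simp only [pd_mul (hdA a _) (hdI _ c), Finset.sum_add_distrib] at h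
    simpa [Matrix.add_apply, Matrix.mul_apply, hA', hI'] using h
  have h₂ : I' = -((A x)⁻¹ * A' * (A x)⁻¹) := by
    have h := congrArg (fun B => (A x)⁻¹ * B) h₁
    simp only [mul_add, mul_zero, ← mul_assoc, Matrix.nonsing_inv_mul _ (hd x hx), one_mul] at h
    exact eq_neg_of_add_eq_zero_right h
  have h₃ := congrFun (congrFun h₂ i) j
  simp only [hI', Matrix.of_apply, Matrix.neg_apply, Matrix.mul_apply, hA', Finset.sum_mul] at h₃
  rw [h₃, Finset.sum_comm]

end InverseMatrix

/-- `g` is the Gram matrix of a smooth pseudo-Riemannian metric on the open set `Ω`. -/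
structure IsMetricOn (Ω : Set (EuclideanSpace ℝ (Fin n)))
    (g : EuclideanSpace ℝ (Fin n) → Matrix (Fin n) (Fin n) ℝ) : Prop where
  isOpen : IsOpen Ω
  smooth : ∀ i j, ContDiffOn ℝ ∞ (fun x => g x i j) Ω
  symm : ∀ x ∈ Ω, ∀ i j, g x i j = g x j i
  det : ∀ x ∈ Ω, IsUnit (g x).det

/-- The Christoffel symbols of the first kind `g(∇_i ∂_j, ∂_k)`. -/
def chr (g : EuclideanSpace ℝ (Fin n) → Matrix (Fin n) (Fin n) ℝ)
    (x : EuclideanSpace ℝ (Fin n)) (i j k : Fin n) : ℝ :=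
  (1 / 2) * (pd i (fun y => g y j k) x + pd j (fun y => g y i k) x - pd k (fun y => g y i j) x)

/-- `(∇_k B)_{ij}` for a `(0,2)`-tensor `B`; the last index is the direction of
differentiation. -/
def covDeriv₂ (g : EuclideanSpace ℝ (Fin n) → Matrix (Fin n) (Fin n) ℝ)
    (B : EuclideanSpace ℝ (Fin n) → Fin n → Fin n → ℝ) (x : EuclideanSpace ℝ (Fin n))
    (i j k : Fin n) : ℝ :=
  pd k (fun y => B y i j) x - ip (g x) (chr g x k i) (fun a => B x a j)
    - ip (g x) (chr g x k j) (B x i)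

/-- The `(0,4)` curvature tensor `g(R(∂_i, ∂_j) ∂_l, ∂_k)`. -/
def riemannLower (g : EuclideanSpace ℝ (Fin n) → Matrix (Fin n) (Fin n) ℝ)
    (x : EuclideanSpace ℝ (Fin n)) (k l i j : Fin n) : ℝ :=
  pd i (fun y => chr g y j l k) x - pd j (fun y => chr g y i l k) x
    - ip (g x) (chr g x i k) (chr g x j l) + ip (g x) (chr g x j k) (chr g x i l)

theorem sum_swap₁₄ (F : Fin n → Fin n → Fin n → Fin n → ℝ) :
    ∑ i, ∑ j, ∑ c, ∑ d, F i j c d = ∑ d, ∑ j, ∑ c, ∑ i, F i j c d := by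
  have h : ∀ i, ∑ j, ∑ c, ∑ d, F i j c d = ∑ d, ∑ j, ∑ c, F i j c d := fun i => by
    rw [Finset.sum_congr rfl fun j _ => Finset.sum_comm, Finset.sum_comm]
  rw [Finset.sum_congr rfl fun i _ => h i, Finset.sum_comm]
  refine Finset.sum_congr rfl fun d _ => ?_
  rw [Finset.sum_comm]
  exact Finset.sum_congr rfl fun j _ => Finset.sum_comm

/-! ### The Levi-Civita connection and its curvature in coordinates, with lowered indices. -/

namespace IsMetricOn

variable {Ω : Set (EuclideanSpace ℝ (Fin n))}
  {g : EuclideanSpace ℝ (Fin n) → Matrix (Fin n) (Fin n) ℝ} {x : EuclideanSpace ℝ (Fin n)}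

theorem pd_symm (hg : IsMetricOn Ω g) (hx : x ∈ Ω) (i j k : Fin n) :
    pd k (fun y => g y i j) x = pd k (fun y => g y j i) x :=
  pd_congr hg.isOpen (fun y hy => hg.symm y hy i j) hx k

theorem chr_symm (hg : IsMetricOn Ω g) (hx : x ∈ Ω) (i j k : Fin n) :
    chr g x i j k = chr g x j i k := by
  rw [chr, chr, hg.pd_symm hx i j k]
  ring

theorem pd_metric (hg : IsMetricOn Ω g) (hx : x ∈ Ω) (i j k : Fin n) :
    pd k (fun y => g y i j) x = chr g x k i j + chr g x k j i := by
  rw [chr, chr, hg.pd_symm hx j i k]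
  ring

theorem contDiffOn_chr (hg : IsMetricOn Ω g) (i j k : Fin n) :
    ContDiffOn ℝ ∞ (fun x => chr g x i j k) Ω := by
  have h (i j k : Fin n) := contDiffOn_pd hg.isOpen (hg.smooth i j) k
  exact contDiffOn_const.mul (((h _ _ _).add (h _ _ _)).sub (h _ _ _))

theorem christoffel_eq (k i j : Fin n) :
    christoffel g k i j x = ∑ l, (g x)⁻¹ k l * chr g x i j l := by
  rw [christoffel, Finset.mul_sum]
  refine Finset.sum_congr rfl fun l _ => ?_
  rw [chr]
  ring

theorem sum_christoffel_mul (hg : IsMetricOn Ω g) (hx : x ∈ Ω) (i j : Fin n) (β : Fin n → ℝ) :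
    ∑ a, christoffel g a i j x * β a = ip (g x) (chr g x i j) β := by
  simp only [christoffel_eq]
  exact sum_raise_mul (hg.symm x hx) _ _

theorem contDiffOn_christoffel (hg : IsMetricOn Ω g) (k i j : Fin n) :
    ContDiffOn ℝ ∞ (christoffel g k i j) Ω := by
  have : christoffel g k i j = fun x => ∑ l, (g x)⁻¹ k l * chr g x i j l := by
    funext x; exact christoffel_eq k i j
  rw [this]
  exact ContDiffOn.sum fun l _ => (contDiffOn_inv hg.smooth hg.det k l).mul
      (hg.contDiffOn_chr i j l)

theorem sum_metric_mul_christoffel (hg : IsMetricOn Ω g) (hx : x ∈ Ω) (k i j : Fin n) :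
    ∑ a, g x k a * christoffel g a i j x = chr g x i j k := by
  rw [← ip_metric_right (hg.symm x hx) (hg.det x hx) k (chr g x i j),
    ← hg.sum_christoffel_mul hx]
  exact Finset.sum_congr rfl fun _ _ => mul_comm _ _

theorem covDeriv₁_eq (hg : IsMetricOn Ω g) (hx : x ∈ Ω)
    (u : EuclideanSpace ℝ (Fin n) → Fin n → ℝ) (i j : Fin n) :
    covDeriv₁ g u x i j = pd i (fun y => u y j) x - ip (g x) (chr g x i j) (u x) := by
  rw [covDeriv₁, hg.sum_christoffel_mul hx]

theorem covDeriv₃_eq (hg : IsMetricOn Ω g) (hx : x ∈ Ω)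
    (T : EuclideanSpace ℝ (Fin n) → Fin n → Fin n → Fin n → ℝ) (i j k l : Fin n) :
    covDeriv₃ g T x i j k l = pd l (fun y => T y i j k) x
      - ip (g x) (chr g x l i) (fun a => T x a j k) - ip (g x) (chr g x l j) (fun a => T x i a k)
      - ip (g x) (chr g x l k) (T x i j) := by
  rw [covDeriv₃, Finset.sum_add_distrib, Finset.sum_add_distrib]
  rw [hg.sum_christoffel_mul hx l i fun a => T x a j k,
    hg.sum_christoffel_mul hx l j fun a => T x i a k, hg.sum_christoffel_mul hx]
  ring

theorem contDiffOn_tr₂ (hg : IsMetricOn Ω g) {B : EuclideanSpace ℝ (Fin n) → Fin n → Fin n → ℝ}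
    (hB : ∀ i j, ContDiffOn ℝ ∞ (fun y => B y i j) Ω) :
    ContDiffOn ℝ ∞ (fun y => tr₂ (g y) (B y)) Ω := by
  simp only [tr₂]
  exact ContDiffOn.sum fun i _ => ContDiffOn.sum fun j _ =>
    (contDiffOn_inv hg.smooth hg.det i j).mul (hB i j)

theorem contDiffOn_ip (hg : IsMetricOn Ω g) {α β : EuclideanSpace ℝ (Fin n) → Fin n → ℝ}
    (hα : ∀ i, ContDiffOn ℝ ∞ (fun y => α y i) Ω) (hβ : ∀ i, ContDiffOn ℝ ∞ (fun y => β y i) Ω) :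
    ContDiffOn ℝ ∞ (fun y => ip (g y) (α y) (β y)) Ω :=
  hg.contDiffOn_tr₂ (B := fun y a b => α y a * β y b) fun i j => (hα i).mul (hβ j)

theorem contDiffOn_ip₂ (hg : IsMetricOn Ω g)
    {A B : EuclideanSpace ℝ (Fin n) → Fin n → Fin n → ℝ}
    (hA : ∀ i j, ContDiffOn ℝ ∞ (fun y => A y i j) Ω)
    (hB : ∀ i j, ContDiffOn ℝ ∞ (fun y => B y i j) Ω) :
    ContDiffOn ℝ ∞ (fun y => ip₂ (g y) (A y) (B y)) Ω :=
  hg.contDiffOn_tr₂ (B := fun y a b => ip (g y) (A y a) (B y b)) fun i j =>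
    hg.contDiffOn_ip (hA i) (hB j)

/-- Contraction commutes with the Levi-Civita connection: by metricity (`pd_metric`) the derivative
of `g⁻¹` consists of two Christoffel terms, which are those in the covariant derivative of `B`. The
product rules `pd_ip` and `pd_ip₂` follow. -/
theorem pd_tr₂ (hg : IsMetricOn Ω g) (hx : x ∈ Ω)
    {B : EuclideanSpace ℝ (Fin n) → Fin n → Fin n → ℝ}
    (hB : ∀ i j, ContDiffOn ℝ ∞ (fun y => B y i j) Ω) (k : Fin n) :
    pd k (fun y => tr₂ (g y) (B y)) x = tr₂ (g x) fun i j => covDeriv₂ g B x i j k := by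
  have hI (i j) := differentiableAt_of_contDiffOn hg.isOpen (contDiffOn_inv hg.smooth hg.det i j) hx
  have hB' (i j) := differentiableAt_of_contDiffOn hg.isOpen (hB i j) hx
  have h₁ : pd k (fun y => tr₂ (g y) (B y)) x =
      ∑ i, ∑ j, (pd k (fun y => (g y)⁻¹ i j) x * B x i j + (g x)⁻¹ i j * pd k (fun y => B y i j) x)
        := by
    simp only [tr₂]
    rw [pd_sum (F := fun i y => ∑ j, (g y)⁻¹ i j * B y i j) _
      (fun i _ => DifferentiableAt.fun_sum fun j _ => (hI i j).mul (hB' i j))]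
    refine Finset.sum_congr rfl fun i _ => ?_
    rw [pd_sum (F := fun j y => (g y)⁻¹ i j * B y i j) _ (fun j _ => (hI i j).mul (hB' i j))]
    exact Finset.sum_congr rfl fun j _ => pd_mul (hI i j) (hB' i j) k
  have h₂ : tr₂ (g x) (fun i j => ip (g x) (chr g x k i) fun a => B x a j) =
      ∑ i, ∑ j, (∑ a, ∑ b, (g x)⁻¹ i a * chr g x k b a * (g x)⁻¹ b j) * B x i j := by
    simp only [ip, tr₂, Finset.mul_sum, Finset.sum_mul]
    rw [sum_swap₁₄]
    refine Finset.sum_congr rfl fun d _ => Finset.sum_congr rfl fun j _ =>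
      Finset.sum_congr rfl fun c _ => Finset.sum_congr rfl fun i _ => ?_
    rw [inv_symm (hg.symm x hx) d c]
    ring
  have h₃ : tr₂ (g x) (fun i j => ip (g x) (chr g x k j) (B x i)) =
      ∑ i, ∑ j, (∑ a, ∑ b, (g x)⁻¹ i a * chr g x k a b * (g x)⁻¹ b j) * B x i j := by
    simp only [ip, tr₂, Finset.mul_sum, Finset.sum_mul]
    refine Finset.sum_congr rfl fun i _ => ?_
    rw [Finset.sum_congr rfl fun j _ => Finset.sum_comm, Finset.sum_comm]
    refine Finset.sum_congr rfl fun d _ =>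
      Finset.sum_congr rfl fun j _ => Finset.sum_congr rfl fun c _ => ?_
    ring
  have h₄ (i j : Fin n) : pd k (fun y => (g y)⁻¹ i j) x =
      -(∑ a, ∑ b, (g x)⁻¹ i a * chr g x k b a * (g x)⁻¹ b j)
      - (∑ a, ∑ b, (g x)⁻¹ i a * chr g x k a b * (g x)⁻¹ b j) := by
    rw [pd_inv hg.isOpen hg.smooth hg.det hx, ← Finset.sum_neg_distrib, ← Finset.sum_neg_distrib,
      ← Finset.sum_sub_distrib]
    refine Finset.sum_congr rfl fun a _ => ?_
    rw [← Finset.sum_neg_distrib, ← Finset.sum_neg_distrib, ← Finset.sum_sub_distrib]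
    refine Finset.sum_congr rfl fun b _ => ?_
    rw [hg.pd_metric hx]
    ring
  simp only [covDeriv₂, tr₂_sub]
  rw [h₁, h₂, h₃]
  simp only [h₄, Finset.sum_add_distrib, sub_mul, neg_mul, Finset.sum_sub_distrib,
    Finset.sum_neg_distrib, tr₂]
  ring

theorem ip_ip_comm (γ α : Fin n → ℝ) (A : Fin n → Fin n → ℝ) (h : Matrix (Fin n) (Fin n) ℝ) :
    ip h γ (fun c => ip h (A c) α) = ip h (fun d => ip h γ fun c => A c d) α := by
  simp only [ip, ← tr₂_const_mul, ← tr₂_mul_const]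
  rw [tr₂_comm]
  simp only [mul_assoc]

theorem pd_ip (hg : IsMetricOn Ω g) (hx : x ∈ Ω) {α β : EuclideanSpace ℝ (Fin n) → Fin n → ℝ}
    (hα : ∀ i, ContDiffOn ℝ ∞ (fun y => α y i) Ω) (hβ : ∀ i, ContDiffOn ℝ ∞ (fun y => β y i) Ω)
    (k : Fin n) :
    pd k (fun y => ip (g y) (α y) (β y)) x =
      ip (g x) (covDeriv₁ g α x k) (β x) + ip (g x) (α x) (covDeriv₁ g β x k) := by
  have h := hg.pd_tr₂ hx (B := fun y a b => α y a * β y b) (fun i j => (hα i).mul (hβ j)) k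
  have h' : (fun y => ip (g y) (α y) (β y)) = fun y => tr₂ (g y) fun a b => α y a * β y b := rfl
  rw [h', h, ip, ip, ← tr₂_add]
  congr 1
  funext a b
  have e₁ : ip (g x) (chr g x k a) (fun c => α x c * β x b) =
      ip (g x) (chr g x k a) (α x) * β x b := by
    rw [ip, ip, ← tr₂_mul_const]
    simp only [mul_assoc]
  have e₂ : ip (g x) (chr g x k b) (fun c => α x a * β x c) =
      α x a * ip (g x) (chr g x k b) (β x) := ip_smul_right _ _ _
  rw [covDeriv₂, e₁, e₂, pd_mul (differentiableAt_of_contDiffOn hg.isOpen (hα a) hx)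
    (differentiableAt_of_contDiffOn hg.isOpen (hβ b) hx), hg.covDeriv₁_eq hx, hg.covDeriv₁_eq hx]
  ring

theorem pd_ip₂ (hg : IsMetricOn Ω g) (hx : x ∈ Ω)
    {A B : EuclideanSpace ℝ (Fin n) → Fin n → Fin n → ℝ}
    (hA : ∀ i j, ContDiffOn ℝ ∞ (fun y => A y i j) Ω)
    (hB : ∀ i j, ContDiffOn ℝ ∞ (fun y => B y i j) Ω) (k : Fin n) :
    pd k (fun y => ip₂ (g y) (A y) (B y)) x =
      ip₂ (g x) (fun a b => covDeriv₂ g A x a b k) (B x)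
      + ip₂ (g x) (A x) (fun a b => covDeriv₂ g B x a b k) := by
  have h := hg.pd_tr₂ hx (B := fun y a b => ip (g y) (A y a) (B y b))
    (fun i j => hg.contDiffOn_ip (hA i) (hB j)) k
  have h' : (fun y => ip₂ (g y) (A y) (B y)) =
    fun y => tr₂ (g y) fun a b => ip (g y) (A y a) (B y b) := rfl
  rw [h', h, ip₂, ip₂, ← tr₂_add]
  congr 1
  funext a b
  have e₁ : ip (g x) (fun d => covDeriv₂ g A x a d k) (B x b) =
      ip (g x) (covDeriv₁ g (fun y => A y a) x k) (B x b)
      - ip (g x) (chr g x k a) (fun c => ip (g x) (A x c) (B x b)) := by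
    rw [ip_ip_comm, ← ip_sub_left]
    congr 1
    funext d
    simp only [covDeriv₂, Pi.sub_apply, hg.covDeriv₁_eq hx]
    ring
  have e₂ : ip (g x) (A x a) (fun d => covDeriv₂ g B x b d k) =
      ip (g x) (A x a) (covDeriv₁ g (fun y => B y b) x k)
      - ip (g x) (chr g x k b) (fun c => ip (g x) (A x a) (B x c)) := by
    have : (fun c => ip (g x) (A x a) (B x c)) = fun c => ip (g x) (B x c) (A x a) := by
      funext c; exact ip_comm (hg.symm x hx) _ _
    rw [this, ip_ip_comm, ip_comm (hg.symm x hx) _ (A x a), ← ip_sub_right]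
    congr 1
    funext d
    simp only [covDeriv₂, Pi.sub_apply, hg.covDeriv₁_eq hx]
    ring
  rw [covDeriv₂, hg.pd_ip hx (hA a) (hB b), e₁, e₂]
  ring

/-- Moving `g` inside `∂Γ` costs a derivative of `g`, that is two Christoffel terms. One cancels the
quadratic term of `riemann`; the other is the quadratic term of `riemannLower`, with the opposite
sign. -/
theorem sum_metric_mul_riemann (hg : IsMetricOn Ω g) (hx : x ∈ Ω) (k l i j : Fin n) :
    ∑ a, g x k a * riemann g a l i j x = riemannLower g x k l i j := by
  have hd (a i j) := differentiableAt_of_contDiffOn hg.isOpen (hg.contDiffOn_christoffel a i j) hx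
  have hd' (i j) := differentiableAt_of_contDiffOn hg.isOpen (hg.smooth i j) hx
  have e₁ (i j : Fin n) : ∑ a, g x k a * pd i (christoffel g a j l) x =
      pd i (fun y => chr g y j l k) x
        - ip (g x) (chr g x j l) (fun a => chr g x i k a + chr g x i a k) := by
    have h : pd i (fun y => chr g y j l k) x =
        pd i (fun y => ∑ a, g y k a * christoffel g a j l y) x :=
      pd_congr hg.isOpen (fun y hy => (hg.sum_metric_mul_christoffel hy k j l).symm) hx i
    rw [h, pd_sum (F := fun a y => g y k a * christoffel g a j l y) _
      (fun a _ => (hd' k a).mul (hd a j l)), ← hg.sum_christoffel_mul hx]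
    rw [← Finset.sum_sub_distrib]
    refine Finset.sum_congr rfl fun a _ => ?_
    rw [pd_mul (hd' k a) (hd a j l), hg.pd_metric hx]
    ring
  have e₂ (i j : Fin n) : ∑ a, g x k a * ∑ m, christoffel g a i m x * christoffel g m j l x =
      ip (g x) (chr g x j l) (fun m => chr g x i m k) := by
    simp only [Finset.mul_sum]
    rw [Finset.sum_comm, ← hg.sum_christoffel_mul hx]
    refine Finset.sum_congr rfl fun m _ => ?_
    rw [← hg.sum_metric_mul_christoffel hx, Finset.mul_sum]
    exact Finset.sum_congr rfl fun a _ => by ring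
  simp only [riemann, Finset.sum_sub_distrib, mul_add, mul_sub, Finset.sum_add_distrib, e₁, e₂]
  have e₃ (i j : Fin n) : ip (g x) (chr g x j l) (fun a => chr g x i k a + chr g x i a k) =
      ip (g x) (chr g x j l) (chr g x i k) + ip (g x) (chr g x j l) (fun a => chr g x i a k) :=
    ip_add_right _ _ _
  rw [e₃, e₃, riemannLower, ip_comm (hg.symm x hx) (chr g x j l) (chr g x i k),
    ip_comm (hg.symm x hx) (chr g x i l) (chr g x j k)]
  ring

theorem riemannLower_antisymm (hg : IsMetricOn Ω g) (hx : x ∈ Ω) (k l i j : Fin n) :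
    riemannLower g x k l i j = -riemannLower g x l k i j := by
  have hd (i j k) := differentiableAt_of_contDiffOn hg.isOpen
    (contDiffOn_pd hg.isOpen (hg.smooth i j) k) hx
  have e (i j k l : Fin n) : pd l (fun y => chr g y i j k) x = 1 / 2 *
      (pd l (pd i fun y => g y j k) x + pd l (pd j fun y => g y i k) x
        - pd l (pd k fun y => g y i j) x) := by
    simp only [chr]
    rw [pd_const_mul (((hd _ _ _).fun_add (hd _ _ _)).fun_sub (hd _ _ _)),
      pd_sub ((hd _ _ _).fun_add (hd _ _ _)) (hd _ _ _), pd_add (hd _ _ _) (hd _ _ _)]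
  have s (i j k l : Fin n) : pd l (pd k fun y => g y i j) x = pd l (pd k fun y => g y j i) x :=
    pd_congr hg.isOpen (fun y hy => hg.pd_symm hy i j k) hx l
  simp only [riemannLower, e]
  rw [pd_comm hg.isOpen (hg.smooth l k) hx j i, pd_comm hg.isOpen (hg.smooth k l) hx j i,
    s k l j i, ip_comm (hg.symm x hx) (chr g x i l), ip_comm (hg.symm x hx) (chr g x j l)]
  ring

/-- The Ricci identity for one-forms. The arguments of `covDeriv₁` are exchanged so that the later
differentiation always stands last. -/
theorem ip_covDeriv₁_comm (hg : IsMetricOn Ω g) (hx : x ∈ Ω)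
    {u : EuclideanSpace ℝ (Fin n) → Fin n → ℝ} (hu : ∀ i, ContDiffOn ℝ ∞ (fun y => u y i) Ω)
    (i j k : Fin n) :
    covDeriv₂ g (fun y a b => covDeriv₁ g u y b a) x i j k
      - covDeriv₂ g (fun y a b => covDeriv₁ g u y b a) x i k j =
      -ip (g x) (fun a => riemannLower g x a i k j) (u x) := by
  have hu' (i) := differentiableAt_of_contDiffOn hg.isOpen
    (contDiffOn_pd hg.isOpen (hu i) j) hx
  have e (j k : Fin n) : pd k (fun y => covDeriv₁ g u y j i) x =
      pd k (pd j fun y => u y i) x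
        - (ip (g x) (covDeriv₁ g (fun y => chr g y j i) x k) (u x)
          + ip (g x) (chr g x j i) (covDeriv₁ g u x k)) := by
    rw [← hg.pd_ip hx (fun a => hg.contDiffOn_chr j i a) hu, ← pd_sub
      (differentiableAt_of_contDiffOn hg.isOpen (contDiffOn_pd hg.isOpen (hu i) j) hx)
      (differentiableAt_of_contDiffOn hg.isOpen
        (hg.contDiffOn_ip (fun a => hg.contDiffOn_chr j i a) hu) hx)]
    exact pd_congr hg.isOpen (fun y hy => hg.covDeriv₁_eq hy u j i) hx k
  have r : (fun a => riemannLower g x a i k j) =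
      covDeriv₁ g (fun y => chr g y j i) x k - covDeriv₁ g (fun y => chr g y k i) x j := by
    funext a
    simp only [Pi.sub_apply, hg.covDeriv₁_eq hx, riemannLower]
    ring
  rw [covDeriv₂, covDeriv₂, e, e, r, ip_sub_left, pd_comm hg.isOpen (hu i) hx k j,
    funext (hg.chr_symm hx k j)]
  ring

end IsMetricOn

/-- The partial derivative `∂_i F` of a vector-valued function. -/
def pdv {V : Type*} [NormedAddCommGroup V] [NormedSpace ℝ V] (i : Fin n)
    (F : EuclideanSpace ℝ (Fin n) → V) (x : EuclideanSpace ℝ (Fin n)) : V :=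
  fderiv ℝ F x (EuclideanSpace.single i 1)

/-! ### Partial derivatives of vector-valued functions. -/

section VectorPartialDerivatives

variable {V : Type*} [NormedAddCommGroup V] [NormedSpace ℝ V]
  {Ω : Set (EuclideanSpace ℝ (Fin n))} {F : EuclideanSpace ℝ (Fin n) → V}
  {x : EuclideanSpace ℝ (Fin n)}

theorem contDiffOn_pdv (hΩ : IsOpen Ω) (hF : ContDiffOn ℝ ∞ F Ω) (i : Fin n) :
    ContDiffOn ℝ ∞ (pdv i F) Ω :=
  (hF.fderiv_of_isOpen hΩ (by simp)).clm_apply contDiffOn_const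

theorem pdv_pdv (hΩ : IsOpen Ω) (hF : ContDiffOn ℝ ∞ F Ω) (hx : x ∈ Ω) (i j : Fin n) :
    pdv i (pdv j F) x = fderiv ℝ (fderiv ℝ F) x (EuclideanSpace.single i 1)
      (EuclideanSpace.single j 1) := pd_pd hΩ hF hx _ _

theorem pdv_comm (hΩ : IsOpen Ω) (hF : ContDiffOn ℝ ∞ F Ω) (hx : x ∈ Ω) (i j : Fin n) :
    pdv i (pdv j F) x = pdv j (pdv i F) x := by
  rw [pdv_pdv hΩ hF hx, pdv_pdv hΩ hF hx, fderiv_fderiv_comm hΩ hF hx]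

theorem pdv_congr {G : EuclideanSpace ℝ (Fin n) → V} (hΩ : IsOpen Ω) (h : ∀ y ∈ Ω, F y = G y)
    (hx : x ∈ Ω) (i : Fin n) : pdv i F x = pdv i G x := by
  have : F =ᶠ[nhds x] G := Filter.eventuallyEq_of_mem (hΩ.mem_nhds hx) h
  rw [pdv, pdv, this.fderiv_eq]

theorem pd_clm_apply (hΩ : IsOpen Ω) {A : EuclideanSpace ℝ (Fin n) → V →L[ℝ] ℝ}
    (hA : ContDiffOn ℝ ∞ A Ω) (hF : ContDiffOn ℝ ∞ F Ω) (hx : x ∈ Ω) (i : Fin n) :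
    pd i (fun y => A y (F y)) x = pdv i A x (F x) + A x (pdv i F x) := by
  rw [pd, fderiv_clm_apply (differentiableAt_of_contDiffOn hΩ hA hx)
    (differentiableAt_of_contDiffOn hΩ hF hx)]
  simp [pdv, add_comm]

end VectorPartialDerivatives

/-- The matrix of the covectors `θ, θ₁, …, θₙ` in the standard basis. -/
def coframeMatrix (θ : EuclideanSpace ℝ (Fin (n + 1)) →L[ℝ] ℝ)
    (θ' : Fin n → EuclideanSpace ℝ (Fin (n + 1)) →L[ℝ] ℝ) :
    Matrix (Fin (n + 1)) (Fin (n + 1)) ℝ :=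
  Matrix.of fun a c =>
    (Fin.cons θ θ' : Fin (n + 1) → EuclideanSpace ℝ (Fin (n + 1)) →L[ℝ] ℝ) a
      (EuclideanSpace.single c 1)

/-! ### Frames adapted to a co-normal. -/

section Coframe

variable {θ : EuclideanSpace ℝ (Fin (n + 1)) →L[ℝ] ℝ}
  {θ' : Fin n → EuclideanSpace ℝ (Fin (n + 1)) →L[ℝ] ℝ}
  {v : Fin n → EuclideanSpace ℝ (Fin (n + 1))} {g : Matrix (Fin n) (Fin n) ℝ}

theorem coframeMatrix_mulVec (w : EuclideanSpace ℝ (Fin (n + 1))) (a : Fin (n + 1)) :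
    (coframeMatrix θ θ').mulVec w.ofLp a =
      (Fin.cons θ θ' : Fin (n + 1) → EuclideanSpace ℝ (Fin (n + 1)) →L[ℝ] ℝ) a w := by
  set α := (Fin.cons θ θ' : Fin (n + 1) → EuclideanSpace ℝ (Fin (n + 1)) →L[ℝ] ℝ) a with hα
  have hw : w = ∑ c, w c • EuclideanSpace.single c (1 : ℝ) := by
    ext c
    simp [Finset.sum_apply, Pi.single_apply]
  conv_rhs => rw [hw, map_sum]
  simp only [Matrix.mulVec, dotProduct, coframeMatrix, Matrix.of_apply, map_smul, smul_eq_mul, ← hα]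
  exact Finset.sum_congr rfl fun c _ => mul_comm _ _

/-- In a linear relation between the covectors, evaluation on the `v j` removes `θ`, and the
non-degeneracy of `g` then forces the coefficients of the `θ' i` to vanish; finally `θ ≠ 0`. -/
theorem det_coframeMatrix_ne_zero (hθ : θ ≠ 0) (h₀ : ∀ j, θ (v j) = 0)
    (h₁ : ∀ i j, θ' i (v j) = -g i j) (hd : IsUnit g.det) : (coframeMatrix θ θ').det ≠ 0 := by
  intro h
  obtain ⟨c, hc, hcz⟩ := Matrix.exists_vecMul_eq_zero_iff.2 h
  have hL : ∀ w : EuclideanSpace ℝ (Fin (n + 1)), c 0 * θ w + ∑ i, c (Fin.succ i) * θ' i w = 0 := by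
    intro w
    have := congrArg (fun r => r ⬝ᵥ w.ofLp) hcz
    rw [← Matrix.dotProduct_mulVec] at this
    simp only [zero_dotProduct] at this
    simpa only [dotProduct, coframeMatrix_mulVec, Fin.sum_univ_succ, Fin.cons_zero,
      Fin.cons_succ] using this
  have hci : (fun i => c (Fin.succ i)) = 0 := by
    refine Matrix.eq_zero_of_vecMul_eq_zero hd.ne_zero ?_
    funext j
    have := hL (v j)
    simp only [h₀, h₁, mul_zero, zero_add, mul_neg, Finset.sum_neg_distrib, neg_eq_zero] at this
    simpa [Matrix.vecMul, dotProduct] using this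
  have hc0 : c 0 = 0 := by
    by_contra hne
    refine hθ (ContinuousLinearMap.ext fun w => ?_)
    have := hL w
    have h' (i : Fin n) : c (Fin.succ i) = 0 := congrFun hci i
    simp only [h', zero_mul, Finset.sum_const_zero, add_zero] at this
    simpa [hne] using this
  exact hc (funext fun a => Fin.cases hc0 (fun i => congrFun hci i) a)

theorem exists_transversal (hθ : θ ≠ 0) (h₀ : ∀ j, θ (v j) = 0)
    (h₁ : ∀ i j, θ' i (v j) = -g i j) (hd : IsUnit g.det) :
    ∃ ξ, θ ξ = 1 ∧ ∀ i, θ' i ξ = 0 := by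
  obtain ⟨w, hw⟩ : ∃ w, θ w ≠ 0 := by
    by_contra! h
    exact hθ (ContinuousLinearMap.ext h)
  -- Normalise a vector on which `θ` does not vanish, then add the combination of the `v j` that the
  -- `θ' i` require; this does not change the value of `θ`.
  refine ⟨(θ w)⁻¹ • w + ∑ j, (g⁻¹.mulVec fun i => (θ w)⁻¹ * θ' i w) j • v j, ?_, fun i => ?_⟩
  · simp [h₀, hw]
  · simp only [map_add, map_smul, map_sum, smul_eq_mul, h₁]
    have : ∑ j, (g⁻¹.mulVec fun i => (θ w)⁻¹ * θ' i w) j * -g i j =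
        -(g.mulVec (g⁻¹.mulVec fun i => (θ w)⁻¹ * θ' i w)) i := by
      simp only [Matrix.mulVec, dotProduct, mul_neg, Finset.sum_neg_distrib, neg_inj]
      exact Finset.sum_congr rfl fun _ _ => mul_comm _ _
    rw [this, Matrix.mulVec_mulVec, Matrix.mul_nonsing_inv _ hd, Matrix.one_mulVec]
    ring

/-- Expansion of the pairing of a covector and a vector in a frame `v₁, …, vₙ, ξ` adapted to the
covectors `θ, θ₁, …, θₙ`. -/
theorem apply_eq_of_transversal (hs : ∀ i j, g i j = g j i) (hθ : θ ≠ 0) (h₀ : ∀ j, θ (v j) = 0)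
    (h₁ : ∀ i j, θ' i (v j) = -g i j) (hd : IsUnit g.det)
    {ξ : EuclideanSpace ℝ (Fin (n + 1))} (hξ : θ ξ = 1) (hξ' : ∀ i, θ' i ξ = 0)
    (α : EuclideanSpace ℝ (Fin (n + 1)) →L[ℝ] ℝ) (w : EuclideanSpace ℝ (Fin (n + 1))) :
    α w = -ip g (fun a => α (v a)) (fun b => θ' b w) + θ w * α ξ := by
  set c : Fin n → ℝ := g⁻¹.mulVec fun b => θ' b w with hc
  -- All `n + 1` covectors of the coframe vanish on the left-hand side.
  have hw : w - θ w • ξ + ∑ a, c a • v a = 0 := by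
    have : (w - θ w • ξ + ∑ a, c a • v a).ofLp = 0 := by
      refine Matrix.eq_zero_of_mulVec_eq_zero (det_coframeMatrix_ne_zero hθ h₀ h₁ hd) ?_
      funext a
      rw [coframeMatrix_mulVec]
      refine Fin.cases ?_ (fun i => ?_) a
      · simp [h₀, hξ]
      · have : ∑ j, c j * g i j = θ' i w := by
          have : ∑ j, c j * g i j = (g.mulVec c) i := by
            simp only [Matrix.mulVec, dotProduct]
            exact Finset.sum_congr rfl fun _ _ => mul_comm _ _
          rw [this, hc, Matrix.mulVec_mulVec, Matrix.mul_nonsing_inv _ hd, Matrix.one_mulVec]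
        simp [h₁, hξ', this]
    ext k
    exact congrFun this k
  have h := congrArg α hw
  simp only [map_add, map_sub, map_smul, map_sum, smul_eq_mul, map_zero] at h
  have : ∑ a, c a * α (v a) = ip g (fun a => α (v a)) (fun b => θ' b w) := by
    rw [ip_comm hs, ← sum_raise_mul hs]
    rfl
  linarith

end Coframe

/-- The Gram matrix `-⟨∂_i Θ, ∂_j F⟩` of the affine metric in coordinates. -/
def localMetric (F : EuclideanSpace ℝ (Fin n) → EuclideanSpace ℝ (Fin (n + 1)))
    (Θ : EuclideanSpace ℝ (Fin n) → EuclideanSpace ℝ (Fin (n + 1)) →L[ℝ] ℝ)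
    (x : EuclideanSpace ℝ (Fin n)) : Matrix (Fin n) (Fin n) ℝ :=
  Matrix.of fun i j => -(pdv i Θ x) (pdv j F x)

/-- The components of the cubic form in coordinates. -/
def localCubic (F : EuclideanSpace ℝ (Fin n) → EuclideanSpace ℝ (Fin (n + 1)))
    (Θ : EuclideanSpace ℝ (Fin n) → EuclideanSpace ℝ (Fin (n + 1)) →L[ℝ] ℝ)
    (x : EuclideanSpace ℝ (Fin n)) (i j k : Fin n) : ℝ :=
  (1 / 2) * (pdv i (pdv j Θ) x (pdv k F x) - pdv k Θ x (pdv i (pdv j F) x))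

/-- A smooth map with a co-normal field on an open set of `ℝⁿ`. -/
structure IsConormalPair (Ω : Set (EuclideanSpace ℝ (Fin n)))
    (F : EuclideanSpace ℝ (Fin n) → EuclideanSpace ℝ (Fin (n + 1)))
    (Θ : EuclideanSpace ℝ (Fin n) → EuclideanSpace ℝ (Fin (n + 1)) →L[ℝ] ℝ) : Prop where
  isOpen : IsOpen Ω
  smooth₁ : ContDiffOn ℝ ∞ F Ω
  smooth₂ : ContDiffOn ℝ ∞ Θ Ω
  ne_zero : ∀ x ∈ Ω, Θ x ≠ 0
  conormal : ∀ x ∈ Ω, ∀ i, Θ x (pdv i F x) = 0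
  det : ∀ x ∈ Ω, IsUnit (localMetric F Θ x).det

/-! ### Structure equations of a co-normal pair. -/

namespace IsConormalPair

variable {Ω : Set (EuclideanSpace ℝ (Fin n))}
  {F : EuclideanSpace ℝ (Fin n) → EuclideanSpace ℝ (Fin (n + 1))}
  {Θ : EuclideanSpace ℝ (Fin n) → EuclideanSpace ℝ (Fin (n + 1)) →L[ℝ] ℝ}
  {x : EuclideanSpace ℝ (Fin n)}

theorem smooth_pdv₁ (h : IsConormalPair Ω F Θ) (i : Fin n) : ContDiffOn ℝ ∞ (pdv i F) Ω :=
  contDiffOn_pdv h.isOpen h.smooth₁ i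

theorem smooth_pdv₂ (h : IsConormalPair Ω F Θ) (i : Fin n) : ContDiffOn ℝ ∞ (pdv i Θ) Ω :=
  contDiffOn_pdv h.isOpen h.smooth₂ i

/-- Differentiate `⟨Θ, ∂_j F⟩ = 0`. As second derivatives commute, the affine metric is symmetric.
-/
theorem conormal_pdv_pdv (h : IsConormalPair Ω F Θ) (hx : x ∈ Ω) (i j : Fin n) :
    Θ x (pdv i (pdv j F) x) = localMetric F Θ x i j := by
  have e := pd_congr (F := fun y => Θ y (pdv j F y)) (G := fun _ => 0) h.isOpen
    (fun y hy => h.conormal y hy j) hx i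
  rw [pd_const, pd_clm_apply h.isOpen h.smooth₂ (h.smooth_pdv₁ j) hx] at e
  simp only [localMetric, Matrix.of_apply]
  linarith

theorem isMetricOn (h : IsConormalPair Ω F Θ) : IsMetricOn Ω (localMetric F Θ) where
  isOpen := h.isOpen
  smooth i j := ((h.smooth_pdv₂ i).clm_apply (h.smooth_pdv₁ j)).neg
  symm x hx i j := by
    rw [← h.conormal_pdv_pdv hx, ← h.conormal_pdv_pdv hx, pdv_comm h.isOpen h.smooth₁ hx]
  det := h.det

theorem pd_localMetric (h : IsConormalPair Ω F Θ) (hx : x ∈ Ω) (i j k : Fin n) :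
    pd k (fun y => localMetric F Θ y i j) x =
      -(pdv k (pdv i Θ) x (pdv j F x)) - pdv i Θ x (pdv k (pdv j F) x) := by
  simp only [localMetric, Matrix.of_apply]
  rw [pd_neg, pd_clm_apply h.isOpen (h.smooth_pdv₂ i) (h.smooth_pdv₁ j) hx]
  ring

theorem localCubic_symm₁₂ (h : IsConormalPair Ω F Θ) (hx : x ∈ Ω) (i j k : Fin n) :
    localCubic F Θ x i j k = localCubic F Θ x j i k := by
  rw [localCubic, localCubic, pdv_comm h.isOpen h.smooth₁ hx, pdv_comm h.isOpen h.smooth₂ hx]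

/-- The symmetry of `∂_i G_{jk}` in `j`, `k`, written out. -/
theorem localCubic_symm₂₃ (h : IsConormalPair Ω F Θ) (hx : x ∈ Ω) (i j k : Fin n) :
    localCubic F Θ x i j k = localCubic F Θ x i k j := by
  have e := h.isMetricOn.pd_symm hx j k i
  rw [h.pd_localMetric hx, h.pd_localMetric hx] at e
  rw [localCubic, localCubic]
  linarith

/-- The induced connection is the Levi-Civita connection plus `C`, and the connection defined by the
derivatives of `Θ` is the Levi-Civita connection minus `C` (`chr_sub_localCubic`). So second
derivatives of `F` and `Θ` are governed by these two conjugate connections. -/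
theorem chr_add_localCubic (h : IsConormalPair Ω F Θ) (hx : x ∈ Ω) (i j k : Fin n) :
    chr (localMetric F Θ) x i j k + localCubic F Θ x i j k =
      -(pdv k Θ x (pdv i (pdv j F) x)) := by
  have e := h.isMetricOn.pd_symm hx j k i
  rw [h.pd_localMetric hx, h.pd_localMetric hx] at e
  rw [chr, h.pd_localMetric hx, h.pd_localMetric hx, h.pd_localMetric hx, localCubic,
    pdv_comm h.isOpen h.smooth₂ hx j i, pdv_comm h.isOpen h.smooth₂ hx k i,
    pdv_comm h.isOpen h.smooth₁ hx k j]
  linarith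

theorem chr_sub_localCubic (h : IsConormalPair Ω F Θ) (hx : x ∈ Ω) (i j k : Fin n) :
    chr (localMetric F Θ) x i j k - localCubic F Θ x i j k =
      -(pdv i (pdv j Θ) x (pdv k F x)) := by
  have e := h.chr_add_localCubic hx i j k
  have e' : localCubic F Θ x i j k =
    (1 / 2) * (pdv i (pdv j Θ) x (pdv k F x) - pdv k Θ x (pdv i (pdv j F) x)) := rfl
  linarith

theorem contDiffOn_localCubic (h : IsConormalPair Ω F Θ) (i j k : Fin n) :
    ContDiffOn ℝ ∞ (fun y => localCubic F Θ y i j k) Ω :=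
  contDiffOn_const.mul
    (((contDiffOn_pdv h.isOpen (h.smooth_pdv₂ j) i).clm_apply (h.smooth_pdv₁ k)).sub
      ((h.smooth_pdv₂ k).clm_apply (contDiffOn_pdv h.isOpen (h.smooth_pdv₁ j) i)))

/-- The Gauss and Codazzi equations, combined. -/
theorem gauss_codazzi (h : IsConormalPair Ω F Θ) (hx : x ∈ Ω) :
    ∃ b : Fin n → Fin n → ℝ, (∀ i j, b i j = b j i) ∧ ∀ i j k l,
      riemannLower (localMetric F Θ) x k i l j
        + covDeriv₃ (localMetric F Θ) (localCubic F Θ) x i j k l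
        - covDeriv₃ (localMetric F Θ) (localCubic F Θ) x i l k j =
      ip (localMetric F Θ x) (localCubic F Θ x j k) (localCubic F Θ x i l)
        - ip (localMetric F Θ x) (localCubic F Θ x l k) (localCubic F Θ x i j)
        - localMetric F Θ x i j * b l k + localMetric F Θ x i l * b j k := by
  have hg := h.isMetricOn
  have hs := hg.symm x hx
  set g := localMetric F Θ with hgdef
  set C := localCubic F Θ with hC
  obtain ⟨ξ, hξ, hξ'⟩ := exists_transversal (v := fun j => pdv j F x) (θ' := fun i => pdv i Θ x)
    (g := g x) (h.ne_zero x hx) (h.conormal x hx) (fun i j => by simp [hgdef, localMetric])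
    (h.det x hx)
  -- `b` is the transversal component of the second derivatives of the co-normal.
  refine ⟨fun k l => pdv k (pdv l Θ) x ξ, fun i j => congrArg (fun α => α ξ)
      (pdv_comm h.isOpen h.smooth₂ hx i j),
    fun i j k l => ?_⟩
  have hexp (l k i j : Fin n) : pdv l (pdv k Θ) x (pdv i (pdv j F) x) =
      -ip (g x) (chr g x l k - C x l k) (chr g x i j + C x i j)
        + g x i j * pdv l (pdv k Θ) x ξ := by
    rw [apply_eq_of_transversal (v := fun j => pdv j F x) hs (h.ne_zero x hx) (h.conormal x hx)
      (fun i j => by simp [hgdef, localMetric]) (h.det x hx) hξ hξ', h.conormal_pdv_pdv hx]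
    have e₁ : (fun a => pdv l (pdv k Θ) x (pdv a F x)) = (-1 : ℝ) • (chr g x l k - C x l k) := by
      funext a
      simp only [Pi.smul_apply, Pi.sub_apply, smul_eq_mul, hgdef, hC, h.chr_sub_localCubic hx]
      ring
    have e₂ : (fun b => pdv b Θ x (pdv i (pdv j F) x)) = (-1 : ℝ) • (chr g x i j + C x i j) := by
      funext a
      simp only [Pi.smul_apply, Pi.add_apply, smul_eq_mul, hgdef, hC, h.chr_add_localCubic hx]
      ring
    rw [e₁, e₂, ip_smul_left, ip_smul_right]
    ring
  have hder (i j k l : Fin n) : pd l (fun y => chr g y i j k) x + pd l (fun y => C y i j k) x =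
      -(pdv l (pdv k Θ) x (pdv i (pdv j F) x)) - pdv k Θ x (pdv l (pdv i (pdv j F)) x) := by
    rw [← pd_add (differentiableAt_of_contDiffOn h.isOpen (hg.contDiffOn_chr i j k) hx)
      (differentiableAt_of_contDiffOn h.isOpen (h.contDiffOn_localCubic i j k) hx),
      pd_congr h.isOpen (fun y hy => h.chr_add_localCubic hy i j k) hx, pd_neg,
      pd_clm_apply h.isOpen (h.smooth_pdv₂ k) (contDiffOn_pdv h.isOpen (h.smooth_pdv₁ j) i) hx]
    ring
  -- The flatness of the ambient space: third derivatives of `F` are symmetric, so they cancel when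
  -- `j` and `l` are exchanged in `hder`. The second derivatives left over are expanded by `hexp`.
  have h3 : pdv l (pdv i (pdv j F)) x = pdv j (pdv i (pdv l F)) x := by
    rw [pdv_comm h.isOpen (h.smooth_pdv₁ j) hx l i, pdv_congr h.isOpen
      (fun y hy => pdv_comm h.isOpen h.smooth₁ hy l j) hx i,
      pdv_comm h.isOpen (h.smooth_pdv₁ l) hx i j]
  have d₁ := hder i j k l
  have d₂ := hder i l k j
  rw [hexp] at d₁ d₂
  rw [h3] at d₁
  have c₁ (a b : Fin n) : (fun c => C x c a b) = C x a b := by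
    funext c
    rw [hC, h.localCubic_symm₁₂ hx, h.localCubic_symm₂₃ hx]
  have c₂ (a b : Fin n) : (fun c => C x a c b) = C x a b := by
    funext c
    rw [hC, h.localCubic_symm₂₃ hx]
  have p₁ : pd l (fun y => chr g y j i k) x = pd l (fun y => chr g y i j k) x :=
    pd_congr h.isOpen (fun y hy => hg.chr_symm hy j i k) hx l
  have p₂ : pd j (fun y => chr g y l i k) x = pd j (fun y => chr g y i l k) x :=
    pd_congr h.isOpen (fun y hy => hg.chr_symm hy l i k) hx j
  rw [hg.covDeriv₃_eq hx, hg.covDeriv₃_eq hx, riemannLower, c₁, c₁, p₁, p₂]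
  simp only [ip_sub_left, ip_add_right] at d₁ d₂
  rw [funext (hg.chr_symm hx j i), funext (hg.chr_symm hx l i), funext (hg.chr_symm hx j l)]
  rw [ip_comm hs (chr g x i l) (C x j k), ip_comm hs (chr g x i j) (C x l k)]
  linarith

end IsConormalPair

/-! ### Covariant derivatives of cubic tensors. -/

namespace IsMetricOn

variable {Ω : Set (EuclideanSpace ℝ (Fin n))}
  {g : EuclideanSpace ℝ (Fin n) → Matrix (Fin n) (Fin n) ℝ} {x : EuclideanSpace ℝ (Fin n)}
  {T U : EuclideanSpace ℝ (Fin n) → Fin n → Fin n → Fin n → ℝ}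

theorem covDeriv₃_symm₁₂ (hg : IsMetricOn Ω g) (hx : x ∈ Ω)
    (hT : ∀ y ∈ Ω, ∀ i j k, T y i j k = T y j i k) (i j k l : Fin n) :
    covDeriv₃ g T x i j k l = covDeriv₃ g T x j i k l := by
  rw [hg.covDeriv₃_eq hx, hg.covDeriv₃_eq hx, pd_congr hg.isOpen (fun y hy => hT y hy i j k) hx,
    funext fun a => hT x hx a j k, funext fun a => hT x hx i a k, funext fun a => hT x hx i j a]
  ring

theorem covDeriv₃_symm₂₃ (hg : IsMetricOn Ω g) (hx : x ∈ Ω)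
    (hT : ∀ y ∈ Ω, ∀ i j k, T y i j k = T y i k j) (i j k l : Fin n) :
    covDeriv₃ g T x i j k l = covDeriv₃ g T x i k j l := by
  rw [hg.covDeriv₃_eq hx, hg.covDeriv₃_eq hx, pd_congr hg.isOpen (fun y hy => hT y hy i j k) hx,
    funext fun a => hT x hx a j k, funext fun a => hT x hx i a k,
    show T x i j = fun a => T x i a j from funext fun a => hT x hx i j a]
  ring

theorem covDeriv₂_congr (hg : IsMetricOn Ω g) (hx : x ∈ Ω)
    {A B : EuclideanSpace ℝ (Fin n) → Fin n → Fin n → ℝ}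
    (hA : ∀ y ∈ Ω, ∀ i j, A y i j = B y i j) (i j k : Fin n) :
    covDeriv₂ g A x i j k = covDeriv₂ g B x i j k := by
  have : A x = B x := funext fun i => funext fun j => hA x hx i j
  rw [covDeriv₂, covDeriv₂, pd_congr hg.isOpen (fun y hy => hA y hy i j) hx, this]

/-- As `g` is parallel, only `U` and `u` are differentiated. -/
theorem covDeriv₃_withTrace (hg : IsMetricOn Ω g) (hx : x ∈ Ω)
    {u : EuclideanSpace ℝ (Fin n) → Fin n → ℝ}
    (hU : ∀ i j k, ContDiffOn ℝ ∞ (fun y => U y i j k) Ω)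
    (hu : ∀ i, ContDiffOn ℝ ∞ (fun y => u y i) Ω) (i j k l : Fin n) :
    covDeriv₃ g (fun y => withTrace (g y) (U y) (u y)) x i j k l =
      covDeriv₃ g U x i j k l + covDeriv₁ g u x l i * g x j k + covDeriv₁ g u x l j * g x i k
        + covDeriv₁ g u x l k * g x i j := by
  have hs := hg.symm x hx
  have hd := hg.det x hx
  have hU' (i j k) := differentiableAt_of_contDiffOn hg.isOpen (hU i j k) hx
  have hu' (i) := differentiableAt_of_contDiffOn hg.isOpen (hu i) hx
  have hg' (i j) := differentiableAt_of_contDiffOn hg.isOpen (hg.smooth i j) hx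
  have hm (i j k : Fin n) := (hu' i).fun_mul (hg' j k)
  have e : pd l (fun y => withTrace (g y) (U y) (u y) i j k) x =
      pd l (fun y => U y i j k) x
        + (pd l (fun y => u y i) x * g x j k + u x i * (chr g x l j k + chr g x l k j)
        + (pd l (fun y => u y j) x * g x i k + u x j * (chr g x l i k + chr g x l k i))
        + (pd l (fun y => u y k) x * g x i j + u x k * (chr g x l i j + chr g x l j i))) := by
    simp only [withTrace]
    rw [pd_add (hU' i j k) (((hm _ _ _).fun_add (hm _ _ _)).fun_add (hm _ _ _)),
      pd_add ((hm _ _ _).fun_add (hm _ _ _)) (hm _ _ _), pd_add (hm _ _ _) (hm _ _ _),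
      pd_mul (hu' _) (hg' _ _), pd_mul (hu' _) (hg' _ _), pd_mul (hu' _) (hg' _ _),
      hg.pd_metric hx, hg.pd_metric hx, hg.pd_metric hx]
  have m (γ : Fin n → ℝ) (p : Fin n) : ip (g x) γ (fun a => g x p a) = γ p :=
    ip_metric_right hs hd p γ
  have w₁ (γ : Fin n → ℝ) (j k : Fin n) :
      ip (g x) γ (fun a => withTrace (g x) (U x) (u x) a j k) =
        ip (g x) γ (fun a => U x a j k) + ip (g x) γ (u x) * g x j k + u x j * γ k + u x k * γ j :=
            by
    have : (fun a => withTrace (g x) (U x) (u x) a j k) = (fun a => U x a j k)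
        + (g x j k) • u x + (u x j) • (fun a => g x k a) + (u x k) • fun a => g x j a := by
      funext a
      simp only [withTrace, Pi.add_apply, Pi.smul_apply, smul_eq_mul, hs a]
      ring
    rw [this]
    simp only [ip_add_right, ip_smul_right, m]
    ring
  have w₂ (γ : Fin n → ℝ) (j k : Fin n) :
      ip (g x) γ (fun a => withTrace (g x) (U x) (u x) j a k) =
        ip (g x) γ (fun a => U x j a k) + ip (g x) γ (u x) * g x j k + u x j * γ k + u x k * γ j :=
            by
    have : (fun a => withTrace (g x) (U x) (u x) j a k) = (fun a => U x j a k)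
        + (g x j k) • u x + (u x j) • (fun a => g x k a) + (u x k) • fun a => g x j a := by
      funext a
      simp only [withTrace, Pi.add_apply, Pi.smul_apply, smul_eq_mul, hs a k]
      ring
    rw [this]
    simp only [ip_add_right, ip_smul_right, m]
    ring
  have w₃ (γ : Fin n → ℝ) (j k : Fin n) :
      ip (g x) γ (withTrace (g x) (U x) (u x) j k) =
        ip (g x) γ (U x j k) + ip (g x) γ (u x) * g x j k + u x j * γ k + u x k * γ j := by
    have : withTrace (g x) (U x) (u x) j k = U x j k
        + (g x j k) • u x + (u x j) • (fun a => g x k a) + (u x k) • fun a => g x j a := by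
      funext a
      simp only [withTrace, Pi.add_apply, Pi.smul_apply, smul_eq_mul]
      ring
    rw [this]
    simp only [ip_add_right, ip_smul_right, m]
    ring
  rw [hg.covDeriv₃_eq hx, hg.covDeriv₃_eq hx, e, w₁, w₂, w₃, hg.covDeriv₁_eq hx,
    hg.covDeriv₁_eq hx, hg.covDeriv₁_eq hx]
  ring

theorem tr₂_covDeriv₃ (hg : IsMetricOn Ω g) (hx : x ∈ Ω)
    (hU : ∀ i j k, ContDiffOn ℝ ∞ (fun y => U y i j k) Ω)
    (h₀ : ∀ y ∈ Ω, ∀ k, tr₂ (g y) (fun i j => U y i j k) = 0) (k l : Fin n) :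
    tr₂ (g x) (fun i j => covDeriv₃ g U x i j k l) = 0 := by
  have e₁ : tr₂ (g x) (fun i j => covDeriv₂ g (fun y i j => U y i j k) x i j l) = 0 := by
    rw [← hg.pd_tr₂ hx (fun i j => hU i j k), pd_congr hg.isOpen (fun y hy => h₀ y hy k) hx,
      pd_const]
  have e₂ : tr₂ (g x) (fun i j => ip (g x) (chr g x l k) (U x i j)) = 0 := by
    rw [tr₂_ip]
    have : (fun b => tr₂ (g x) fun i j => U x i j b) = (0 : Fin n → ℝ) := funext (h₀ x hx)
    rw [this, ip_zero_right]
  have e₃ : (fun i j => covDeriv₃ g U x i j k l) = fun i j =>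
      covDeriv₂ g (fun y i j => U y i j k) x i j l - ip (g x) (chr g x l k) (U x i j) := by
    funext i j
    rw [hg.covDeriv₃_eq hx, covDeriv₂]
  rw [e₃, tr₂_sub, e₁, e₂, sub_zero]

end IsMetricOn

/-! ### Separation of the Gauss and Codazzi equations. -/

namespace IsConormalPair

variable {Ω : Set (EuclideanSpace ℝ (Fin n))}
  {F : EuclideanSpace ℝ (Fin n) → EuclideanSpace ℝ (Fin (n + 1))}
  {Θ : EuclideanSpace ℝ (Fin n) → EuclideanSpace ℝ (Fin (n + 1)) →L[ℝ] ℝ}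
  {x : EuclideanSpace ℝ (Fin n)}

/-- The equations of Codazzi and Gauss. -/
theorem codazzi_and_gauss (h : IsConormalPair Ω F Θ) (hx : x ∈ Ω) :
    ∃ b : Fin n → Fin n → ℝ, (∀ i j, b i j = b j i) ∧
      (∀ i j k l, covDeriv₃ (localMetric F Θ) (localCubic F Θ) x i j k l
        - covDeriv₃ (localMetric F Θ) (localCubic F Θ) x i j l k =
        (localMetric F Θ x i l * b j k + localMetric F Θ x j l * b i k
          - localMetric F Θ x i k * b j l - localMetric F Θ x j k * b i l) / 2) ∧
      ∀ i j k l, riemannLower (localMetric F Θ) x k l i j =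
        ip (localMetric F Θ x) (localCubic F Θ x k j) (localCubic F Θ x l i)
          - ip (localMetric F Θ x) (localCubic F Θ x k i) (localCubic F Θ x l j)
        - kulkarniNomizu b (localMetric F Θ x) i j k l / 2 := by
  obtain ⟨b, hb, H⟩ := h.gauss_codazzi hx
  have hs := h.isMetricOn.symm x hx
  have s₁₂ := h.isMetricOn.covDeriv₃_symm₁₂ hx (T := localCubic F Θ)
    (fun y hy => h.localCubic_symm₁₂ hy)
  have s₂₃ := h.isMetricOn.covDeriv₃_symm₂₃ hx (T := localCubic F Θ)
    (fun y hy => h.localCubic_symm₂₃ hy)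
  have c₁₂ (i j : Fin n) : localCubic F Θ x i j = localCubic F Θ x j i :=
    funext (h.localCubic_symm₁₂ hx i j)
  have ra := h.isMetricOn.riemannLower_antisymm hx
  have comm := ip_comm hs
  generalize localMetric F Θ = g at *
  generalize localCubic F Θ = C at *
  refine ⟨b, hb, fun i j k l => ?_, fun i j k l => ?_⟩
  -- The curvature is skew in its first pair of arguments, whereas the derivatives of the totally
  -- symmetric cubic are symmetric in the corresponding ones. Adding two instances of the combined
  -- equation removes the curvature.
  · have a₁ := H i k j l
    have a₂ := H j k i l
    rw [ra, c₁₂ k i, c₁₂ j l, comm, c₁₂ l i] at a₂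
    rw [c₁₂ k j, comm (C x j k)] at a₁
    have n₁ := s₂₃ i k j l
    have n₂ := s₂₃ i l j k
    have n₃ : covDeriv₃ g C x j k i l = covDeriv₃ g C x i j k l := by rw [s₂₃, s₁₂]
    have n₄ : covDeriv₃ g C x j l i k = covDeriv₃ g C x i j l k := by rw [s₂₃, s₁₂]
    rw [n₁, n₂] at a₁
    rw [n₃, n₄] at a₂
    have b₁ := hb l j
    have b₂ := hb k j
    have b₃ := hb l i
    have b₄ := hb k i
    rw [b₁, b₂] at a₁
    rw [b₃, b₄] at a₂
    linarith
  -- Subtracting two instances removes the derivatives of the cubic.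
  · have a₁ := H l j k i
    have a₂ := H k j l i
    have n₁ : covDeriv₃ g C x k j l i = covDeriv₃ g C x l j k i := by rw [s₂₃, s₁₂, s₂₃]
    have n₂ : covDeriv₃ g C x k i l j = covDeriv₃ g C x l i k j := by rw [s₂₃, s₁₂, s₂₃]
    rw [ra, n₁, n₂] at a₂
    rw [c₁₂ j l, c₁₂ i l] at a₂
    rw [c₁₂ j k, c₁₂ i k] at a₁
    rw [comm (C x l i), comm (C x l j)] at a₂
    simp only [kulkarniNomizu]
    rw [hs j l, hs i k, hs j k, hs i l]
    linarith

end IsConormalPair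

/-- The trace part of the cubic form in coordinates. -/
def localTrace (F : EuclideanSpace ℝ (Fin n) → EuclideanSpace ℝ (Fin (n + 1)))
    (Θ : EuclideanSpace ℝ (Fin n) → EuclideanSpace ℝ (Fin (n + 1)) →L[ℝ] ℝ)
    (x : EuclideanSpace ℝ (Fin n)) (i : Fin n) : ℝ :=
  1 / ((n : ℝ) + 2) * tr₂ (localMetric F Θ x) (localCubic F Θ x i)

/-- The trace-free part of the cubic form in coordinates. -/
def localTraceFree (F : EuclideanSpace ℝ (Fin n) → EuclideanSpace ℝ (Fin (n + 1)))
    (Θ : EuclideanSpace ℝ (Fin n) → EuclideanSpace ℝ (Fin (n + 1)) →L[ℝ] ℝ)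
    (x : EuclideanSpace ℝ (Fin n)) (i j k : Fin n) : ℝ :=
  localCubic F Θ x i j k - (localTrace F Θ x i * localMetric F Θ x j k
    + localTrace F Θ x j * localMetric F Θ x i k + localTrace F Θ x k * localMetric F Θ x i j)

/-- The defining equations of an abundant co-normalisation, in coordinates. -/
structure IsAbundantPair (Ω : Set (EuclideanSpace ℝ (Fin n)))
    (F : EuclideanSpace ℝ (Fin n) → EuclideanSpace ℝ (Fin (n + 1)))
    (Θ : EuclideanSpace ℝ (Fin n) → EuclideanSpace ℝ (Fin (n + 1)) →L[ℝ] ℝ) : Prop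
    extends IsConormalPair Ω F Θ where
  three_le : 3 ≤ n
  weyl : ∀ x ∈ Ω, ∀ i j k l, weyl (localMetric F Θ) x i j k l = 0
  covDeriv_U : ∀ x ∈ Ω, ∀ i j k l,
    sym₄TraceFree (localMetric F Θ x) (covDeriv₃ (localMetric F Θ) (localTraceFree F Θ) x) i j k l =
      sym₄TraceFree (localMetric F Θ x) (fun a b c d =>
        compEndo (localMetric F Θ x) (localTraceFree F Θ x) a b d c
          + 4 * (localTraceFree F Θ x a b c * localTrace F Θ x d)) i j k l
  covDeriv_u : ∀ x ∈ Ω, ∀ i j,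
    covDeriv₁ (localMetric F Θ) (localTrace F Θ) x i j =
      schouten (localMetric F Θ) x i j + localTrace F Θ x i * localTrace F Θ x j
      - normSq₁ (localMetric F Θ x) (localTrace F Θ x) / 2 * localMetric F Θ x i j
      + 1 / ((n : ℝ) - 2) * (trEndo (localMetric F Θ x) (localTraceFree F Θ x) i j
        + ((n : ℝ) - 6) / (2 * ((n : ℝ) + 2) * ((n : ℝ) - 1))
          * normSq₃ (localMetric F Θ x) (localTraceFree F Θ x) * localMetric F Θ x i j)

/-! ### Trace and trace-free part of the cubic. -/

namespace IsConormalPair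

variable {Ω : Set (EuclideanSpace ℝ (Fin n))}
  {F : EuclideanSpace ℝ (Fin n) → EuclideanSpace ℝ (Fin (n + 1))}
  {Θ : EuclideanSpace ℝ (Fin n) → EuclideanSpace ℝ (Fin (n + 1)) →L[ℝ] ℝ}
  {x : EuclideanSpace ℝ (Fin n)}

theorem localCubic_eq (x) : localCubic F Θ x =
    withTrace (localMetric F Θ x) (localTraceFree F Θ x) (localTrace F Θ x) := by
  funext i j k
  simp only [withTrace, localTraceFree]
  ring

theorem contDiffOn_localTrace (h : IsConormalPair Ω F Θ) (i : Fin n) :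
    ContDiffOn ℝ ∞ (fun y => localTrace F Θ y i) Ω :=
  contDiffOn_const.mul (h.isMetricOn.contDiffOn_tr₂ fun j k => h.contDiffOn_localCubic i j k)

theorem contDiffOn_localTraceFree (h : IsConormalPair Ω F Θ) (i j k : Fin n) :
    ContDiffOn ℝ ∞ (fun y => localTraceFree F Θ y i j k) Ω := by
  have hm (i j k : Fin n) := (h.contDiffOn_localTrace i).mul (h.isMetricOn.smooth j k)
  exact (h.contDiffOn_localCubic i j k).sub (((hm _ _ _).add (hm _ _ _)).add (hm _ _ _))

theorem localTraceFree_symm₁₂ (h : IsConormalPair Ω F Θ) (hx : x ∈ Ω) (i j k : Fin n) :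
    localTraceFree F Θ x i j k = localTraceFree F Θ x j i k := by
  rw [localTraceFree, localTraceFree, h.localCubic_symm₁₂ hx, h.isMetricOn.symm x hx i j]
  ring

theorem localTraceFree_symm₂₃ (h : IsConormalPair Ω F Θ) (hx : x ∈ Ω) (i j k : Fin n) :
    localTraceFree F Θ x i j k = localTraceFree F Θ x i k j := by
  rw [localTraceFree, localTraceFree, h.localCubic_symm₂₃ hx, h.isMetricOn.symm x hx j k]
  ring

/-- The three subtracted products have trace `n u`, `u` and `u`, hence the normalisation of `u` by
`n + 2`. -/
theorem tr₂_localTraceFree (h : IsConormalPair Ω F Θ) (hx : x ∈ Ω) (i : Fin n) :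
    tr₂ (localMetric F Θ x) (localTraceFree F Θ x i) = 0 := by
  have hs := h.isMetricOn.symm x hx
  have hd := h.det x hx
  have e : localTraceFree F Θ x i = fun j k => localCubic F Θ x i j k
      - (localTrace F Θ x i * localMetric F Θ x j k
      + localTrace F Θ x j * localMetric F Θ x i k
      + localMetric F Θ x i j * localTrace F Θ x k) := by
    funext j k
    rw [localTraceFree]
    ring
  rw [e, tr₂_sub, tr₂_add, tr₂_add, tr₂_const_mul _ fun a b => localMetric F Θ x a b,
    tr₂_metric hs hd]
  have e₁ := ip_metric_left hd i (localTrace F Θ x)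
  have e₂ := ip_metric_right hs hd i (localTrace F Θ x)
  have e₃ : localTrace F Θ x i = 1 / ((n : ℝ) + 2) * tr₂ (localMetric F Θ x) (localCubic F Θ x i) :=
    rfl
  rw [ip] at e₁ e₂
  rw [e₁, e₂]
  have : (n : ℝ) + 2 ≠ 0 := by positivity
  field_simp at e₃
  linarith

end IsConormalPair

/-! ### Integrability conditions of an abundant co-normalisation. -/

namespace IsAbundantPair

variable {Ω : Set (EuclideanSpace ℝ (Fin n))}
  {F : EuclideanSpace ℝ (Fin n) → EuclideanSpace ℝ (Fin (n + 1))}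
  {Θ : EuclideanSpace ℝ (Fin n) → EuclideanSpace ℝ (Fin (n + 1)) →L[ℝ] ℝ}
  {x : EuclideanSpace ℝ (Fin n)}

/-- The symmetry of the Ricci tensor follows from the pair symmetry of the curvature, which is
visible in the Gauss equation. -/
theorem schouten_symm (h : IsAbundantPair Ω F Θ) (hx : x ∈ Ω) (i j : Fin n) :
    schouten (localMetric F Θ) x i j = schouten (localMetric F Θ) x j i := by
  have hg := h.isMetricOn
  have hs := hg.symm x hx
  have hd := hg.det x hx
  have hr (i j : Fin n) : ricci (localMetric F Θ) x i j =
      tr₂ (localMetric F Θ x) fun a b => riemannLower (localMetric F Θ) x b j a i := by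
    simp only [ricci, tr₂, ← hg.sum_metric_mul_riemann hx, Finset.mul_sum]
    refine Finset.sum_congr rfl fun a _ => ?_
    rw [Finset.sum_comm]
    have : ∀ c, ∑ b, (localMetric F Θ x)⁻¹ a b * (localMetric F Θ x b c
        * riemann (localMetric F Θ) c j a i x) =
        (1 : Matrix (Fin n) (Fin n) ℝ) a c * riemann (localMetric F Θ) c j a i x := fun c => by
      rw [← Matrix.nonsing_inv_mul _ hd, Matrix.mul_apply, Finset.sum_mul]
      exact Finset.sum_congr rfl fun b _ => by ring
    simp only [this, Matrix.one_apply, ite_mul, one_mul, zero_mul, Finset.sum_ite_eq,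
      Finset.mem_univ, if_true]
  obtain ⟨b, hb, -, hG⟩ := h.codazzi_and_gauss hx
  have c₁₂ (i j : Fin n) : localCubic F Θ x i j = localCubic F Θ x j i :=
    funext (h.localCubic_symm₁₂ hx i j)
  have hp (k l i j : Fin n) : riemannLower (localMetric F Θ) x k l i j =
      riemannLower (localMetric F Θ) x i j k l := by
    rw [hG, hG, c₁₂ k j, c₁₂ l i, c₁₂ k i, c₁₂ l j, ip_comm hs (localCubic F Θ x j k)]
    simp only [kulkarniNomizu]
    rw [hs j l, hs i k, hs j k, hs i l, hb j l, hb i k, hb j k, hb i l]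
    ring
  have : ricci (localMetric F Θ) x i j = ricci (localMetric F Θ) x j i := by
    rw [hr, hr, tr₂_swap hs]
    simp only [hp _ j]
  rw [schouten, schouten, this, hs i j]

end IsAbundantPair

namespace IsAbundantPair

variable {Ω : Set (EuclideanSpace ℝ (Fin n))}
  {F : EuclideanSpace ℝ (Fin n) → EuclideanSpace ℝ (Fin (n + 1))}
  {Θ : EuclideanSpace ℝ (Fin n) → EuclideanSpace ℝ (Fin (n + 1)) →L[ℝ] ℝ}
  {x : EuclideanSpace ℝ (Fin n)}

theorem riemannLower_eq (h : IsAbundantPair Ω F Θ) (hx : x ∈ Ω) (i j k l : Fin n) :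
    riemannLower (localMetric F Θ) x k l i j =
      kulkarniNomizu (schouten (localMetric F Θ) x) (localMetric F Θ x) i j k l := by
  rw [← h.isMetricOn.sum_metric_mul_riemann hx, ← sub_eq_zero]
  exact h.weyl x hx i j k l

theorem covDeriv_u_eq (h : IsAbundantPair Ω F Θ) (hx : x ∈ Ω) (i j : Fin n) :
    covDeriv₁ (localMetric F Θ) (localTrace F Θ) x i j =
      schouten (localMetric F Θ) x i j + localTrace F Θ x i * localTrace F Θ x j
      - normSq₁ (localMetric F Θ x) (localTrace F Θ x) / 2 * localMetric F Θ x i j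
      + 1 / ((n : ℝ) - 2) * (gram (localMetric F Θ x) (localTraceFree F Θ x) i j
        + ((n : ℝ) - 6) / (2 * ((n : ℝ) + 2) * ((n : ℝ) - 1))
          * tr₂ (localMetric F Θ x) (gram (localMetric F Θ x) (localTraceFree F Θ x))
          * localMetric F Θ x i j) := by
  rw [h.covDeriv_u x hx, trEndo_eq (h.isMetricOn.symm x hx) (h.localTraceFree_symm₂₃ hx),
    normSq₃_eq]
  rfl

/-- The integrability conditions for the cubic form: the trace-free part `U` has commutators of
curvature type, and `∇U` is determined. -/
theorem commutator_and_covDeriv_U (h : IsAbundantPair Ω F Θ) (hx : x ∈ Ω) :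
    (∃ Q : Fin n → Fin n → ℝ, ∀ i j k l,
      ip (localMetric F Θ x) (localTraceFree F Θ x k i) (localTraceFree F Θ x l j)
        - ip (localMetric F Θ x) (localTraceFree F Θ x k j) (localTraceFree F Θ x l i) =
        -kulkarniNomizu Q (localMetric F Θ x) i j k l) ∧
    ∀ i j k l, covDeriv₃ (localMetric F Θ) (localTraceFree F Θ) x i j k l =
      structureDeriv (localMetric F Θ x) (localTraceFree F Θ x) (localTrace F Θ x) i j k l := by
  have hg := h.isMetricOn
  have hs := hg.symm x hx
  have hd := hg.det x hx
  have h₁₂ := h.localTraceFree_symm₁₂ hx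
  have h₂₃ := h.localTraceFree_symm₂₃ hx
  have htr := h.tr₂_localTraceFree hx
  obtain ⟨b, hb, hC, hG⟩ := h.codazzi_and_gauss hx
  have hU := h.covDeriv_U x hx
  have hR := h.riemannLower_eq hx
  have hu := h.covDeriv_u_eq hx
  have hPs := h.schouten_symm hx
  have hCU (i j k l : Fin n) := hg.covDeriv₃_withTrace hx h.contDiffOn_localTraceFree
    h.contDiffOn_localTrace i j k l
  have hCe : (fun y => withTrace (localMetric F Θ y) (localTraceFree F Θ y) (localTrace F Θ y)) =
      localCubic F Θ := funext fun y => (IsConormalPair.localCubic_eq y).symm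
  rw [hCe] at hCU
  rw [IsConormalPair.localCubic_eq x] at hG
  have hs₁₂ := hg.covDeriv₃_symm₁₂ hx (T := localTraceFree F Θ)
    (fun y hy => h.localTraceFree_symm₁₂ hy)
  have hs₂₃ := hg.covDeriv₃_symm₂₃ hx (T := localTraceFree F Θ)
    (fun y hy => h.localTraceFree_symm₂₃ hy)
  have hstr := hg.tr₂_covDeriv₃ hx h.contDiffOn_localTraceFree fun y hy k => by
    rw [← h.tr₂_localTraceFree hy k]
    congr 1
    funext i j
    rw [h.localTraceFree_symm₂₃ hy, h.localTraceFree_symm₁₂ hy]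
  have hn := h.three_le
  generalize covDeriv₃ (localMetric F Θ) (localTraceFree F Θ) x = N at *
  generalize covDeriv₁ (localMetric F Θ) (localTrace F Θ) x = v at *
  generalize schouten (localMetric F Θ) x = P at *
  generalize localTraceFree F Θ x = U at *
  generalize localTrace F Θ x = u at *
  generalize localMetric F Θ = γ at *
  generalize γ x = g at *
  -- `Q` collects everything in the Gauss equation that appears as a product with `G`: the curvature
  -- `P ∧ G`, the term with `b`, and the contribution of the trace part of the cubic.
  set Q : Fin n → Fin n → ℝ := fun a c => P a c + b a c / 2
    + (contr g U u a c + u a * u c + normSq₁ g u / 2 * g a c) with hQ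
  have hW (i j k l : Fin n) : ip g (U k i) (U l j) - ip g (U k j) (U l i) =
      -kulkarniNomizu Q g i j k l := by
    have e₁ := withTrace_commutator hs hd h₁₂ h₂₃ u i j k l
    have e₂ := hG i j k l
    rw [hR] at e₂
    simp only [kulkarniNomizu, hQ] at *
    linarith
  refine ⟨⟨Q, hW⟩, ?_⟩
  have hgr := gram_eq_of_commutator hs hd h₁₂ h₂₃ htr hW
  have hn₂ : (n : ℝ) - 2 ≠ 0 := by
    have : (3 : ℝ) ≤ n := by exact_mod_cast hn
    linarith
  have hvs (i j : Fin n) : v i j = v j i := by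
    rw [hu, hu, hPs, hs i j, gram_symm hs]
    ring
  -- Codazzi for `C`, minus the derivatives of its trace part, gives the skew part of `∇U` in terms
  -- of `b / 2 + ∇u`. When `b` is taken from the definition of `Q`, the terms `P` and `u ⊗ u` cancel
  -- against those of `∇u`; `Q` and `∇u` each contribute `𝒰 / (n - 2)`, and `r` gathers the
  -- multiples of `G`.
  refine eq_structureDeriv hn hs hd h₁₂ h₂₃ htr u (q := fun i j => b i j / 2 + v i j)
    (r := -tr₂ g Q / (n - 2) - normSq₁ g u
      + ((n : ℝ) - 6) / (2 * ((n : ℝ) + 2) * ((n : ℝ) - 1)) * tr₂ g (gram g U) / (n - 2))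
    (fun i j => ?_) hs₁₂ hs₂₃ hstr (fun i j k l => ?_) hU
  · have e₁ : Q i j = (gram g U i j - tr₂ g Q * g i j) / (n - 2) := by
      rw [hgr]
      field_simp
      ring
    have e₂ : b i j / 2 = Q i j - P i j
        - (contr g U u i j + u i * u j + normSq₁ g u / 2 * g i j) := by
      simp only [hQ]
      ring
    rw [e₂, e₁, hu]
    ring
  · have e₁ := hC i j k l
    rw [hCU, hCU, hvs l i, hvs l j, hvs l k, hvs k i, hvs k j] at e₁
    linarith

end IsAbundantPair

/-! ### Product rules for `(0,2)`-tensors. -/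

namespace IsMetricOn

variable {Ω : Set (EuclideanSpace ℝ (Fin n))}
  {g : EuclideanSpace ℝ (Fin n) → Matrix (Fin n) (Fin n) ℝ} {x : EuclideanSpace ℝ (Fin n)}
  {A B : EuclideanSpace ℝ (Fin n) → Fin n → Fin n → ℝ}

theorem covDeriv₂_add (hg : IsMetricOn Ω g) (hx : x ∈ Ω)
    (hA : ∀ i j, ContDiffOn ℝ ∞ (fun y => A y i j) Ω)
    (hB : ∀ i j, ContDiffOn ℝ ∞ (fun y => B y i j) Ω) (i j k : Fin n) :
    covDeriv₂ g (fun y a b => A y a b + B y a b) x i j k =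
      covDeriv₂ g A x i j k + covDeriv₂ g B x i j k := by
  have e₁ (γ : Fin n → ℝ) : ip (g x) γ (fun a => A x a j + B x a j) =
      ip (g x) γ (fun a => A x a j) + ip (g x) γ (fun a => B x a j) := ip_add_right _ _ _
  have e₂ (γ : Fin n → ℝ) : ip (g x) γ (fun a => A x i a + B x i a) =
      ip (g x) γ (A x i) + ip (g x) γ (B x i) := ip_add_right _ _ _
  rw [covDeriv₂, e₁, e₂, pd_add (differentiableAt_of_contDiffOn hg.isOpen (hA i j) hx)
    (differentiableAt_of_contDiffOn hg.isOpen (hB i j) hx), covDeriv₂, covDeriv₂]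
  ring

theorem covDeriv₂_const_mul (hg : IsMetricOn Ω g) (hx : x ∈ Ω)
    (hA : ∀ i j, ContDiffOn ℝ ∞ (fun y => A y i j) Ω) (c : ℝ) (i j k : Fin n) :
    covDeriv₂ g (fun y a b => c * A y a b) x i j k = c * covDeriv₂ g A x i j k := by
  have e₁ (γ : Fin n → ℝ) : ip (g x) γ (fun a => c * A x a j) =
      c * ip (g x) γ (fun a => A x a j) := ip_smul_right _ _ _
  have e₂ (γ : Fin n → ℝ) : ip (g x) γ (fun a => c * A x i a) =
      c * ip (g x) γ (A x i) := ip_smul_right _ _ _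
  rw [covDeriv₂, e₁, e₂, pd_const_mul (differentiableAt_of_contDiffOn hg.isOpen (hA i j) hx),
    covDeriv₂]
  ring

theorem covDeriv₂_mul (hg : IsMetricOn Ω g) (hx : x ∈ Ω)
    {α β : EuclideanSpace ℝ (Fin n) → Fin n → ℝ} (hα : ∀ i, ContDiffOn ℝ ∞ (fun y => α y i) Ω)
    (hβ : ∀ i, ContDiffOn ℝ ∞ (fun y => β y i) Ω) (i j k : Fin n) :
    covDeriv₂ g (fun y a b => α y a * β y b) x i j k =
      covDeriv₁ g α x k i * β x j + α x i * covDeriv₁ g β x k j := by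
  have e₁ (γ : Fin n → ℝ) : ip (g x) γ (fun a => α x a * β x j) =
      ip (g x) γ (α x) * β x j := by
    simp only [mul_comm _ (β x j)]
    exact ip_smul_right _ _ _
  have e₂ (γ : Fin n → ℝ) : ip (g x) γ (fun a => α x i * β x a) =
      α x i * ip (g x) γ (β x) := ip_smul_right _ _ _
  rw [covDeriv₂, e₁, e₂, pd_mul (differentiableAt_of_contDiffOn hg.isOpen (hα i) hx)
    (differentiableAt_of_contDiffOn hg.isOpen (hβ j) hx), hg.covDeriv₁_eq hx, hg.covDeriv₁_eq hx]
  ring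

theorem covDeriv₂_mul_metric (hg : IsMetricOn Ω g) (hx : x ∈ Ω)
    {f : EuclideanSpace ℝ (Fin n) → ℝ} (hf : ContDiffOn ℝ ∞ f Ω) (i j k : Fin n) :
    covDeriv₂ g (fun y a b => f y * g y a b) x i j k = pd k f x * g x i j := by
  have e₁ (γ : Fin n → ℝ) : ip (g x) γ (fun a => f x * g x a j) = f x * γ j := by
    rw [← ip_metric_right (hg.symm x hx) (hg.det x hx) j γ]
    simp only [hg.symm x hx _ j]
    exact ip_smul_right _ _ _
  have e₂ (γ : Fin n → ℝ) : ip (g x) γ (fun a => f x * g x i a) = f x * γ i := by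
    rw [← ip_metric_right (hg.symm x hx) (hg.det x hx) i γ]
    exact ip_smul_right _ _ _
  rw [covDeriv₂, e₁, e₂, pd_mul (differentiableAt_of_contDiffOn hg.isOpen hf hx)
    (differentiableAt_of_contDiffOn hg.isOpen (hg.smooth i j) hx), hg.pd_metric hx]
  ring

theorem covDeriv₂_gram (hg : IsMetricOn Ω g) (hx : x ∈ Ω)
    {U : EuclideanSpace ℝ (Fin n) → Fin n → Fin n → Fin n → ℝ}
    (hU : ∀ i j k, ContDiffOn ℝ ∞ (fun y => U y i j k) Ω) (i j k : Fin n) :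
    covDeriv₂ g (fun y => gram (g y) (U y)) x i j k =
      ip₂ (g x) (fun a b => covDeriv₃ g U x i a b k) (U x j)
        + ip₂ (g x) (fun a b => covDeriv₃ g U x j a b k) (U x i) := by
  have hs := hg.symm x hx
  have e (γ : Fin n → ℝ) (V : Fin n → Fin n → ℝ) : ip (g x) γ (fun c => ip₂ (g x) (U x c) V) =
      ip₂ (g x) (fun a b => ip (g x) γ fun c => U x c a b) V :=
    (ip₂_ip_left γ (fun a b c => U x c a b) V).symm
  have e' (γ : Fin n → ℝ) : ip (g x) γ (gram (g x) (U x) i) =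
      ip₂ (g x) (fun a b => ip (g x) γ fun c => U x c a b) (U x i) := by
    rw [← e]
    congr 1
    funext c
    exact gram_symm hs i c
  have e₃ (i : Fin n) (V : Fin n → Fin n → ℝ) :
      ip₂ (g x) (fun a b => covDeriv₃ g U x i a b k) V =
      ip₂ (g x) (fun a b => covDeriv₂ g (fun y => U y i) x a b k) V
        - ip₂ (g x) (fun a b => ip (g x) (chr g x k i) fun c => U x c a b) V := by
    rw [← ip₂_sub_left]
    congr 1
    funext a b
    simp only [Pi.sub_apply]
    rw [hg.covDeriv₃_eq hx, covDeriv₂]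
    ring
  have h' : (fun y => gram (g y) (U y) i j) = fun y => ip₂ (g y) (U y i) (U y j) := rfl
  rw [covDeriv₂, h', hg.pd_ip₂ hx (hU i) (hU j), e', e₃, e₃]
  simp only [gram]
  rw [e, ip₂_comm hs (U x i)]
  ring

end IsMetricOn

/-! ### Vanishing of the Cotton tensor. -/

namespace IsAbundantPair

variable {Ω : Set (EuclideanSpace ℝ (Fin n))}
  {F : EuclideanSpace ℝ (Fin n) → EuclideanSpace ℝ (Fin (n + 1))}
  {Θ : EuclideanSpace ℝ (Fin n) → EuclideanSpace ℝ (Fin (n + 1)) →L[ℝ] ℝ}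
  {x : EuclideanSpace ℝ (Fin n)}

theorem covDeriv_u_symm (h : IsAbundantPair Ω F Θ) (hx : x ∈ Ω) (i j : Fin n) :
    covDeriv₁ (localMetric F Θ) (localTrace F Θ) x i j =
      covDeriv₁ (localMetric F Θ) (localTrace F Θ) x j i := by
  rw [h.covDeriv_u_eq hx, h.covDeriv_u_eq hx, h.schouten_symm hx, h.isMetricOn.symm x hx i j,
    gram_symm (h.isMetricOn.symm x hx)]
  ring

/-- The Cotton tensor of the affine metric vanishes. -/
theorem covDeriv_schouten_symm (h : IsAbundantPair Ω F Θ) (hx : x ∈ Ω) (i j k : Fin n) :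
    covDeriv₂ (localMetric F Θ) (schouten (localMetric F Θ)) x i j k =
      covDeriv₂ (localMetric F Θ) (schouten (localMetric F Θ)) x i k j := by
  have hg := h.isMetricOn
  have hs := hg.symm x hx
  have hd := hg.det x hx
  have hus := h.contDiffOn_localTrace
  have hUs := h.contDiffOn_localTraceFree
  obtain ⟨⟨Q, hW⟩, hN⟩ := h.commutator_and_covDeriv_U hx
  have hu := h.covDeriv_u_eq hx
  have hv := h.covDeriv_u_symm hx
  set c : ℝ := ((n : ℝ) - 6) / (2 * ((n : ℝ) + 2) * ((n : ℝ) - 1)) with hc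
  set v : EuclideanSpace ℝ (Fin n) → Fin n → Fin n → ℝ :=
    covDeriv₁ (localMetric F Θ) (localTrace F Θ) with hvdef
  set T : EuclideanSpace ℝ (Fin n) → ℝ := fun y =>
    tr₂ (localMetric F Θ y) (gram (localMetric F Θ y) (localTraceFree F Θ y)) with hT
  have hgs (i j : Fin n) : ContDiffOn ℝ ∞ (fun y => gram (localMetric F Θ y)
      (localTraceFree F Θ y) i j) Ω := hg.contDiffOn_ip₂ (fun a b => hUs i a b)
          (fun a b => hUs j a b)
  have hTs : ContDiffOn ℝ ∞ T Ω := hg.contDiffOn_tr₂ hgs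
  have hus₂ : ContDiffOn ℝ ∞ (fun y => normSq₁ (localMetric F Θ y) (localTrace F Θ y)) Ω :=
    hg.contDiffOn_ip hus hus
  have hvs (i j : Fin n) : ContDiffOn ℝ ∞ (fun y => v y i j) Ω :=
    (contDiffOn_pd h.isOpen (hus j) i).sub (ContDiffOn.sum fun a _ =>
      (hg.contDiffOn_christoffel a i j).mul (hus a))
  -- The equation for `∇u` solved for the Schouten tensor. Its summands have known derivatives:
  -- `∇∇u` enters only through its skew part, and `∇𝒰` is known from `∇U`.
  have hP : ∀ y ∈ Ω, ∀ i j, schouten (localMetric F Θ) y i j =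
      v y j i + ((-1) * (localTrace F Θ y i * localTrace F Θ y j) +
        ((1 / 2 * normSq₁ (localMetric F Θ y) (localTrace F Θ y) - 1 / ((n : ℝ) - 2) * c * T y)
          * localMetric F Θ y i j +
        (-(1 / ((n : ℝ) - 2))) * gram (localMetric F Θ y) (localTraceFree F Θ y) i j)) := by
    intro y hy i j
    have := h.covDeriv_u_eq hy i j
    rw [hvdef, h.covDeriv_u_symm hy j i, this]
    ring
  have hus₃ : ContDiffOn ℝ ∞ (fun y => 1 / 2 * normSq₁ (localMetric F Θ y) (localTrace F Θ y)
      - 1 / ((n : ℝ) - 2) * c * T y) Ω :=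
    (contDiffOn_const.mul hus₂).sub (contDiffOn_const.mul hTs)
  have huu (i j : Fin n) : ContDiffOn ℝ ∞ (fun y => localTrace F Θ y i * localTrace F Θ y j) Ω :=
    (hus i).mul (hus j)
  have s₁ (i j : Fin n) := (contDiffOn_const (c := (-1 : ℝ))).mul (huu i j)
  have s₂ (i j : Fin n) := hus₃.mul (hg.smooth i j)
  have s₃ (i j : Fin n) := (contDiffOn_const (c := -(1 / ((n : ℝ) - 2)))).mul (hgs i j)
  have hpu (k : Fin n) : pd k (fun y => normSq₁ (localMetric F Θ y) (localTrace F Θ y)) x =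
      2 * ip (localMetric F Θ x) (localTrace F Θ x) (v x k) := by
    have := hg.pd_ip hx hus hus k
    rw [ip_comm hs] at this
    rw [two_mul]
    exact this
  set D : Fin n → Fin n → Fin n → ℝ := fun i j k => covDeriv₂ (localMetric F Θ) (fun y =>
    gram (localMetric F Θ y) (localTraceFree F Θ y)) x i j k with hD
  have hpT (k : Fin n) : pd k T x = tr₂ (localMetric F Θ x) fun a b => D a b k :=
    hg.pd_tr₂ hx hgs k
  have hD' (i j k : Fin n) : D i j k =
      ip₂ (localMetric F Θ x) (fun a b => structureDeriv (localMetric F Θ x)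
        (localTraceFree F Θ x) (localTrace F Θ x) i a b k) (localTraceFree F Θ x j)
      + ip₂ (localMetric F Θ x) (fun a b => structureDeriv (localMetric F Θ x)
        (localTraceFree F Θ x) (localTrace F Θ x) j a b k) (localTraceFree F Θ x i) := by
    simp only [hD, hg.covDeriv₂_gram hx hUs, hN]
  have key := gramDeriv_antisymm h.three_le hs hd (h.localTraceFree_symm₁₂ hx)
    (h.localTraceFree_symm₂₃ hx) (h.tr₂_localTraceFree hx) (localTrace F Θ x) hW hD' hc i j k
  have hric := hg.ip_covDeriv₁_comm hx hus i j k
  have hPe (i j k : Fin n) : covDeriv₂ (localMetric F Θ) (schouten (localMetric F Θ)) x i j k =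
      covDeriv₂ (localMetric F Θ) (fun y a b => v y b a) x i j k
      - (v x k i * localTrace F Θ x j + localTrace F Θ x i * v x k j)
      + (ip (localMetric F Θ x) (localTrace F Θ x) (v x k)
        - 1 / ((n : ℝ) - 2) * c * tr₂ (localMetric F Θ x) fun a b => D a b k)
          * localMetric F Θ x i j
      - 1 / ((n : ℝ) - 2) * D i j k := by
    rw [hg.covDeriv₂_congr hx hP, hg.covDeriv₂_add hx (fun a b => hvs b a)
      (fun a b => (s₁ a b).add ((s₂ a b).add (s₃ a b))),
      hg.covDeriv₂_add hx s₁ (fun a b => (s₂ a b).add (s₃ a b)),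
      hg.covDeriv₂_add hx s₂ s₃, hg.covDeriv₂_const_mul hx huu, hg.covDeriv₂_mul hx hus hus,
      hg.covDeriv₂_mul_metric hx hus₃, hg.covDeriv₂_const_mul hx hgs,
      pd_sub (differentiableAt_of_contDiffOn h.isOpen (contDiffOn_const.mul hus₂) hx)
        (differentiableAt_of_contDiffOn h.isOpen (contDiffOn_const.mul hTs) hx),
      pd_const_mul (differentiableAt_of_contDiffOn h.isOpen hus₂ hx),
      pd_const_mul (differentiableAt_of_contDiffOn h.isOpen hTs hx), hpu, hpT]
    ring
  rw [← sub_eq_zero, hPe, hPe]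
  -- With `Riem = P ∧ G` in the Ricci identity, the terms with `P` cancel against those from the
  -- derivatives of `u ⊗ u` and `|u|²`. The remainder is `gramDeriv_antisymm` divided by `n - 2`.
  have hR : (fun a => riemannLower (localMetric F Θ) x a i k j) =
      (localMetric F Θ x i j) • schouten (localMetric F Θ) x k
      + (schouten (localMetric F Θ) x i j) • localMetric F Θ x k
      - (schouten (localMetric F Θ) x k i) • localMetric F Θ x j
      - (localMetric F Θ x k i) • schouten (localMetric F Θ) x j := by
    funext a
    rw [h.riemannLower_eq hx]
    simp only [kulkarniNomizu, Pi.add_apply, Pi.sub_apply, Pi.smul_apply, smul_eq_mul]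
    rw [hs i j, h.schouten_symm hx i j]
    ring
  have hvk (k : Fin n) : v x k = schouten (localMetric F Θ) x k
      + (localTrace F Θ x k) • localTrace F Θ x
      - (normSq₁ (localMetric F Θ x) (localTrace F Θ x) / 2) • localMetric F Θ x k
      + (1 / ((n : ℝ) - 2)) • gram (localMetric F Θ x) (localTraceFree F Θ x) k
      + (1 / ((n : ℝ) - 2) * c * T x) • localMetric F Θ x k := by
    funext j
    rw [hu]
    simp only [Pi.add_apply, Pi.sub_apply, Pi.smul_apply, smul_eq_mul, hT]
    ring
  have hiv (k : Fin n) : ip (localMetric F Θ x) (localTrace F Θ x) (v x k) =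
      ip (localMetric F Θ x) (localTrace F Θ x) (schouten (localMetric F Θ) x k)
      + localTrace F Θ x k * normSq₁ (localMetric F Θ x) (localTrace F Θ x)
      - normSq₁ (localMetric F Θ x) (localTrace F Θ x) / 2 * localTrace F Θ x k
      + 1 / ((n : ℝ) - 2) * ip (localMetric F Θ x) (localTrace F Θ x)
        (gram (localMetric F Θ x) (localTraceFree F Θ x) k)
      + 1 / ((n : ℝ) - 2) * c * T x * localTrace F Θ x k := by
    rw [hvk]
    simp only [ip_add_right, ip_sub_right, ip_smul_right, ip_metric_right hs hd]
    rfl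
  have hsplit (k : Fin n) := congrFun (hvk k)
  rw [hR] at hric
  simp only [ip_add_left, ip_sub_left, ip_smul_left, ip_metric_left hd] at hric
  rw [ip_comm hs (schouten (localMetric F Θ) x k), ip_comm hs (schouten (localMetric F Θ) x j)]
    at hric
  rw [hiv, hiv]
  have e₁ := hsplit i k
  have e₂ := hsplit i j
  simp only [Pi.add_apply, Pi.sub_apply, Pi.smul_apply, smul_eq_mul] at e₁ e₂
  rw [hv k i, hv j i, hv k j, e₁, e₂, hs i k]
  rw [h.schouten_symm hx k i] at hric
  have hkey := congrArg (fun r => 1 / ((n : ℝ) - 2) * r) key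
  simp only [mul_zero] at hkey
  rw [hs i k] at hkey
  simp only [hT]
  linear_combination hric + hkey

end IsAbundantPair

/-! ### The Frobenius theorem for linear systems, by integration along rays. -/

section Frobenius

open Set

variable {E W : Type*} [NormedAddCommGroup E] [NormedSpace ℝ E] [NormedRing W]
  [NormedAlgebra ℝ W]

/-- Grönwall's inequality with constant `1` gives `ε (eᵗ - 1)`, and `e - 1 < 2`. -/
theorem norm_le_of_norm_deriv_le {w w' : ℝ → W} {ε : ℝ} (hε : 0 ≤ ε)
    (hw : ∀ t ∈ Icc (0 : ℝ) 1, HasDerivWithinAt w (w' t) (Icc 0 1) t) (h₀ : w 0 = 0)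
    (hb : ∀ t ∈ Icc (0 : ℝ) 1, ‖w' t‖ ≤ ‖w t‖ + ε) : ∀ t ∈ Icc (0 : ℝ) 1, ‖w t‖ ≤ 2 * ε := by
  intro t ht
  have h := norm_le_gronwallBound_of_norm_deriv_right_le (f := w) (f' := w') (δ := 0) (K := 1)
    (ε := ε) (fun t ht => (hw t ht).continuousWithinAt)
    (fun t ht => (hw t ⟨ht.1, ht.2.le⟩).mono_of_mem_nhdsWithin (Icc_mem_nhdsGE_of_mem ht))
    (by simp [h₀]) (fun t ht => by simpa using hb t ⟨ht.1, ht.2.le⟩) t ht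
  rw [gronwallBound_of_K_ne_0 one_ne_zero] at h
  have h₁ : Real.exp t ≤ Real.exp 1 := Real.exp_le_exp.2 ht.2
  have h₂ := Real.exp_one_lt_d9
  simp only [zero_mul, div_one, one_mul, sub_zero, zero_add] at h
  nlinarith

theorem exists_linear_solution [CompleteSpace W] {B : ℝ → W}
    (hB : ContinuousOn B (Icc 0 1)) (hb : ∀ t ∈ Icc (0 : ℝ) 1, ‖B t‖ ≤ 1 / 2) (V₀ : W) :
    ∃ γ : ℝ → W, γ 0 = V₀ ∧ ∀ t ∈ Icc (0 : ℝ) 1, HasDerivWithinAt γ (B t * γ t) (Icc 0 1) t := by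
  -- In the ball of radius `‖V₀‖` around `V₀` the norm is at most `2 ‖V₀‖` and the speed at most
  -- `‖V₀‖`, so the solution stays in the ball for unit time.
  have h : IsPicardLindelof (fun t w => B t * w) (tmin := 0) (tmax := 1) ⟨0, by simp⟩ V₀ ‖V₀‖₊ 0
      ‖V₀‖₊ (1 / 2) := by
    refine ⟨fun t ht => ?_, fun w _ => hB.mul continuousOn_const, fun t ht w hw => ?_, ?_⟩
    · refine LipschitzOnWith.of_dist_le_mul fun v _ w _ => ?_
      rw [dist_eq_norm, dist_eq_norm, ← mul_sub]
      refine (norm_mul_le _ _).trans ?_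
      gcongr
      simpa using hb t ht
    · rw [Metric.mem_closedBall, dist_eq_norm] at hw
      have h₁ := norm_mul_le (B t) w
      have h₂ : ‖w‖ ≤ ‖w - V₀‖ + ‖V₀‖ := by simpa using norm_add_le (w - V₀) V₀
      have h₃ := hb t ht
      simp only [coe_nnnorm] at hw ⊢
      nlinarith [norm_nonneg w, norm_nonneg V₀]
    · simp
  exact h.exists_eq_forall_mem_Icc_hasDerivWithinAt₀

theorem norm_linear_solution_le {B : ℝ → W}
    (hb : ∀ t ∈ Icc (0 : ℝ) 1, ‖B t‖ ≤ 1 / 2) {V₀ : W} {γ : ℝ → W} (h₀ : γ 0 = V₀)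
    (hγ : ∀ t ∈ Icc (0 : ℝ) 1, HasDerivWithinAt γ (B t * γ t) (Icc 0 1) t) :
    ∀ t ∈ Icc (0 : ℝ) 1, ‖γ t‖ ≤ 2 * ‖V₀‖ := by
  intro t ht
  have h := norm_le_of_norm_deriv_le (w := fun t => γ t - V₀) (ε := ‖V₀‖ / 2) (by positivity)
    (fun t ht => (hγ t ht).sub_const V₀) (by simp [h₀]) (fun t ht => ?_) t ht
  · have h₂ : ‖γ t‖ ≤ ‖γ t - V₀‖ + ‖V₀‖ := by simpa using norm_add_le (γ t - V₀) V₀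
    linarith
  · have h₁ := norm_mul_le (B t) (γ t)
    have h₂ : ‖γ t‖ ≤ ‖γ t - V₀‖ + ‖V₀‖ := by simpa using norm_add_le (γ t - V₀) V₀
    have h₃ := hb t ht
    nlinarith [norm_nonneg (γ t), norm_nonneg (γ t - V₀)]

/-- The quantitative form of the statement that the radial solutions of an integrable linear
system depend differentiably on the direction. -/
theorem norm_radial_sub_le {A : E → E →L[ℝ] W} {p : E} {r C : ℝ} (hC : 0 ≤ C)
    (hr : r ≤ 1) (hCr : C * r ≤ 1 / 2)
    (hd : ∀ y ∈ Metric.ball p r, HasFDerivAt A (fderiv ℝ A y) y)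
    (hA : ∀ y ∈ Metric.ball p r, ‖A y‖ ≤ C)
    (hA₁ : ∀ y ∈ Metric.ball p r, ∀ z ∈ Metric.ball p r, ‖A y - A z‖ ≤ C * ‖y - z‖)
    (hA₂ : ∀ y ∈ Metric.ball p r, ∀ z ∈ Metric.ball p r,
      ‖fderiv ℝ A y - fderiv ℝ A z‖ ≤ C * ‖y - z‖)
    (hcurv : ∀ y ∈ Metric.ball p r, ∀ h k, ∀ w, fderiv ℝ A y h k * w + A y k * (A y h * w) =
      fderiv ℝ A y k h * w + A y h * (A y k * w))
    {V₀ : W} {x x' : E} (hx : ‖x‖ < r) (hx' : ‖x'‖ < r) {γ γ' : ℝ → W} (h₀ : γ 0 = V₀)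
    (h₀' : γ' 0 = V₀)
    (hγ : ∀ t ∈ Icc (0 : ℝ) 1, HasDerivWithinAt γ (A (p + t • x) x * (γ t)) (Icc 0 1) t)
    (hγ' : ∀ t ∈ Icc (0 : ℝ) 1, HasDerivWithinAt γ' (A (p + t • x') x' * (γ' t)) (Icc 0 1) t) :
    ‖γ' 1 - γ 1 - A (p + x) (x' - x) * γ 1‖ ≤
      16 * (C + C ^ 2) * ‖V₀‖ * ‖x' - x‖ ^ 2 := by
  set m := ‖V₀‖ with hm
  set h := x' - x with hh
  have hm₀ : 0 ≤ m := norm_nonneg _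
  have hmem {z : E} (hz : ‖z‖ < r) {t : ℝ} (ht : t ∈ Icc (0 : ℝ) 1) :
      p + t • z ∈ Metric.ball p r := by
    rw [Metric.mem_ball, dist_eq_norm, add_sub_cancel_left, norm_smul, Real.norm_eq_abs,
      abs_of_nonneg ht.1]
    nlinarith [norm_nonneg z, ht.2]
  have hb {z : E} (hz : ‖z‖ < r) (t : ℝ) (ht : t ∈ Icc (0 : ℝ) 1) :
      ‖A (p + t • z) z‖ ≤ 1 / 2 := by
    have h₁ := (A (p + t • z)).le_opNorm z
    have h₂ := hA _ (hmem hz ht)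
    nlinarith [norm_nonneg z]
  have hγb := norm_linear_solution_le (hb hx) h₀ hγ
  have hγb' := norm_linear_solution_le (hb hx') h₀' hγ'
  have hAd (t : ℝ) (ht : t ∈ Icc (0 : ℝ) 1) : ‖A (p + t • x') - A (p + t • x)‖ ≤ C * ‖h‖ := by
    refine (hA₁ _ (hmem hx' ht) _ (hmem hx ht)).trans ?_
    have : p + t • x' - (p + t • x) = t • h := by rw [hh, smul_sub]; abel
    rw [this, norm_smul, Real.norm_eq_abs, abs_of_nonneg ht.1]
    have := mul_le_mul_of_nonneg_right ht.2 (norm_nonneg h)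
    nlinarith
  have hap {D : E →L[ℝ] W} {z : E} {w : W} {a b c : ℝ} (h₁ : ‖D‖ ≤ a) (h₂ : ‖z‖ ≤ b)
      (h₃ : ‖w‖ ≤ c) : ‖D z * w‖ ≤ a * b * c := by
    have ha : 0 ≤ a := (norm_nonneg _).trans h₁
    have hb : 0 ≤ b := (norm_nonneg _).trans h₂
    calc ‖D z * w‖ ≤ ‖D z‖ * ‖w‖ := norm_mul_le _ _
      _ ≤ (‖D‖ * ‖z‖) * ‖w‖ := by gcongr; exact D.le_opNorm z
      _ ≤ a * b * c := by gcongr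
  -- First-order estimate: neighbouring radial solutions differ by `O(‖h‖)`.
  have hdiff : ∀ t ∈ Icc (0 : ℝ) 1, ‖γ' t - γ t‖ ≤ 2 * (4 * C * m * ‖h‖) := by
    refine norm_le_of_norm_deriv_le (by positivity) (fun t ht => (hγ' t ht).sub (hγ t ht))
      (by rw [h₀, h₀', sub_self]) fun t ht => ?_
    have e : A (p + t • x') x' * (γ' t) - A (p + t • x) x * (γ t) =
        A (p + t • x') x' * (γ' t - γ t) + (A (p + t • x') - A (p + t • x)) x' * (γ t)
          + A (p + t • x) h * (γ t) := by
      simp only [hh, map_sub, sub_apply, sub_mul, mul_sub]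
      abel
    rw [e]
    refine (norm_add₃_le).trans ?_
    have b₁ : ‖A (p + t • x') x' * (γ' t - γ t)‖ ≤ 1 / 2 * ‖γ' t - γ t‖ :=
      (norm_mul_le _ _).trans (by gcongr; exact hb hx' t ht)
    have b₂ := hap (hAd t ht) hx'.le (hγb t ht)
    have b₃ := hap (hA _ (hmem hx ht)) le_rfl (hγb t ht) (z := h)
    have : C * ‖h‖ * r * (2 * m) ≤ C * ‖h‖ * 1 * (2 * m) := by gcongr
    nlinarith [norm_nonneg (γ' t - γ t)]
  have htaylor (t : ℝ) (ht : t ∈ Icc (0 : ℝ) 1) :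
      ‖A (p + t • x') - A (p + t • x) - t • fderiv ℝ A (p + t • x) h‖ ≤ C * ‖h‖ ^ 2 := by
    have hseg : segment ℝ (p + t • x) (p + t • x') ⊆ Metric.ball p r :=
      (convex_ball p r).segment_subset (hmem hx ht) (hmem hx' ht)
    have e : p + t • x' - (p + t • x) = t • h := by rw [hh, smul_sub]; abel
    have hth : ‖t • h‖ ≤ ‖h‖ := by
      rw [norm_smul, Real.norm_eq_abs, abs_of_nonneg ht.1]
      exact mul_le_of_le_one_left (norm_nonneg _) ht.2
    have := (convex_segment (p + t • x) (p + t • x')).norm_image_sub_le_of_norm_hasFDerivWithin_le'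
      (f := A) (f' := fun y => fderiv ℝ A y) (φ := fderiv ℝ A (p + t • x)) (C := C * ‖h‖)
      (fun y hy => (hd y (hseg hy)).hasFDerivWithinAt) (fun y hy => by
        refine (hA₂ y (hseg hy) _ (hmem hx ht)).trans ?_
        gcongr
        have := norm_sub_le_of_mem_segment hy
        rw [e] at this
        exact this.trans hth) (left_mem_segment ℝ _ _) (right_mem_segment ℝ _ _)
    rw [e, map_smul] at this
    calc _ ≤ C * ‖h‖ * ‖t • h‖ := this
      _ ≤ C * ‖h‖ * ‖h‖ := by gcongr
      _ = C * ‖h‖ ^ 2 := by ring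
  have hline (t : ℝ) : HasDerivAt (fun t : ℝ => p + t • x) x t := by
    simpa using ((hasDerivAt_id t).smul_const x).const_add p
  -- If `V` solved the system, the radial solution would vary in the direction `h` by `t A(p + t
  -- x)(h) γ(t)`. The function here is the deviation from that; it is shown to satisfy the radial
  -- equation up to `O(‖h‖²)`, so Grönwall's inequality bounds it.
  have hw : ∀ t ∈ Icc (0 : ℝ) 1, HasDerivWithinAt
      (fun t => γ' t - γ t - t • (A (p + t • x) h * (γ t)))
      (A (p + t • x') x' * (γ' t) - A (p + t • x) x * (γ t) -
          (t • (fderiv ℝ A (p + t • x) x h * (γ t)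
        + A (p + t • x) h * (A (p + t • x) x * (γ t))) + (1 : ℝ) • (A (p + t • x) h * (γ t))))
      (Icc 0 1) t := by
    intro t ht
    have a₁ : HasDerivWithinAt (fun t => A (p + t • x)) (fderiv ℝ A (p + t • x) x) (Icc 0 1) t :=
      ((hd _ (hmem hx ht)).comp_hasDerivAt t (hline t)).hasDerivWithinAt
    have a₂ : HasDerivWithinAt (fun t => A (p + t • x) h) (fderiv ℝ A (p + t • x) x h) (Icc 0 1) t
        := by
      simpa using a₁.clm_apply (hasDerivWithinAt_const t _ h)
    exact ((hγ' t ht).sub (hγ t ht)).sub ((hasDerivWithinAt_id t _).smul (a₂.mul (hγ t ht)))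
  have key := norm_le_of_norm_deriv_le (ε := 8 * (C + C ^ 2) * m * ‖h‖ ^ 2) (by positivity) hw
    (by simp [h₀, h₀']) (fun t ht => ?_) 1 (by simp)
  · simp only [one_smul] at key
    calc _ ≤ _ := key
      _ = _ := by ring
  -- Integrability exchanges the directions `x` and `h`; after this every term is either `A(x)`
  -- applied to the deviation or of second order in `h`.
  · have c := hcurv _ (hmem hx ht) x h (γ t)
    have e : A (p + t • x') x' * (γ' t) - A (p + t • x) x * (γ t) -
        (t • (fderiv ℝ A (p + t • x) x h * (γ t)
        + A (p + t • x) h * (A (p + t • x) x * (γ t))) + (1 : ℝ) • (A (p + t • x) h * (γ t))) =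
        A (p + t • x) x * (γ' t - γ t - t • (A (p + t • x) h * (γ t)))
        + ((A (p + t • x') - A (p + t • x) - t • fderiv ℝ A (p + t • x) h) x * (γ t)
        + ((A (p + t • x') - A (p + t • x)) x * (γ' t - γ t)
        + ((A (p + t • x') - A (p + t • x)) h * (γ' t)
        + A (p + t • x) h * (γ' t - γ t)))) := by
      rw [c]
      have : x' = x + h := by rw [hh]; abel
      simp only [sub_apply, smul_apply, smul_add, one_smul, sub_mul, mul_sub, smul_mul_assoc,
        mul_smul_comm]
      rw [this]
      simp only [map_add, add_mul]
      abel
    rw [e]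
    have hrn := (norm_nonneg x).trans hx.le
    have b₀ : ‖A (p + t • x) x * (γ' t - γ t - t • (A (p + t • x) h * (γ t)))‖ ≤
        1 * ‖γ' t - γ t - t • (A (p + t • x) h * (γ t))‖ :=
      (norm_mul_le _ _).trans (by gcongr; linarith [hb hx t ht])
    have b₁ := hap (htaylor t ht) hx.le (hγb t ht)
    have b₂ := hap (hAd t ht) hx.le (hdiff t ht)
    have b₃ := hap (hAd t ht) (le_refl ‖h‖) (hγb' t ht)
    have b₄ := hap (hA _ (hmem hx ht)) (le_refl ‖h‖) (hdiff t ht)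
    have b₁' : C * ‖h‖ ^ 2 * r * (2 * m) ≤ C * ‖h‖ ^ 2 * 1 * (2 * m) := by gcongr
    have b₂' : C * ‖h‖ * r * (2 * (4 * C * m * ‖h‖)) ≤ 4 * C * m * ‖h‖ ^ 2 := by
      calc C * ‖h‖ * r * (2 * (4 * C * m * ‖h‖)) = (C * r) * (8 * C * m * ‖h‖ ^ 2) := by ring
        _ ≤ 1 / 2 * (8 * C * m * ‖h‖ ^ 2) := by gcongr
        _ = _ := by ring
    have s₁ := norm_add_le (A (p + t • x) x * (γ' t - γ t - t • (A (p + t • x) h * (γ t))))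
      ((A (p + t • x') - A (p + t • x) - t • fderiv ℝ A (p + t • x) h) x * (γ t)
        + ((A (p + t • x') - A (p + t • x)) x * (γ' t - γ t)
        + ((A (p + t • x') - A (p + t • x)) h * (γ' t)
        + A (p + t • x) h * (γ' t - γ t))))
    have s₂ := norm_add_le ((A (p + t • x') - A (p + t • x) - t • fderiv ℝ A (p + t • x) h) x *
        (γ t))
      ((A (p + t • x') - A (p + t • x)) x * (γ' t - γ t)
        + ((A (p + t • x') - A (p + t • x)) h * (γ' t) + A (p + t • x) h * (γ' t - γ t)))
    have s₃ := norm_add_le ((A (p + t • x') - A (p + t • x)) x * (γ' t - γ t))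
        ((A (p + t • x') - A (p + t • x)) h * (γ' t) + A (p + t • x) h * (γ' t - γ t))
    have s₄ := norm_add_le ((A (p + t • x') - A (p + t • x)) h * (γ' t))
      (A (p + t • x) h * (γ' t - γ t))
    nlinarith

/-- **Frobenius theorem** for linear systems: an integrable system `dV = A V` with values in a
Banach algebra is locally solvable. -/
theorem exists_solution_of_integrable [CompleteSpace W] {A : E → E →L[ℝ] W} {Ω : Set E}
    (hΩ : IsOpen Ω) (hA : ContDiffOn ℝ ∞ A Ω)
    (hcurv : ∀ y ∈ Ω, ∀ h k, fderiv ℝ A y h k + A y k * A y h = fderiv ℝ A y k h + A y h * A y k)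
    {p : E} (hp : p ∈ Ω) (V₀ : W) :
    ∃ r > 0, Metric.ball p r ⊆ Ω ∧ ∃ V : E → W, V p = V₀ ∧
      ContDiffOn ℝ ∞ V (Metric.ball p r) ∧ ∀ y ∈ Metric.ball p r,
        HasFDerivAt V (((ContinuousLinearMap.mul ℝ W).flip (V y)).comp (A y)) y := by
  have hA' : ContDiffOn ℝ ∞ (fderiv ℝ A) Ω := hA.fderiv_of_isOpen hΩ (by simp)
  have hmem := hΩ.mem_nhds hp
  obtain ⟨K₁, s₁, hs₁, hL₁⟩ := ((hA.contDiffAt hmem).of_le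
    (by simp : (1 : WithTop ℕ∞) ≤ ∞)).exists_lipschitzOnWith
  obtain ⟨K₂, s₂, hs₂, hL₂⟩ := ((hA'.contDiffAt hmem).of_le
    (by simp : (1 : WithTop ℕ∞) ≤ ∞)).exists_lipschitzOnWith
  have hbd : ∀ᶠ y in nhds p, ‖A y‖ < ‖A p‖ + 1 :=
    ((hA.contDiffAt hmem).continuousAt.norm).eventually_lt continuousAt_const (by simp)
  obtain ⟨r₀, hr₀, hball⟩ := Metric.mem_nhds_iff.1
    (Filter.inter_mem (Filter.inter_mem hs₁ hs₂) (Filter.inter_mem hbd hmem))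
  set C : ℝ := K₁ + K₂ + (‖A p‖ + 1) with hC
  have hC₁ : 1 ≤ C := by
    have := norm_nonneg (A p)
    have := K₁.2
    have := K₂.2
    simp only [NNReal.val_eq_coe] at *
    linarith
  -- On a ball of this radius the radial equations have coefficients of norm at most `1 / 2`; as `1
  -- ≤ C`, also `r ≤ 1`.
  set r := min r₀ (1 / (2 * C)) with hr
  have hrpos : 0 < r := lt_min hr₀ (by positivity)
  have hCr : C * r ≤ 1 / 2 := by
    calc C * r ≤ C * (1 / (2 * C)) := by gcongr; exact min_le_right _ _
      _ = 1 / 2 := by field_simp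
  have hr₁ : r ≤ 1 := by nlinarith
  have hsub : Metric.ball p r ⊆ Metric.ball p r₀ := Metric.ball_subset_ball (min_le_left _ _)
  have hsubΩ : Metric.ball p r ⊆ Ω := fun y hy => (hball (hsub hy)).2.2
  have hAb : ∀ y ∈ Metric.ball p r, ‖A y‖ ≤ C := fun y hy => by
    have h₁ : ‖A y‖ < ‖A p‖ + 1 := (hball (hsub hy)).2.1
    have := K₁.2
    have := K₂.2
    simp only [NNReal.val_eq_coe] at *
    linarith
  have hA₁ : ∀ y ∈ Metric.ball p r, ∀ z ∈ Metric.ball p r, ‖A y - A z‖ ≤ C * ‖y - z‖ := by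
    intro y hy z hz
    rw [← dist_eq_norm, ← dist_eq_norm]
    refine (hL₁.dist_le_mul y (hball (hsub hy)).1.1 z (hball (hsub hz)).1.1).trans ?_
    gcongr
    have := norm_nonneg (A p)
    have := K₂.2
    simp only [NNReal.val_eq_coe] at *
    linarith
  have hA₂ : ∀ y ∈ Metric.ball p r, ∀ z ∈ Metric.ball p r,
      ‖fderiv ℝ A y - fderiv ℝ A z‖ ≤ C * ‖y - z‖ := by
    intro y hy z hz
    rw [← dist_eq_norm y z]
    refine (dist_eq_norm (fderiv ℝ A y) (fderiv ℝ A z)).symm.trans_le ?_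
    refine (hL₂.dist_le_mul y (hball (hsub hy)).1.2 z (hball (hsub hz)).1.2).trans ?_
    gcongr
    have := norm_nonneg (A p)
    have := K₁.2
    simp only [NNReal.val_eq_coe] at *
    linarith
  have hd : ∀ y ∈ Metric.ball p r, HasFDerivAt A (fderiv ℝ A y) y := fun y hy =>
    ((hA.contDiffAt (hΩ.mem_nhds (hsubΩ hy))).differentiableAt (by simp)).hasFDerivAt
  have hseg {z : E} (hz : ‖z‖ < r) {t : ℝ} (ht : t ∈ Icc (0 : ℝ) 1) :
      p + t • z ∈ Metric.ball p r := by
    rw [Metric.mem_ball, dist_eq_norm, add_sub_cancel_left, norm_smul, Real.norm_eq_abs,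
      abs_of_nonneg ht.1]
    nlinarith [norm_nonneg z, ht.2]
  have hex : ∀ x : E, ‖x‖ < r → ∃ γ : ℝ → W, γ 0 = V₀ ∧ ∀ t ∈ Icc (0 : ℝ) 1,
      HasDerivWithinAt γ (A (p + t • x) x * γ t) (Icc 0 1) t := by
    intro x hx
    refine exists_linear_solution (B := fun t => A (p + t • x) x) ?_ (fun t ht => ?_) V₀
    · refine ContinuousOn.clm_apply ?_ continuousOn_const
      exact hA.continuousOn.comp (by fun_prop) fun t ht => hsubΩ (hseg hx ht)
    · refine ((A (p + t • x)).le_opNorm x).trans ?_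
      have := hAb _ (hseg hx ht)
      nlinarith [norm_nonneg x]
  -- `γ x` solves the equation along the ray `t ↦ p + t x`; the solution of the system at `y` is the
  -- value of `γ (y - p)` at time `1`.
  choose! γ hγ₀ hγ using hex
  have hnorm {y : E} (hy : y ∈ Metric.ball p r) : ‖y - p‖ < r := by
    rwa [Metric.mem_ball, dist_eq_norm] at hy
  have hder : ∀ y ∈ Metric.ball p r, HasFDerivAt (fun y => γ (y - p) 1)
      (((ContinuousLinearMap.mul ℝ W).flip (γ (y - p) 1)).comp (A y)) y := by
    intro y hy
    refine HasFDerivAt.of_isLittleO ?_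
    refine Asymptotics.IsBigO.trans_isLittleO (g := fun z => ‖z - y‖ ^ 2) ?_
      (Asymptotics.isLittleO_pow_sub_sub y one_lt_two)
    refine Asymptotics.IsBigO.of_bound (16 * (C + C ^ 2) * ‖V₀‖) ?_
    filter_upwards [Metric.isOpen_ball.mem_nhds hy] with z hz
    have := norm_radial_sub_le (by linarith) hr₁ hCr hd hAb hA₁ hA₂
      (fun y hy h k w => by rw [← mul_assoc, ← mul_assoc, ← add_mul, ← add_mul,
        hcurv y (hsubΩ hy)])
      (hnorm hy) (hnorm hz) (hγ₀ _ (hnorm hy)) (hγ₀ _ (hnorm hz)) (hγ _ (hnorm hy))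
      (hγ _ (hnorm hz))
    rw [add_sub_cancel, sub_sub_sub_cancel_right] at this
    rw [norm_pow, norm_norm]
    exact this
  refine ⟨r, hrpos, hsubΩ, fun y => γ (y - p) 1, ?_, ?_, hder⟩
  · have h₀ : ‖p - p‖ < r := by simpa using hrpos
    have := norm_linear_solution_le (B := fun _ => 0) (V₀ := 0) (γ := fun t => γ (p - p) t - V₀)
      (by simp) (by rw [hγ₀ _ h₀, sub_self]) (fun t ht => by
        simpa using (hγ _ h₀ t ht).sub_const V₀) 1 (by simp)
    simpa [sub_eq_zero] using this
  -- Bootstrapping: the derivative is a product of `A` and `V`, so each order of smoothness of `V`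
  -- gives the next.
  · rw [contDiffOn_infty]
    intro k
    induction k with
    | zero =>
      exact contDiffOn_zero.2 fun y hy => (hder y hy).continuousAt.continuousWithinAt
    | succ k ih =>
      push_cast
      rw [contDiffOn_succ_iff_fderiv_of_isOpen Metric.isOpen_ball]
      refine ⟨fun y hy => (hder y hy).differentiableAt.differentiableWithinAt,
        fun h => absurd h (by simp), ?_⟩
      refine ContDiffOn.congr ?_ fun y hy => (hder y hy).fderiv
      refine ContDiffOn.clm_comp ?_ ((hA.of_le (by exact_mod_cast le_top)).mono hsubΩ)
      exact ((ContinuousLinearMap.mul ℝ W).flip.contDiff).comp_contDiffOn ih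

end Frobenius

/-- **Frobenius theorem** for linear systems in coordinates. -/
theorem exists_solution_of_pdv_integrable {W : Type*} [NormedRing W] [NormedAlgebra ℝ W]
    [CompleteSpace W] {a : Fin n → EuclideanSpace ℝ (Fin n) → W}
    {Ω : Set (EuclideanSpace ℝ (Fin n))} (hΩ : IsOpen Ω) (ha : ∀ i, ContDiffOn ℝ ∞ (a i) Ω)
    (hcurv : ∀ y ∈ Ω, ∀ i j, pdv i (a j) y + a j y * a i y = pdv j (a i) y + a i y * a j y)
    {p : EuclideanSpace ℝ (Fin n)} (hp : p ∈ Ω) (V₀ : W) :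
    ∃ r > 0, Metric.ball p r ⊆ Ω ∧ ∃ V : EuclideanSpace ℝ (Fin n) → W, V p = V₀ ∧
      ContDiffOn ℝ ∞ V (Metric.ball p r) ∧
      ∀ y ∈ Metric.ball p r, ∀ i, pdv i V y = a i y * V y := by
  set A : EuclideanSpace ℝ (Fin n) → EuclideanSpace ℝ (Fin n) →L[ℝ] W :=
    fun y => ∑ i, (EuclideanSpace.proj i : EuclideanSpace ℝ (Fin n) →L[ℝ] ℝ).smulRight (a i y)
    with hAdef
  have hAe (y h : EuclideanSpace ℝ (Fin n)) : A y h = ∑ i, h i • a i y := by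
    simp [hAdef]
  have hA : ContDiffOn ℝ ∞ A Ω := by
    refine ContDiffOn.sum fun i _ => ?_
    exact (ContinuousLinearMap.smulRightL ℝ (EuclideanSpace ℝ (Fin n)) W
      (EuclideanSpace.proj i)).contDiff.comp_contDiffOn (ha i)
  have hsum (h : EuclideanSpace ℝ (Fin n)) : h = ∑ i, h i • EuclideanSpace.single i (1 : ℝ) := by
    ext c
    simp [Pi.single_apply]
  have hAd (y) (hy : y ∈ Ω) (h k : EuclideanSpace ℝ (Fin n)) :
      fderiv ℝ A y h k = ∑ i, ∑ j, (h i * k j) • pdv i (a j) y := by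
    have hd (j) := differentiableAt_of_contDiffOn hΩ (ha j) hy
    have e₁ : fderiv ℝ A y h k = fderiv ℝ (fun y => A y k) y h := by
      rw [fderiv_clm_apply (differentiableAt_of_contDiffOn hΩ hA hy) (differentiableAt_const _)]
      simp
    have e₂ : (fun y => A y k) = fun y => ∑ j, k j • a j y := funext fun y => hAe y k
    rw [e₁, e₂, fderiv_fun_sum fun j _ => (hd j).fun_const_smul (k j), sum_apply]
    rw [Finset.sum_comm]
    refine Finset.sum_congr rfl fun j _ => ?_
    rw [fderiv_fun_const_smul (hd j), smul_apply]
    conv_lhs => rw [hsum h, map_sum]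
    rw [Finset.smul_sum]
    refine Finset.sum_congr rfl fun i _ => ?_
    rw [map_smul, smul_smul, mul_comm]
    rfl
  obtain ⟨r, hr, hrΩ, V, hV₀, hV, hVd⟩ := exists_solution_of_integrable hΩ hA
    (fun y hy h k => by
      have e (h k : EuclideanSpace ℝ (Fin n)) : fderiv ℝ A y h k + A y k * A y h =
          ∑ i, ∑ j, (h i * k j) • (pdv i (a j) y + a j y * a i y) := by
        have : A y k * A y h = ∑ i, ∑ j, (h i * k j) • (a j y * a i y) := by
          rw [hAe, hAe, Finset.sum_mul_sum, Finset.sum_comm]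
          refine Finset.sum_congr rfl fun i _ => Finset.sum_congr rfl fun j _ => ?_
          rw [smul_mul_smul_comm, mul_comm]
        rw [hAd y hy, this]
        simp only [smul_add, Finset.sum_add_distrib]
      rw [e, e, Finset.sum_comm]
      refine Finset.sum_congr rfl fun i _ => Finset.sum_congr rfl fun j _ => ?_
      rw [hcurv y hy, mul_comm]) hp V₀
  refine ⟨r, hr, hrΩ, V, hV₀, hV, fun y hy i => ?_⟩
  rw [pdv, (hVd y hy).fderiv]
  simp [hAe]

/-- **Frobenius theorem** for linear systems in components. -/
theorem exists_solution_of_pd_integrable {ι : Type*} [Fintype ι] [DecidableEq ι]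
    {a : Fin n → EuclideanSpace ℝ (Fin n) → Matrix ι ι ℝ}
    {Ω : Set (EuclideanSpace ℝ (Fin n))} (hΩ : IsOpen Ω)
    (ha : ∀ i α β, ContDiffOn ℝ ∞ (fun y => a i y α β) Ω)
    (hcurv : ∀ y ∈ Ω, ∀ i j α, ∀ w : ι → ℝ,
      pd i (fun z => ∑ β, a j z α β * w β) y + ∑ β, a j y α β * ∑ γ, a i y β γ * w γ =
      pd j (fun z => ∑ β, a i z α β * w β) y + ∑ β, a i y α β * ∑ γ, a j y β γ * w γ)
    {p : EuclideanSpace ℝ (Fin n)} (hp : p ∈ Ω) (w₀ : ι → ℝ) :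
    ∃ r > 0, Metric.ball p r ⊆ Ω ∧ ∃ w : EuclideanSpace ℝ (Fin n) → ι → ℝ, w p = w₀ ∧
      (∀ α, ContDiffOn ℝ ∞ (fun y => w y α) (Metric.ball p r)) ∧
      ∀ y ∈ Metric.ball p r, ∀ i α, pd i (fun y => w y α) y = ∑ β, a i y α β * w y β := by
  set e : ι → ι → (ι → ℝ) →L[ℝ] (ι → ℝ) := fun α β =>
    (ContinuousLinearMap.proj β : (ι → ℝ) →L[ℝ] ℝ).smulRight (Pi.single α (1 : ℝ)) with he
  -- The matrices act as operators, which form a Banach algebra. The system is solved there with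
  -- initial value `1`, and the fundamental solution is applied to `w₀`.
  set b : Fin n → EuclideanSpace ℝ (Fin n) → (ι → ℝ) →L[ℝ] (ι → ℝ) :=
    fun i y => ∑ α, ∑ β, a i y α β • e α β with hbdef
  have hbe (i y) (w : ι → ℝ) (α) : b i y w α = ∑ β, a i y α β * w β := by
    simp [hbdef, he, Finset.sum_apply, Pi.single_apply]
  have hb (i) : ContDiffOn ℝ ∞ (b i) Ω :=
    ContDiffOn.sum fun α _ => ContDiffOn.sum fun β _ => (ha i α β).smul contDiffOn_const
  have hev (F : EuclideanSpace ℝ (Fin n) → (ι → ℝ) →L[ℝ] (ι → ℝ)) (y)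
      (hF : DifferentiableAt ℝ F y) (i) (w : ι → ℝ) (α) :
      pdv i F y w α = pd i (fun y => F y w α) y := by
    have h₁ : HasFDerivAt (fun y => F y w α) ((ContinuousLinearMap.proj α :
        (ι → ℝ) →L[ℝ] ℝ).comp ((ContinuousLinearMap.apply ℝ (ι → ℝ) w).comp
          (fderiv ℝ F y))) y :=
      (ContinuousLinearMap.proj α : (ι → ℝ) →L[ℝ] ℝ).hasFDerivAt.comp y
        ((ContinuousLinearMap.apply ℝ (ι → ℝ) w).hasFDerivAt.comp y hF.hasFDerivAt)
    rw [pd, h₁.fderiv]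
    rfl
  obtain ⟨r, hr, hrΩ, V, hV₀, hV, hVd⟩ := exists_solution_of_pdv_integrable hΩ hb
    (fun y hy i j => by
      ext w α
      have h₁ (i j : Fin n) : (pdv i (b j) y + b j y * b i y) w α =
          pd i (fun z => ∑ β, a j z α β * w β) y + ∑ β, a j y α β * ∑ γ, a i y β γ * w γ := by
        have : (pdv i (b j) y + b j y * b i y) w α = pdv i (b j) y w α + b j y (b i y w) α := rfl
        rw [this, hev _ _ (differentiableAt_of_contDiffOn hΩ (hb j) hy)]
        simp only [hbe]
      rw [h₁, h₁, hcurv y hy]) hp 1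
  refine ⟨r, hr, hrΩ, fun y => V y w₀, by simp [hV₀], fun α => ?_, fun y hy i α => ?_⟩
  · exact contDiffOn_pi.1 (hV.clm_apply contDiffOn_const) α
  · rw [← hev _ _ (differentiableAt_of_contDiffOn Metric.isOpen_ball hV hy), hVd y hy]
    exact hbe i y (V y w₀) α

/-! ### Curvature under a conformal change. -/

namespace IsMetricOn

variable {Ω : Set (EuclideanSpace ℝ (Fin n))}
  {g : EuclideanSpace ℝ (Fin n) → Matrix (Fin n) (Fin n) ℝ} {x : EuclideanSpace ℝ (Fin n)}
  {φ : EuclideanSpace ℝ (Fin n) → ℝ}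

theorem pd_exp (hg : IsMetricOn Ω g) (hx : x ∈ Ω) (hφ : ContDiffOn ℝ ∞ φ Ω) (k : Fin n) :
    pd k (fun y => Real.exp (2 * φ y)) x = 2 * pd k φ x * Real.exp (2 * φ x) := by
  have hd := (differentiableAt_of_contDiffOn hg.isOpen hφ hx).hasFDerivAt
  rw [pd, ((hd.const_mul 2).exp).fderiv]
  simp only [smul_apply, smul_eq_mul, pd]
  ring

theorem conformal (hg : IsMetricOn Ω g) (hφ : ContDiffOn ℝ ∞ φ Ω) :
    IsMetricOn Ω fun y => Real.exp (2 * φ y) • g y where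
  isOpen := hg.isOpen
  smooth i j := (contDiffOn_const.mul hφ).exp.mul (hg.smooth i j)
  symm x hx i j := by simp only [Matrix.smul_apply, hg.symm x hx i j]
  det x hx := by
    rw [Matrix.det_smul]
    exact (IsUnit.pow _ (Real.exp_pos _).ne'.isUnit).mul (hg.det x hx)

/-- The Christoffel symbols of the first kind of `e^{2φ} g`, divided by `e^{2φ}`. -/
def confChr (g : EuclideanSpace ℝ (Fin n) → Matrix (Fin n) (Fin n) ℝ)
    (φ : EuclideanSpace ℝ (Fin n) → ℝ) (x : EuclideanSpace ℝ (Fin n)) (i j k : Fin n) : ℝ :=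
  chr g x i j k + (pd i φ x * g x j k + pd j φ x * g x i k - pd k φ x * g x i j)

theorem chr_conformal (hg : IsMetricOn Ω g) (hx : x ∈ Ω) (hφ : ContDiffOn ℝ ∞ φ Ω)
    (i j k : Fin n) : chr (fun y => Real.exp (2 * φ y) • g y) x i j k =
      Real.exp (2 * φ x) * confChr g φ x i j k := by
  have hde := differentiableAt_of_contDiffOn hg.isOpen ((contDiffOn_const.mul hφ).exp) hx (F :=
    fun y => Real.exp (2 * φ y))
  have hd (i j) := differentiableAt_of_contDiffOn hg.isOpen (hg.smooth i j) hx
  simp only [chr, Matrix.smul_apply, smul_eq_mul, pd_mul hde (hd _ _), hg.pd_exp hx hφ, confChr]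
  ring

theorem ip_conformal (c : ℝ) (hc : c ≠ 0) (h : Matrix (Fin n) (Fin n) ℝ) (hd : IsUnit h.det)
    (α β : Fin n → ℝ) : ip (c • h) α β = c⁻¹ * ip h α β := by
  have : (c • h)⁻¹ = c⁻¹ • h⁻¹ := by
    refine Matrix.inv_eq_left_inv ?_
    rw [Matrix.smul_mul, Matrix.mul_smul, smul_smul, inv_mul_cancel₀ hc, one_smul,
      Matrix.nonsing_inv_mul _ hd]
  simp only [ip, tr₂, this, Matrix.smul_apply, smul_eq_mul, mul_assoc, Finset.mul_sum]

/-- The `(0,4)` curvature tensor of `e^{2φ} g`. -/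
theorem riemannLower_conformal (hg : IsMetricOn Ω g) (hx : x ∈ Ω) (hφ : ContDiffOn ℝ ∞ φ Ω)
    (k l i j : Fin n) :
    riemannLower (fun y => Real.exp (2 * φ y) • g y) x k l i j =
      Real.exp (2 * φ x) * (riemannLower g x k l i j - kulkarniNomizu (fun a b =>
        covDeriv₁ g (fun y a => pd a φ y) x a b - pd a φ x * pd b φ x
          + normSq₁ (g x) (fun a => pd a φ x) / 2 * g x a b) (g x) i j k l) := by
  have hs := hg.symm x hx
  have hd := hg.det x hx
  have hde := differentiableAt_of_contDiffOn hg.isOpen ((contDiffOn_const.mul hφ).exp) hx (F :=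
    fun y => Real.exp (2 * φ y))
  have hdp (i) := differentiableAt_of_contDiffOn hg.isOpen (contDiffOn_pd hg.isOpen hφ i) hx
  have hdg (i j) := differentiableAt_of_contDiffOn hg.isOpen (hg.smooth i j) hx
  have hdc (i j k) := differentiableAt_of_contDiffOn hg.isOpen (hg.contDiffOn_chr i j k) hx
  have hm (a i j : Fin n) := (hdp a).fun_mul (hdg i j)
  have hdcc (i j k : Fin n) : DifferentiableAt ℝ (fun y => confChr g φ y i j k) x :=
    (hdc i j k).fun_add (((hm _ _ _).fun_add (hm _ _ _)).fun_sub (hm _ _ _))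
  have e₁ (i j k l : Fin n) : pd l (fun y => chr (fun y => Real.exp (2 * φ y) • g y) y i j k) x =
      Real.exp (2 * φ x) * (2 * pd l φ x * confChr g φ x i j k + (pd l (fun y => chr g y i j k) x
        + (pd l (pd i φ) x * g x j k + pd i φ x * (chr g x l j k + chr g x l k j)
        + (pd l (pd j φ) x * g x i k + pd j φ x * (chr g x l i k + chr g x l k i))
        - (pd l (pd k φ) x * g x i j + pd k φ x * (chr g x l i j + chr g x l j i))))) := by
    rw [pd_congr hg.isOpen (fun y hy => hg.chr_conformal hy hφ i j k) hx, pd_mul hde (hdcc i j k),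
      hg.pd_exp hx hφ]
    simp only [confChr]
    rw [pd_add (hdc _ _ _) (((hm _ _ _).fun_add (hm _ _ _)).fun_sub (hm _ _ _)),
      pd_sub ((hm _ _ _).fun_add (hm _ _ _)) (hm _ _ _), pd_add (hm _ _ _) (hm _ _ _),
      pd_mul (hdp _) (hdg _ _), pd_mul (hdp _) (hdg _ _), pd_mul (hdp _) (hdg _ _),
      hg.pd_metric hx, hg.pd_metric hx, hg.pd_metric hx]
    ring
  have e₂ (i j : Fin n) : chr (fun y => Real.exp (2 * φ y) • g y) x i j =
      (Real.exp (2 * φ x)) • (chr g x i j + (pd i φ x) • g x j + (pd j φ x) • g x i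
        - (g x i j) • fun k => pd k φ x) := by
    funext k
    rw [hg.chr_conformal hx hφ, confChr]
    simp only [Pi.add_apply, Pi.sub_apply, Pi.smul_apply, smul_eq_mul]
    ring
  have hE := (Real.exp_pos (2 * φ x)).ne'
  have e₃ (α β : Fin n → ℝ) : ip (Real.exp (2 * φ x) • g x) ((Real.exp (2 * φ x)) • α)
      ((Real.exp (2 * φ x)) • β) = Real.exp (2 * φ x) * ip (g x) α β := by
    rw [ip_conformal _ hE _ hd, ip_smul_left, ip_smul_right]
    field_simp
  have e₄ (α : Fin n → ℝ) : ip (g x) (fun k => pd k φ x) α = ip (g x) α fun k => pd k φ x :=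
    ip_comm hs _ _
  have e₅ : normSq₁ (g x) (fun k => pd k φ x) = ip (g x) (fun k => pd k φ x) fun k => pd k φ x :=
      rfl
  have e₆ (i j : Fin n) : covDeriv₁ g (fun y a => pd a φ y) x i j =
      pd i (pd j φ) x - ip (g x) (chr g x i j) fun k => pd k φ x := hg.covDeriv₁_eq hx _ i j
  rw [riemannLower, e₁, e₁, e₂, e₂, e₂, e₂, e₃, e₃, riemannLower]
  simp only [ip_add_left, ip_sub_left, ip_smul_left, ip_add_right, ip_sub_right, ip_smul_right,
    ip_metric_left hd, ip_metric_right hs hd, kulkarniNomizu, e₅, e₆, confChr, Pi.add_apply,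
    Pi.sub_apply, Pi.smul_apply, smul_eq_mul]
  rw [e₄ (chr g x j l), e₄ (chr g x i l), pd_comm hg.isOpen hφ hx j i]
  simp only [hg.chr_symm hx j i, hs j i, hs k i, hs k j, hs l k]
  ring

end IsMetricOn

theorem ip_neg_right (h : Matrix (Fin n) (Fin n) ℝ) (α β : Fin n → ℝ) :
    ip h α (fun c => -β c) = -ip h α β := by
  have := ip_smul_right (g := h) (-1) α β
  simp only [neg_smul, one_smul, neg_mul, one_mul] at this
  exact this

/-! ### Vanishing Weyl and Cotton tensors imply local conformal flatness. -/

namespace IsMetricOn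

variable {Ω : Set (EuclideanSpace ℝ (Fin n))}
  {g : EuclideanSpace ℝ (Fin n) → Matrix (Fin n) (Fin n) ℝ} {x : EuclideanSpace ℝ (Fin n)}

theorem mono (hg : IsMetricOn Ω g) {Ω' : Set (EuclideanSpace ℝ (Fin n))} (ho : IsOpen Ω')
    (h : Ω' ⊆ Ω) : IsMetricOn Ω' g where
  isOpen := ho
  smooth i j := (hg.smooth i j).mono h
  symm x hx := hg.symm x (h hx)
  det x hx := hg.det x (h hx)

theorem contDiffOn_schouten (hg : IsMetricOn Ω g) (i j : Fin n) :
    ContDiffOn ℝ ∞ (fun y => schouten g y i j) Ω := by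
  have hr (i j : Fin n) : ContDiffOn ℝ ∞ (fun y => ricci g y i j) Ω := by
    refine ContDiffOn.sum fun a _ => ?_
    have h (k i j : Fin n) := hg.contDiffOn_christoffel k i j
    refine ((contDiffOn_pd hg.isOpen (h _ _ _) _).sub (contDiffOn_pd hg.isOpen (h _ _ _) _)).add
      (ContDiffOn.sum fun m _ => ((h _ _ _).mul (h _ _ _)).sub ((h _ _ _).mul (h _ _ _)))
  exact contDiffOn_const.mul
    ((hr i j).sub (((hg.contDiffOn_tr₂ hr).div_const _).mul (hg.smooth i j)))

/-- The coefficient matrices of the linear system `dσ = μ`, `∇μ = -σ P + ρ g`,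
`dρ = -P(μ, ·)`. -/
def flatSystem (g : EuclideanSpace ℝ (Fin n) → Matrix (Fin n) (Fin n) ℝ) (i : Fin n)
    (x : EuclideanSpace ℝ (Fin n)) : Matrix (Fin n ⊕ Bool) (Fin n ⊕ Bool) ℝ :=
  -- `inl` carries the components of `μ`, `inr false` is `σ` and `inr true` is `ρ`.
  Matrix.of fun α β => match α, β with
    | .inl j, .inl c => christoffel g c i j x
    | .inl j, .inr false => -schouten g x i j
    | .inl j, .inr true => g x i j
    | .inr false, .inl c => if c = i then 1 else 0
    | .inr true, .inl c => -∑ b, (g x)⁻¹ c b * schouten g x i b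
    | .inr _, .inr _ => 0

theorem sum_flatSystem_inl (hg : IsMetricOn Ω g) (hx : x ∈ Ω) (i j : Fin n)
    (w : Fin n ⊕ Bool → ℝ) : ∑ β, flatSystem g i x (.inl j) β * w β =
      ip (g x) (chr g x i j) (fun c => w (.inl c)) - w (.inr false) * schouten g x i j
        + w (.inr true) * g x i j := by
  rw [Fintype.sum_sum_type, Fintype.sum_bool, ← hg.sum_christoffel_mul hx]
  simp only [flatSystem, Matrix.of_apply]
  ring

theorem sum_flatSystem_false (i : Fin n) (w : Fin n ⊕ Bool → ℝ) :
    ∑ β, flatSystem g i x (.inr false) β * w β = w (.inl i) := by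
  rw [Fintype.sum_sum_type, Fintype.sum_bool]
  simp [flatSystem]

theorem sum_flatSystem_true (hg : IsMetricOn Ω g) (hx : x ∈ Ω) (i : Fin n)
    (w : Fin n ⊕ Bool → ℝ) : ∑ β, flatSystem g i x (.inr true) β * w β =
      -ip (g x) (schouten g x i) (fun c => w (.inl c)) := by
  rw [Fintype.sum_sum_type, Fintype.sum_bool, ← sum_raise_mul (hg.symm x hx)]
  simp [flatSystem]

theorem contDiffOn_flatSystem (hg : IsMetricOn Ω g) (i : Fin n) (α β : Fin n ⊕ Bool) :
    ContDiffOn ℝ ∞ (fun y => flatSystem g i y α β) Ω := by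
  rcases α with j | _ | _ <;> rcases β with c | _ | _ <;> simp only [flatSystem, Matrix.of_apply]
  · exact hg.contDiffOn_christoffel c i j
  · exact (hg.contDiffOn_schouten i j).neg
  · exact hg.smooth i j
  · exact contDiffOn_const
  · exact contDiffOn_const
  · exact contDiffOn_const
  · exact (ContDiffOn.sum fun b _ => (contDiffOn_inv hg.smooth hg.det c b).mul
      (hg.contDiffOn_schouten i b)).neg
  · exact contDiffOn_const
  · exact contDiffOn_const

/-- The `μ`-component is the Ricci identity with `Riem = P ∧ g`, where the coefficient of `σ` is the
Cotton tensor. The `σ`-component uses only that `P`, `g` and `Γ` are symmetric, and the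
`ρ`-component again that the Cotton tensor vanishes. -/
theorem flatSystem_integrable (hg : IsMetricOn Ω g)
    (hP : ∀ x ∈ Ω, ∀ i j, schouten g x i j = schouten g x j i)
    (hR : ∀ x ∈ Ω, ∀ i j k l, riemannLower g x k l i j = kulkarniNomizu (schouten g x) (g x) i j k
        l)
    (hC : ∀ x ∈ Ω, ∀ i j k, covDeriv₂ g (schouten g) x i j k = covDeriv₂ g (schouten g) x i k j)
    (hx : x ∈ Ω) (i j : Fin n) (α : Fin n ⊕ Bool) (w : Fin n ⊕ Bool → ℝ) :
    pd i (fun z => ∑ β, flatSystem g j z α β * w β) x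
        + ∑ β, flatSystem g j x α β * ∑ γ, flatSystem g i x β γ * w γ =
      pd j (fun z => ∑ β, flatSystem g i z α β * w β) x
        + ∑ β, flatSystem g i x α β * ∑ γ, flatSystem g j x β γ * w γ := by
  have hs := hg.symm x hx
  have hd := hg.det x hx
  have hPd (i j) := differentiableAt_of_contDiffOn hg.isOpen (hg.contDiffOn_schouten i j) hx
  have hgd (i j) := differentiableAt_of_contDiffOn hg.isOpen (hg.smooth i j) hx
  set m : Fin n → ℝ := fun c => w (.inl c) with hm
  have hms (c : Fin n) : ContDiffOn ℝ ∞ (fun _ : EuclideanSpace ℝ (Fin n) => m c) Ω :=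
    contDiffOn_const
  -- The integrability condition is tested on a constant vector `w`, so its covariant derivative
  -- consists of the Christoffel term alone.
  have hmd (i : Fin n) : covDeriv₁ g (fun _ => m) x i = fun c => -ip (g x) (chr g x i c) m := by
    funext c
    rw [hg.covDeriv₁_eq hx, pd_const]
    ring
  have hcip (j b : Fin n) : DifferentiableAt ℝ (fun y => ip (g y) (chr g y j b) m) x :=
    differentiableAt_of_contDiffOn hg.isOpen
      (hg.contDiffOn_ip (fun c => hg.contDiffOn_chr j b c) hms) hx
  have hP₁ (i j c : Fin n) : covDeriv₁ g (fun y => schouten g y j) x i c =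
      covDeriv₂ g (schouten g) x c j i + ip (g x) (chr g x i j) (schouten g x c) := by
    rw [hg.covDeriv₁_eq hx, covDeriv₂, pd_congr hg.isOpen (fun y hy => hP y hy j c) hx,
      show schouten g x j = fun a => schouten g x a j from funext fun a => hP x hx j a]
    ring
  have hP₂ : (covDeriv₁ g (fun y => schouten g y j) x i) = covDeriv₁ g (fun y => schouten g y i) x
      j := by
    funext c
    rw [hP₁, hP₁, hC x hx c j i, funext (hg.chr_symm hx i j)]
  rcases α with b | _ | _
  · have e (i j : Fin n) : pd i (fun z => ∑ β, flatSystem g j z (.inl b) β * w β) x =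
        ip (g x) (covDeriv₁ g (fun y => chr g y j b) x i) m
          - ip (g x) (chr g x j b) (fun c => ip (g x) (chr g x i c) m)
          - w (.inr false) * pd i (fun y => schouten g y j b) x
          + w (.inr true) * pd i (fun y => g y j b) x := by
      rw [pd_congr hg.isOpen (fun y hy => hg.sum_flatSystem_inl hy j b w) hx,
        pd_add ((hcip j b).fun_sub ((hPd _ _).const_mul _)) ((hgd _ _).const_mul _),
        pd_sub (hcip j b) ((hPd _ _).const_mul _), pd_const_mul (hPd _ _), pd_const_mul (hgd _ _),
        hg.pd_ip hx (fun c => hg.contDiffOn_chr j b c) hms, hmd]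
      rw [ip_neg_right]
      ring
    have f (i j : Fin n) : ∑ β, flatSystem g j x (.inl b) β * ∑ γ, flatSystem g i x β γ * w γ =
        ip (g x) (chr g x j b) (fun c => ip (g x) (chr g x i c) m)
          - w (.inr false) * ip (g x) (chr g x j b) (schouten g x i)
          + w (.inr true) * chr g x j b i - w (.inl i) * schouten g x j b
          - ip (g x) (schouten g x i) m * g x j b := by
      rw [hg.sum_flatSystem_inl hx j b fun β => ∑ γ, flatSystem g i x β γ * w γ]
      simp only [sum_flatSystem_false, hg.sum_flatSystem_true hx, hg.sum_flatSystem_inl hx]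
      have : (fun c => ip (g x) (chr g x i c) (fun c => w (.inl c)) - w (.inr false) * schouten g x
          i c
          + w (.inr true) * g x i c) = (fun c => ip (g x) (chr g x i c) m)
          - (w (.inr false)) • schouten g x i + (w (.inr true)) • g x i := rfl
      rw [this, ip_add_right, ip_sub_right, ip_smul_right, ip_smul_right, ip_metric_right hs hd]
      ring
    have r : ip (g x) (covDeriv₁ g (fun y => chr g y j b) x i) m
        - ip (g x) (covDeriv₁ g (fun y => chr g y i b) x j) m =
        g x j b * ip (g x) (schouten g x i) m + schouten g x j b * m i
        - schouten g x i b * m j - g x i b * ip (g x) (schouten g x j) m := by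
      have : covDeriv₁ g (fun y => chr g y j b) x i - covDeriv₁ g (fun y => chr g y i b) x j =
          (g x j b) • schouten g x i + (schouten g x j b) • g x i
            - (schouten g x i b) • g x j - (g x i b) • schouten g x j := by
        have : covDeriv₁ g (fun y => chr g y j b) x i - covDeriv₁ g (fun y => chr g y i b) x j =
            fun a => riemannLower g x a b i j := by
          funext a
          simp only [Pi.sub_apply, hg.covDeriv₁_eq hx, riemannLower]
          ring
        rw [this]
        funext a
        rw [hR x hx]
        simp only [kulkarniNomizu, Pi.add_apply, Pi.sub_apply, Pi.smul_apply, smul_eq_mul]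
        ring
      rw [← ip_sub_left, this]
      simp only [ip_add_left, ip_sub_left, ip_smul_left, ip_metric_left hd]
    have c := hC x hx b j i
    have p₁ := congrFun hP₂ b
    rw [hg.covDeriv₁_eq hx, hg.covDeriv₁_eq hx, ip_comm hs, ip_comm hs (chr g x j b)] at p₁
    rw [e, e, f, f, hg.pd_metric hx, hg.pd_metric hx, ip_comm hs (chr g x j b) (schouten g x i),
      ip_comm hs (chr g x i b) (schouten g x j), hg.chr_symm hx i j]
    linear_combination r - w (.inr false) * p₁
  · simp only [sum_flatSystem_false, pd_const, hg.sum_flatSystem_inl hx]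
    rw [funext (hg.chr_symm hx i j), hP x hx i j, hs i j]
  · have e (i j : Fin n) : pd i (fun z => ∑ β, flatSystem g j z (.inr true) β * w β) x =
        -ip (g x) (covDeriv₁ g (fun y => schouten g y j) x i) m
          + ip (g x) (schouten g x j) (fun c => ip (g x) (chr g x i c) m) := by
      rw [pd_congr hg.isOpen (fun y hy => hg.sum_flatSystem_true hy j w) hx, pd_neg,
        hg.pd_ip hx (fun c => hg.contDiffOn_schouten j c) hms, hmd]
      rw [ip_neg_right]
      ring
    have f (i j : Fin n) : ∑ β, flatSystem g j x (.inr true) β * ∑ γ, flatSystem g i x β γ * w γ =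
        -ip (g x) (schouten g x j) (fun c => ip (g x) (chr g x i c) m)
          + w (.inr false) * ip (g x) (schouten g x j) (schouten g x i)
          - w (.inr true) * schouten g x j i := by
      rw [hg.sum_flatSystem_true hx j fun β => ∑ γ, flatSystem g i x β γ * w γ]
      simp only [hg.sum_flatSystem_inl hx]
      have : (fun c => ip (g x) (chr g x i c) (fun c => w (.inl c)) - w (.inr false) * schouten g x
          i c
          + w (.inr true) * g x i c) = (fun c => ip (g x) (chr g x i c) m)
          - (w (.inr false)) • schouten g x i + (w (.inr true)) • g x i := rfl
      rw [this, ip_add_right, ip_sub_right, ip_smul_right, ip_smul_right, ip_metric_right hs hd]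
      ring
    rw [e, e, f, f, hP₂, ip_comm hs (schouten g x j) (schouten g x i), hP x hx i j]
    ring

theorem riemann_eq_zero (hg : IsMetricOn Ω g) (hx : x ∈ Ω)
    (h : ∀ k l i j, riemannLower g x k l i j = 0) (l k i j : Fin n) : riemann g l k i j x = 0 := by
  have : (g x).mulVec (fun a => riemann g a k i j x) = 0 := by
    funext b
    exact (hg.sum_metric_mul_riemann hx b k i j).trans (h b k i j)
  exact congrFun (Matrix.eq_zero_of_mulVec_eq_zero (hg.det x hx).ne_zero this) l

/-- A metric whose Weyl and Cotton tensors vanish is locally conformally flat. -/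
theorem exists_conformal_flat (hg : IsMetricOn Ω g)
    (hP : ∀ x ∈ Ω, ∀ i j, schouten g x i j = schouten g x j i)
    (hR : ∀ x ∈ Ω, ∀ i j k l, riemannLower g x k l i j = kulkarniNomizu (schouten g x) (g x) i j k
        l)
    (hC : ∀ x ∈ Ω, ∀ i j k, covDeriv₂ g (schouten g) x i j k = covDeriv₂ g (schouten g) x i k j)
    {p : EuclideanSpace ℝ (Fin n)} (hp : p ∈ Ω) :
    ∃ r > 0, Metric.ball p r ⊆ Ω ∧ ∃ φ : EuclideanSpace ℝ (Fin n) → ℝ,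
      ContDiffOn ℝ ∞ φ (Metric.ball p r) ∧ ∀ x ∈ Metric.ball p r, ∀ l k i j,
        riemann (fun y => Real.exp (2 * φ y) • g y) l k i j x = 0 := by
  obtain ⟨r₀, hr₀, hb₀, w, hwp, hws, hw⟩ := exists_solution_of_pd_integrable hg.isOpen
    hg.contDiffOn_flatSystem (fun y hy i j α w => hg.flatSystem_integrable hP hR hC hy i j α w) hp
    -- Initial values `μ = 0`, `ρ = 0` and `σ = 1`, so that `σ` is positive near `p`.
    (Sum.elim 0 fun b => if b then 0 else 1)
  set σ : EuclideanSpace ℝ (Fin n) → ℝ := fun y => w y (.inr false) with hσ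
  set ρ : EuclideanSpace ℝ (Fin n) → ℝ := fun y => w y (.inr true) with hρ
  set μ : EuclideanSpace ℝ (Fin n) → Fin n → ℝ := fun y c => w y (.inl c) with hμ
  have hσs : ContDiffOn ℝ ∞ σ (Metric.ball p r₀) := hws _
  have hpos : ∀ᶠ y in nhds p, 0 < σ y := by
    refine (hσs.continuousOn.continuousAt (Metric.ball_mem_nhds p hr₀)).eventually_const_lt ?_
    simp [hσ, hwp]
  obtain ⟨r, hr, hb⟩ := Metric.mem_nhds_iff.1 (Filter.inter_mem hpos (Metric.ball_mem_nhds p hr₀))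
  have hbr : Metric.ball p r ⊆ Metric.ball p r₀ := fun y hy => (hb hy).2
  have hbΩ : Metric.ball p r ⊆ Ω := hbr.trans hb₀
  have hg' := hg.mono Metric.isOpen_ball hbΩ
  have hσp (y) (hy : y ∈ Metric.ball p r) : 0 < σ y := (hb hy).1
  have hws' (α) : ContDiffOn ℝ ∞ (fun y => w y α) (Metric.ball p r) := (hws α).mono hbr
  have hwd (α) {y} (hy : y ∈ Metric.ball p r) : DifferentiableAt ℝ (fun y => w y α) y :=
    differentiableAt_of_contDiffOn Metric.isOpen_ball (hws' α) hy
  have dσ {y} (hy : y ∈ Metric.ball p r) (i) : pd i σ y = μ y i := by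
    rw [hw y (hbr hy), sum_flatSystem_false]
  have dρ {y} (hy : y ∈ Metric.ball p r) (i) :
      pd i ρ y = -ip (g y) (schouten g y i) (μ y) := by
    rw [hw y (hbr hy), hg.sum_flatSystem_true (hbΩ hy)]
  have dμ {y} (hy : y ∈ Metric.ball p r) (i j) :
      covDeriv₁ g μ y i j = -σ y * schouten g y i j + ρ y * g y i j := by
    rw [hg'.covDeriv₁_eq hy, hw y (hbr hy), hg.sum_flatSystem_inl (hbΩ hy)]
    ring
  -- A first integral of the system, zero at `p`. It eliminates `ρ` when the trace term `|dφ|²` is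
  -- computed below.
  have hcons : ∀ y ∈ Metric.ball p r, 2 * σ y * ρ y - ip (g y) (μ y) (μ y) = 0 := by
    have hsm : ContDiffOn ℝ ∞ (fun y => 2 * σ y * ρ y - ip (g y) (μ y) (μ y)) (Metric.ball p r) :=
      ((contDiffOn_const.mul (hws' _)).mul (hws' _)).sub
        (hg'.contDiffOn_ip (fun c => hws' _) fun c => hws' _)
    have hz : ∀ y ∈ Metric.ball p r,
        fderiv ℝ (fun y => 2 * σ y * ρ y - ip (g y) (μ y) (μ y)) y = 0 := by
      intro y hy
      have hs := hg.symm y (hbΩ hy)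
      have hd := hg.det y (hbΩ hy)
      have hpd (i : Fin n) : pd i (fun y => 2 * σ y * ρ y - ip (g y) (μ y) (μ y)) y = 0 := by
        have dip := differentiableAt_of_contDiffOn Metric.isOpen_ball
          (hg'.contDiffOn_ip (α := μ) (β := μ) (fun c => hws' _) fun c => hws' _) hy
        rw [pd_sub (((hwd _ hy).const_mul 2).fun_mul (hwd _ hy)) dip,
          pd_mul ((hwd _ hy).const_mul 2) (hwd _ hy), pd_const_mul (hwd _ hy), dσ hy, dρ hy,
          hg'.pd_ip hy (fun c => hws' _) fun c => hws' _]
        have : covDeriv₁ g μ y i = (-σ y) • schouten g y i + (ρ y) • g y i := funext fun j => dμ hy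
            i j
        rw [this]
        simp only [ip_add_left, ip_add_right, ip_smul_left, ip_smul_right, ip_metric_left hd,
          ip_metric_right hs hd]
        rw [ip_comm hs (μ y)]
        ring
      ext h
      have hh : h = ∑ i, h i • EuclideanSpace.single i (1 : ℝ) := by
        ext c
        simp [Pi.single_apply]
      rw [hh, map_sum, zero_apply]
      exact Finset.sum_eq_zero fun i _ => by
        rw [map_smul]
        exact (congrArg (fun c => h i • c) (hpd i)).trans (smul_zero _)
    intro y hy
    have := Metric.isOpen_ball.is_const_of_fderiv_eq_zero (convex_ball p r).isPreconnected
      (hsm.differentiableOn (by simp)) hz hy (Metric.mem_ball_self hr)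
    rw [this]
    have h₀ : μ p = 0 := by
      funext c
      simp [hμ, hwp]
    have h₁ : ρ p = 0 := by simp [hρ, hwp]
    rw [h₀, h₁, ip_zero_right]
    ring
  -- Thus `e^{2φ} g = σ⁻² g`.
  set φ : EuclideanSpace ℝ (Fin n) → ℝ := fun y => -Real.log (σ y) with hφ
  have hφs : ContDiffOn ℝ ∞ φ (Metric.ball p r) :=
    ((hws' _).log fun y hy => (hσp y hy).ne').neg
  have dφ {y} (hy : y ∈ Metric.ball p r) (i) : pd i φ y = -(μ y i / σ y) := by
    rw [hφ, pd_neg, pd, ((hwd (.inr false) hy).hasFDerivAt.log (hσp y hy).ne').fderiv]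
    have : fderiv ℝ (fun y => w y (.inr false)) y (EuclideanSpace.single i 1) = μ y i := dσ hy i
    rw [smul_apply, this, smul_eq_mul]
    simp only [hσ]
    ring
  refine ⟨r, hr, hbΩ, φ, hφs, fun x hx => (hg'.conformal hφs).riemann_eq_zero hx
    fun k l i j => ?_⟩
  have hs := hg.symm x (hbΩ hx)
  have hσx := (hσp x hx).ne'
  rw [hg'.riemannLower_conformal hx hφs, hR x (hbΩ hx)]
  have dφ' : (fun a => pd a φ x) = (-(σ x)⁻¹) • μ x := by
    funext a
    rw [dφ hx, Pi.smul_apply, smul_eq_mul]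
    ring
  have hcd (i j : Fin n) : covDeriv₁ g (fun y a => pd a φ y) x i j =
      -(covDeriv₁ g μ x i j / σ x) + μ x i * μ x j / σ x ^ 2 := by
    have hpφ := differentiableAt_of_contDiffOn Metric.isOpen_ball
      (contDiffOn_pd Metric.isOpen_ball hφs j) hx
    have e : pd i (fun y => pd j φ y) x =
        -((pd i (fun y => μ y j) x * σ x - μ x j * pd i σ x) / σ x ^ 2) := by
      have h := pd_congr (F := fun y => σ y * pd j φ y) (G := fun y => -μ y j)
        Metric.isOpen_ball (fun y hy => by
          rw [dφ hy]
          have := (hσp y hy).ne'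
          field_simp) hx i
      rw [pd_mul (F := σ) (hwd _ hx) hpφ, dφ hx, pd_neg] at h
      have h' : pd i (pd j φ) x = (-pd i (fun y => μ y j) x + pd i σ x * (μ x j / σ x)) / σ x := by
        rw [eq_div_iff hσx]
        linarith
      rw [h']
      field_simp
      ring
    rw [hg'.covDeriv₁_eq hx, e, dφ', ip_smul_right, hg'.covDeriv₁_eq hx, dσ hx]
    field_simp
    ring
  -- The tensor by which the conformal change alters the curvature is the Schouten tensor itself, so
  -- it cancels `Riem = P ∧ g`.
  have hQ (a b : Fin n) : covDeriv₁ g (fun y a => pd a φ y) x a b - pd a φ x * pd b φ x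
      + normSq₁ (g x) (fun a => pd a φ x) / 2 * g x a b = schouten g x a b := by
    have h₁ : normSq₁ (g x) (fun a => pd a φ x) = (σ x)⁻¹ * ((σ x)⁻¹ * ip (g x) (μ x) (μ x)) := by
      have : normSq₁ (g x) (fun a => pd a φ x) = ip (g x) (fun a => pd a φ x) fun a => pd a φ x :=
          rfl
      rw [this, dφ', ip_smul_left, ip_smul_right]
      ring
    have h₂ : ip (g x) (μ x) (μ x) = 2 * σ x * ρ x := by linarith [hcons x hx]
    rw [h₁, h₂, hcd, dμ hx, dφ hx, dφ hx]
    field_simp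
    ring
  simp only [hQ, sub_self, mul_zero]

end IsMetricOn

/-! ### Geometric quantities depend only on the metric on an open set. -/

section Congruence

variable {Ω : Set (EuclideanSpace ℝ (Fin n))}
  {g g' : EuclideanSpace ℝ (Fin n) → Matrix (Fin n) (Fin n) ℝ} {x : EuclideanSpace ℝ (Fin n)}

theorem christoffel_congr (hΩ : IsOpen Ω) (h : ∀ y ∈ Ω, g y = g' y) (hx : x ∈ Ω) (k i j : Fin n) :
    christoffel g k i j x = christoffel g' k i j x := by
  have e (a b c : Fin n) : pd c (fun y => g y a b) x = pd c (fun y => g' y a b) x :=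
    pd_congr hΩ (fun y hy => by rw [h y hy]) hx c
  simp only [christoffel, e, h x hx]

theorem riemann_congr (hΩ : IsOpen Ω) (h : ∀ y ∈ Ω, g y = g' y) (hx : x ∈ Ω) (l k i j : Fin n) :
    riemann g l k i j x = riemann g' l k i j x := by
  have e (a b c d : Fin n) : pd d (christoffel g a b c) x = pd d (christoffel g' a b c) x :=
    pd_congr hΩ (fun y hy => christoffel_congr hΩ h hy a b c) hx d
  simp only [riemann, e, christoffel_congr hΩ h hx]

theorem schouten_congr (hΩ : IsOpen Ω) (h : ∀ y ∈ Ω, g y = g' y) (hx : x ∈ Ω) (i j : Fin n) :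
    schouten g x i j = schouten g' x i j := by
  have e : ricci g x = ricci g' x := by
    funext i j
    simp only [ricci, riemann_congr hΩ h hx]
  simp only [schouten, e, h x hx]

theorem weyl_congr (hΩ : IsOpen Ω) (h : ∀ y ∈ Ω, g y = g' y) (hx : x ∈ Ω) (i j k l : Fin n) :
    weyl g x i j k l = weyl g' x i j k l := by
  simp only [weyl, kulkarniNomizu, schouten_congr hΩ h hx, riemann_congr hΩ h hx, h x hx]

theorem covDeriv₁_congr_metric {u u' : EuclideanSpace ℝ (Fin n) → Fin n → ℝ} (hΩ : IsOpen Ω)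
    (h : ∀ y ∈ Ω, g y = g' y) (hu : ∀ y ∈ Ω, u y = u' y) (hx : x ∈ Ω) (i j : Fin n) :
    covDeriv₁ g u x i j = covDeriv₁ g' u' x i j := by
  have e (a c : Fin n) : pd c (fun y => u y a) x = pd c (fun y => u' y a) x :=
    pd_congr hΩ (fun y hy => by rw [hu y hy]) hx c
  simp only [covDeriv₁, e, christoffel_congr hΩ h hx, hu x hx]

theorem covDeriv₃_congr_metric {T T' : EuclideanSpace ℝ (Fin n) → Fin n → Fin n → Fin n → ℝ}
    (hΩ : IsOpen Ω) (h : ∀ y ∈ Ω, g y = g' y) (hT : ∀ y ∈ Ω, T y = T' y) (hx : x ∈ Ω)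
    (i j k l : Fin n) : covDeriv₃ g T x i j k l = covDeriv₃ g' T' x i j k l := by
  have e (a b c d : Fin n) : pd d (fun y => T y a b c) x = pd d (fun y => T' y a b c) x :=
    pd_congr hΩ (fun y hy => by rw [hT y hy]) hx d
  simp only [covDeriv₃, e, christoffel_congr hΩ h hx, hT x hx]

end Congruence

/-- The determinant as a continuous multilinear function of the rows. -/
def detRows (m : ℕ) : ContinuousMultilinearMap ℝ (fun _ : Fin m => Fin m → ℝ) ℝ where
  toMultilinearMap := (Matrix.detRowAlternating : (Fin m → ℝ) [⋀^Fin m]→ₗ[ℝ] ℝ).toMultilinearMap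
  cont := Continuous.matrix_det (A := fun A : Matrix (Fin m) (Fin m) ℝ => A) continuous_id

/-- Jacobi's formula for `∂A = B A`: replacing row `i` by a combination of the rows multiplies the
determinant by the diagonal coefficient `B i i`. -/
theorem pd_det {m : ℕ} {A : EuclideanSpace ℝ (Fin n) → Matrix (Fin m) (Fin m) ℝ}
    {x : EuclideanSpace ℝ (Fin n)} (hA : ∀ i j, DifferentiableAt ℝ (fun y => A y i j) x)
    (k : Fin n) (B : Matrix (Fin m) (Fin m) ℝ)
    (hB : ∀ i j, pd k (fun y => A y i j) x = ∑ l, B i l * A x l j) :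
    pd k (fun y => (A y).det) x = (∑ i, B i i) * (A x).det := by
  have h₁ : HasFDerivAt (fun y i j => A y i j)
      (ContinuousLinearMap.pi fun i => ContinuousLinearMap.pi fun j =>
        fderiv ℝ (fun y => A y i j) x) x :=
    hasFDerivAt_pi.2 fun i => hasFDerivAt_pi.2 fun j => (hA i j).hasFDerivAt
  have h₂ := ((detRows m).hasFDerivAt (fun i j => A x i j)).comp x h₁
  have h₃ : fderiv ℝ (fun y => (A y).det) x = _ := h₂.fderiv
  rw [pd, h₃, Finset.sum_mul]
  simp only [ContinuousLinearMap.comp_apply, ContinuousMultilinearMap.linearDeriv_apply]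
  refine Finset.sum_congr rfl fun i _ => ?_
  have : (ContinuousLinearMap.pi fun i => ContinuousLinearMap.pi fun j =>
      fderiv ℝ (fun y => A y i j) x) (EuclideanSpace.single k 1) i = ∑ l, B i l • A x l := by
    funext j
    simpa [Finset.sum_apply, pd] using hB i j
  rw [this]
  exact Matrix.det_updateRow_sum (A x) i (B i)

/-- The potential of the trace part of the cubic form. -/
def localPotential (F : EuclideanSpace ℝ (Fin n) → EuclideanSpace ℝ (Fin (n + 1)))
    (Θ : EuclideanSpace ℝ (Fin n) → EuclideanSpace ℝ (Fin (n + 1)) →L[ℝ] ℝ)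
    (x : EuclideanSpace ℝ (Fin n)) : ℝ :=
  3 / ((n : ℝ) + 2) * (1 / 2 * Real.log (localMetric F Θ x).det
    - Real.log (coframeMatrix (Θ x) fun i => pdv i Θ x).det)

/-! ### The potential of the trace part in coordinates. -/

namespace IsConormalPair

variable {Ω : Set (EuclideanSpace ℝ (Fin n))}
  {F : EuclideanSpace ℝ (Fin n) → EuclideanSpace ℝ (Fin (n + 1))}
  {Θ : EuclideanSpace ℝ (Fin n) → EuclideanSpace ℝ (Fin (n + 1)) →L[ℝ] ℝ}
  {x : EuclideanSpace ℝ (Fin n)}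

theorem det_coframeMatrix_ne_zero (h : IsConormalPair Ω F Θ) (hx : x ∈ Ω) :
    (coframeMatrix (Θ x) fun i => pdv i Θ x).det ≠ 0 :=
  Abundant.det_coframeMatrix_ne_zero (v := fun j => pdv j F x) (g := localMetric F Θ x)
    (h.ne_zero x hx) (h.conormal x hx) (fun i j => by simp [localMetric]) (h.det x hx)

theorem contDiffOn_coframeMatrix (h : IsConormalPair Ω F Θ) (a c : Fin (n + 1)) :
    ContDiffOn ℝ ∞ (fun y => coframeMatrix (Θ y) (fun i => pdv i Θ y) a c) Ω := by
  refine Fin.cases ?_ (fun i => ?_) a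
  · simpa [coframeMatrix] using h.smooth₂.clm_apply contDiffOn_const
  · simpa [coframeMatrix] using (h.smooth_pdv₂ i).clm_apply contDiffOn_const

theorem contDiffOn_localPotential (h : IsConormalPair Ω F Θ) :
    ContDiffOn ℝ ∞ (localPotential F Θ) Ω :=
  contDiffOn_const.mul ((contDiffOn_const.mul ((contDiffOn_det h.isMetricOn.smooth).log
    fun y hy => (h.det y hy).ne_zero)).sub
      ((contDiffOn_det h.contDiffOn_coframeMatrix).log fun _ hy => h.det_coframeMatrix_ne_zero hy))

theorem pd_det_localMetric (h : IsConormalPair Ω F Θ) (hx : x ∈ Ω) (k : Fin n) :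
    pd k (fun y => (localMetric F Θ y).det) x =
      2 * tr₂ (localMetric F Θ x) (chr (localMetric F Θ) x k) * (localMetric F Θ x).det := by
  have hg := h.isMetricOn
  have hs := hg.symm x hx
  have hd := h.det x hx
  set g := localMetric F Θ with hgd
  rw [pd_det (fun i j => differentiableAt_of_contDiffOn h.isOpen (hg.smooth i j) hx) k
    (Matrix.of (fun i j => pd k (fun y => g y i j) x) * (g x)⁻¹)]
  · congr 1
    have e : 2 * tr₂ (g x) (chr g x k) = tr₂ (g x) (fun i j => pd k (fun y => g y i j) x) := by
      simp only [hg.pd_metric hx]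
      rw [tr₂_add]
      have := tr₂_swap hs fun i j => chr g x k i j
      have e' : tr₂ (g x) (fun i j => chr g x k i j) = tr₂ (g x) (chr g x k) := rfl
      linarith
    rw [e, tr₂, Finset.sum_comm]
    simp only [Matrix.mul_apply, Matrix.of_apply]
    refine Finset.sum_congr rfl fun i _ => Finset.sum_congr rfl fun j _ => ?_
    rw [mul_comm, hg.pd_symm hx]
  · intro i j
    have : (Matrix.of (fun i j => pd k (fun y => g y i j) x) * (g x)⁻¹ * g x) i j =
        pd k (fun y => g y i j) x := by
      rw [Matrix.mul_assoc, Matrix.nonsing_inv_mul _ hd, Matrix.mul_one, Matrix.of_apply]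
    rw [← this, Matrix.mul_apply]

theorem pd_det_coframeMatrix (h : IsConormalPair Ω F Θ) (hx : x ∈ Ω) (k : Fin n) :
    pd k (fun y => (coframeMatrix (Θ y) fun i => pdv i Θ y).det) x =
      tr₂ (localMetric F Θ x) (fun i j => chr (localMetric F Θ) x k i j - localCubic F Θ x k i j)
        * (coframeMatrix (Θ x) fun i => pdv i Θ x).det := by
  have hg := h.isMetricOn
  have hs := hg.symm x hx
  have hd := h.det x hx
  obtain ⟨ξ, hξ, hξ'⟩ := exists_transversal (v := fun j => pdv j F x) (θ' := fun i => pdv i Θ x)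
    (g := localMetric F Θ x) (h.ne_zero x hx) (h.conormal x hx) (fun i j => by simp [localMetric])
    hd
  have hexp (i : Fin n) (w : EuclideanSpace ℝ (Fin (n + 1))) : pdv k (pdv i Θ) x w =
      ip (localMetric F Θ x) (fun a => chr (localMetric F Θ) x k i a - localCubic F Θ x k i a)
        (fun b => pdv b Θ x w) + pdv k (pdv i Θ) x ξ * Θ x w := by
    rw [apply_eq_of_transversal (v := fun j => pdv j F x) hs (h.ne_zero x hx) (h.conormal x hx)
      (fun i j => by simp [localMetric]) hd hξ hξ' (pdv k (pdv i Θ) x) w]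
    have : (fun a => pdv k (pdv i Θ) x (pdv a F x)) =
        (-1 : ℝ) • fun a => chr (localMetric F Θ) x k i a - localCubic F Θ x k i a := by
      funext a
      rw [Pi.smul_apply, h.chr_sub_localCubic hx, smul_eq_mul]
      ring
    rw [this, ip_smul_left]
    ring
  have hc (A : EuclideanSpace ℝ (Fin n) → EuclideanSpace ℝ (Fin (n + 1)) →L[ℝ] ℝ)
      (hA : ContDiffOn ℝ ∞ A Ω) (w : EuclideanSpace ℝ (Fin (n + 1))) :
      pd k (fun y => A y w) x = pdv k A x w := by
    rw [pd_clm_apply h.isOpen hA contDiffOn_const hx]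
    simp [pdv]
  -- The derivative of the coframe expressed in the coframe: `Θ` goes to the row `∂_k Θ`, and `∂_i
  -- Θ` to its expansion with coefficients from `chr - C` and a multiple of `Θ`. The row of `Θ` has
  -- no diagonal entry.
  rw [pd_det (fun a c => differentiableAt_of_contDiffOn h.isOpen
    (h.contDiffOn_coframeMatrix a c) hx) k (Matrix.of fun a b => Fin.cases
      (Fin.cases 0 (fun j => if j = k then 1 else 0) b)
      (fun i => Fin.cases (pdv k (pdv i Θ) x ξ) (fun b => ∑ a, (localMetric F Θ x)⁻¹ a b *
        (chr (localMetric F Θ) x k i a - localCubic F Θ x k i a)) b) a)]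
  · congr 1
    simp only [Fin.sum_univ_succ, Matrix.of_apply, Fin.cases_zero, Fin.cases_succ, zero_add, tr₂]
    refine Finset.sum_congr rfl fun i _ => Finset.sum_congr rfl fun a _ => ?_
    rw [inv_symm hs]
  · intro a c
    refine Fin.cases ?_ (fun i => ?_) a
    · simp [coframeMatrix, Fin.sum_univ_succ, hc Θ h.smooth₂]
    · simp only [coframeMatrix, Matrix.of_apply, Fin.cons_succ, Fin.sum_univ_succ, Fin.cases_zero,
        Fin.cases_succ, Fin.cons_zero]
      rw [hc _ (h.smooth_pdv₂ i), hexp, add_comm]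
      congr 1
      simp only [ip, tr₂, Finset.sum_mul]
      rw [Finset.sum_comm]
      exact Finset.sum_congr rfl fun _ _ => Finset.sum_congr rfl fun _ _ => by ring

/-- The volume of `G` contributes the trace of `chr`, that of the coframe the trace of `chr - C`.
The difference is the trace of `C`, which is `(n + 2) u`. `Real.log` is the logarithm of the
absolute value, so the signs of the determinants do not matter. -/
theorem pd_localPotential (h : IsConormalPair Ω F Θ) (hx : x ∈ Ω) (k : Fin n) :
    pd k (localPotential F Θ) x = 3 * localTrace F Θ x k := by
  have d₁ := differentiableAt_of_contDiffOn h.isOpen (contDiffOn_det h.isMetricOn.smooth) hx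
  have d₂ := differentiableAt_of_contDiffOn h.isOpen (contDiffOn_det h.contDiffOn_coframeMatrix) hx
  have n₁ := (h.det x hx).ne_zero
  have n₂ := h.det_coframeMatrix_ne_zero hx
  have hlog {G : EuclideanSpace ℝ (Fin n) → ℝ} (hG : DifferentiableAt ℝ G x) (h0 : G x ≠ 0) :
      pd k (fun y => Real.log (G y)) x = (G x)⁻¹ * pd k G x := by
    simp [pd, fderiv.log hG h0]
  have e : localPotential F Θ = fun y => 3 / ((n : ℝ) + 2) *
      (1 / 2 * Real.log (localMetric F Θ y).det
        - Real.log (coframeMatrix (Θ y) fun i => pdv i Θ y).det) := rfl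
  rw [e, pd_const_mul (((d₁.log n₁).const_mul _).fun_sub (d₂.log n₂)),
    pd_sub ((d₁.log n₁).const_mul _) (d₂.log n₂), pd_const_mul (d₁.log n₁), hlog d₁ n₁, hlog d₂ n₂,
    h.pd_det_localMetric hx, h.pd_det_coframeMatrix hx, localTrace, tr₂_sub]
  field_simp
  ring

end IsConormalPair

theorem isOpen_transition {M : Type*} [TopologicalSpace M]
    (e e' : OpenPartialHomeomorph M (EuclideanSpace ℝ (Fin n))) :
    IsOpen (e.target ∩ e.symm ⁻¹' e'.source) :=
  e.symm.isOpen_inter_preimage e'.open_source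

/-! ### Charts and extended vector fields. -/

section Charts

variable {M : Type*} [TopologicalSpace M] [ChartedSpace (EuclideanSpace ℝ (Fin n)) M]
  {V : Type*} [NormedAddCommGroup V] [NormedSpace ℝ V]
  {e : OpenPartialHomeomorph M (EuclideanSpace ℝ (Fin n))} {x : EuclideanSpace ℝ (Fin n)}

theorem mdifferentiable_of_mem_maximalAtlas (he : e ∈ IsManifold.maximalAtlas (𝓡 n) ∞ M) :
    e.MDifferentiable (𝓡 n) (𝓡 n) :=
  ⟨(contMDiffOn_of_mem_maximalAtlas he).mdifferentiableOn (by simp),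
    (contMDiffOn_symm_of_mem_maximalAtlas he).mdifferentiableOn (by simp)⟩

theorem mfderiv_mfderiv_symm (he : e ∈ IsManifold.maximalAtlas (𝓡 n) ∞ M) (hx : x ∈ e.target)
    (v : EuclideanSpace ℝ (Fin n)) :
    mfderiv (𝓡 n) (𝓡 n) e (e.symm x) (mfderiv (𝓡 n) (𝓡 n) e.symm x v) = v :=
  congrArg (fun L => L v) ((mdifferentiable_of_mem_maximalAtlas he).comp_symm_deriv hx)

theorem mfderiv_symm_mfderiv (he : e ∈ IsManifold.maximalAtlas (𝓡 n) ∞ M) (hx : x ∈ e.target)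
    (X : TangentSpace (𝓡 n) (e.symm x)) :
    mfderiv (𝓡 n) (𝓡 n) e.symm x (mfderiv (𝓡 n) (𝓡 n) e (e.symm x) X) = X := by
  have h := (mdifferentiable_of_mem_maximalAtlas he).symm_comp_deriv (e.map_target hx)
  rw [e.right_inv hx] at h
  exact congrArg (fun L => L X) h

theorem mvfderiv_mfderiv_symm {h : M → V} (he : e ∈ IsManifold.maximalAtlas (𝓡 n) ∞ M)
    (hx : x ∈ e.target) (hh : MDifferentiableAt (𝓡 n) 𝓘(ℝ, V) h (e.symm x))
    (v : EuclideanSpace ℝ (Fin n)) :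
    mvfderiv (𝓡 n) h (e.symm x) (mfderiv (𝓡 n) (𝓡 n) e.symm x v) = fderiv ℝ (h ∘ e.symm) x v := by
  rw [← mfderiv_eq_fderiv, mfderiv_comp x hh
    ((mdifferentiable_of_mem_maximalAtlas he).mdifferentiableAt_symm hx)]
  rfl

theorem mdifferentiableAt_of_comp_symm {h : M → V} (he : e ∈ IsManifold.maximalAtlas (𝓡 n) ∞ M)
    (hx : x ∈ e.target) (hh : DifferentiableAt ℝ (h ∘ e.symm) x) :
    MDifferentiableAt (𝓡 n) 𝓘(ℝ, V) h (e.symm x) := by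
  have h₁ : MDifferentiableAt (𝓡 n) 𝓘(ℝ, V) ((h ∘ e.symm) ∘ e) (e.symm x) := by
    refine MDifferentiableAt.comp (I' := 𝓡 n) _ ?_
      ((mdifferentiable_of_mem_maximalAtlas he).mdifferentiableAt (e.map_target hx))
    rw [e.right_inv hx]
    exact hh.mdifferentiableAt
  refine h₁.congr_of_eventuallyEq ?_
  filter_upwards [e.open_source.mem_nhds (e.map_target hx)] with q hq
  simp [e.left_inv hq]

theorem contDiffOn_comp_symm {h : M → V} (he : e ∈ IsManifold.maximalAtlas (𝓡 n) ∞ M)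
    (hh : ContMDiff (𝓡 n) 𝓘(ℝ, V) ∞ h) : ContDiffOn ℝ ∞ (h ∘ e.symm) e.target :=
  contMDiffOn_iff_contDiffOn.1 (hh.comp_contMDiffOn (contMDiffOn_symm_of_mem_maximalAtlas he))

theorem contDiffOn_transition {e' : OpenPartialHomeomorph M (EuclideanSpace ℝ (Fin n))}
    (he : e ∈ IsManifold.maximalAtlas (𝓡 n) ∞ M) (he' : e' ∈ IsManifold.maximalAtlas (𝓡 n) ∞ M) :
    ContDiffOn ℝ ∞ (e' ∘ e.symm) (e.target ∩ e.symm ⁻¹' e'.source) :=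
  contMDiffOn_iff_contDiffOn.1 (((contMDiffOn_of_mem_maximalAtlas he').comp
    ((contMDiffOn_symm_of_mem_maximalAtlas he).mono Set.inter_subset_left)
    fun _ hy => hy.2))

variable [IsManifold (𝓡 n) ∞ M]

theorem extendVec_self {p : M} (Y : TangentSpace (𝓡 n) p) : extendVec Y p = Y := by
  have : IsManifold (𝓡 n) 1 M := .of_le (n := ∞) (by simp)
  exact FiberBundle.extend_apply_self _ _

/-- The extension comes from the trivialisation at `p`, so it has constant components in the
preferred chart at `p`. -/
theorem extendVec_chartAt {p : M} (Y : TangentSpace (𝓡 n) p)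
    (hx : x ∈ (chartAt (EuclideanSpace ℝ (Fin n)) p).target) :
    extendVec Y ((chartAt (EuclideanSpace ℝ (Fin n)) p).symm x) =
      mfderiv (𝓡 n) (𝓡 n) (chartAt (EuclideanSpace ℝ (Fin n)) p).symm x Y := by
  have : IsManifold (𝓡 n) 1 M := .of_le (n := ∞) (by simp)
  set e₀ := chartAt (EuclideanSpace ℝ (Fin n)) p with he₀
  have hq : e₀.symm x ∈ e₀.source := e₀.map_target hx
  have h := TangentBundle.symmL_trivializationAt (𝕜 := ℝ) (I := 𝓡 n) (x₀ := p) hq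
  have h₂ : (trivializationAt (EuclideanSpace ℝ (Fin n)) (TangentSpace (𝓡 n)) p ⟨p, Y⟩).2 = Y :=
    congrArg (fun L => L Y) (fderivWithin_extChartAt_comp_extChartAt_symm_range (I := 𝓡 n) (x := p))
  have h₃ : extendVec Y (e₀.symm x) = Bundle.Trivialization.symmL ℝ
      (trivializationAt (EuclideanSpace ℝ (Fin n)) (TangentSpace (𝓡 n)) p) (e₀.symm x) Y := by
    rw [extendVec, FiberBundle.extend, h₂]
    exact (Bundle.Trivialization.symmL_apply (R := ℝ) (trivializationAt (EuclideanSpace ℝ (Fin n))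
      (TangentSpace (𝓡 n)) p) (b := e₀.symm x) hq Y).symm
  rw [h₃, h]
  change mfderivWithin (𝓡 n) (𝓡 n) e₀.symm (Set.range fun z : EuclideanSpace ℝ (Fin n) => z)
    (e₀ (e₀.symm x)) Y = _
  rw [Set.range_id', mfderivWithin_univ]
  have h₄ : ∀ z, z = x → (mfderiv (𝓡 n) (𝓡 n) e₀.symm z Y : EuclideanSpace ℝ (Fin n)) =
      mfderiv (𝓡 n) (𝓡 n) e₀.symm x Y := by rintro _ rfl; rfl
  exact h₄ _ (e₀.right_inv hx)

/-- The representative in the chart `e` of the extension of a tangent vector to a vector field. -/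
def extendRep (e : OpenPartialHomeomorph M (EuclideanSpace ℝ (Fin n))) {p : M}
    (Y : TangentSpace (𝓡 n) p) (y : EuclideanSpace ℝ (Fin n)) : EuclideanSpace ℝ (Fin n) :=
  mfderiv (𝓡 n) (𝓡 n) e (e.symm y) (extendVec Y (e.symm y))

theorem mvfderiv_extendVec {h : M → V} (he : e ∈ IsManifold.maximalAtlas (𝓡 n) ∞ M)
    (hx : x ∈ e.target) (hh : MDifferentiableAt (𝓡 n) 𝓘(ℝ, V) h (e.symm x)) {p : M}
    (Y : TangentSpace (𝓡 n) p) :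
    mvfderiv (𝓡 n) h (e.symm x) (extendVec Y (e.symm x)) =
      fderiv ℝ (h ∘ e.symm) x (extendRep e Y x) := by
  rw [← mvfderiv_mfderiv_symm he hx hh, extendRep]
  exact congrArg (mvfderiv (𝓡 n) h (e.symm x)) (mfderiv_symm_mfderiv he hx _).symm

theorem extendRep_self (he : e ∈ IsManifold.maximalAtlas (𝓡 n) ∞ M) (hx : x ∈ e.target)
    (v : EuclideanSpace ℝ (Fin n)) :
    extendRep e (p := e.symm x) (mfderiv (𝓡 n) (𝓡 n) e.symm x v) x = v := by
  rw [extendRep, extendVec_self]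
  exact mfderiv_mfderiv_symm he hx v

/-- In another chart the constant components are multiplied by the derivative of the smooth
transition map. -/
theorem differentiableAt_extendRep (he : e ∈ IsManifold.maximalAtlas (𝓡 n) ∞ M)
    (hx : x ∈ e.target) (Y : TangentSpace (𝓡 n) (e.symm x)) :
    DifferentiableAt ℝ (extendRep e Y) x := by
  set e₀ := chartAt (EuclideanSpace ℝ (Fin n)) (e.symm x) with he₀
  have he₀' : e₀ ∈ IsManifold.maximalAtlas (𝓡 n) ∞ M := IsManifold.chart_mem_maximalAtlas _
  have hxs : x ∈ e.target ∩ e.symm ⁻¹' e₀.source := ⟨hx, mem_chart_source _ _⟩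
  have h₁ : ContDiffOn ℝ ∞ (fun y => fderiv ℝ (e ∘ e₀.symm) ((e₀ ∘ e.symm) y) Y)
      (e.target ∩ e.symm ⁻¹' e₀.source) := by
    refine ContDiffOn.clm_apply ?_ contDiffOn_const
    refine ((contDiffOn_transition he₀' he).fderiv_of_isOpen (isOpen_transition _ _)
      (by simp)).comp (contDiffOn_transition he he₀') fun y hy => ⟨e₀.map_source hy.2, ?_⟩
    simpa [e₀.left_inv hy.2] using e.map_target hy.1
  refine (differentiableAt_of_contDiffOn (isOpen_transition _ _) h₁ hxs).congr_of_eventuallyEq ?_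
  filter_upwards [(isOpen_transition e e₀).mem_nhds hxs] with y hy
  obtain ⟨z, hz, hzy⟩ : ∃ z ∈ e₀.target, e.symm y = e₀.symm z :=
    ⟨e₀ (e.symm y), e₀.map_source hy.2, (e₀.left_inv hy.2).symm⟩
  have hz' : (e₀ ∘ e.symm) y = z := by simp [hzy, e₀.right_inv hz]
  have hm : MDifferentiableAt (𝓡 n) (𝓡 n) e (e₀.symm z) := by
    rw [← hzy]
    exact (mdifferentiable_of_mem_maximalAtlas he).mdifferentiableAt (e.map_target hy.1)
  rw [hz', extendRep, hzy, extendVec_chartAt Y hz]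
  exact mvfderiv_mfderiv_symm he₀' hz hm Y

end Charts

theorem sum_smul_single {m : ℕ} (v : EuclideanSpace ℝ (Fin m)) :
    ∑ i, v i • EuclideanSpace.single i (1 : ℝ) = v := by
  ext c
  simp [Finset.sum_apply, Pi.single_apply]

theorem fderiv_eq_sum_pdv {V : Type*} [NormedAddCommGroup V] [NormedSpace ℝ V]
    (F : EuclideanSpace ℝ (Fin n) → V) (x v : EuclideanSpace ℝ (Fin n)) :
    fderiv ℝ F x v = ∑ i, v i • pdv i F x := by
  conv_lhs => rw [← sum_smul_single v, map_sum]
  simp only [map_smul, pdv]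

theorem fderiv_clm_apply_apply {E V W : Type*} [NormedAddCommGroup E] [NormedSpace ℝ E]
    [NormedAddCommGroup V] [NormedSpace ℝ V] [NormedAddCommGroup W] [NormedSpace ℝ W]
    {A : E → V →L[ℝ] W} {b : E → V} {x : E} (hA : DifferentiableAt ℝ A x)
    (hb : DifferentiableAt ℝ b x) (u : E) :
    fderiv ℝ (fun y => A y (b y)) x u = fderiv ℝ A x u (b x) + A x (fderiv ℝ b x u) := by
  rw [fderiv_clm_apply hA hb]
  simp [add_comm]

/-! ### Structure equations for arbitrary vectors. -/

namespace IsConormalPair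

variable {Ω : Set (EuclideanSpace ℝ (Fin n))}
  {F : EuclideanSpace ℝ (Fin n) → EuclideanSpace ℝ (Fin (n + 1))}
  {Θ : EuclideanSpace ℝ (Fin n) → EuclideanSpace ℝ (Fin (n + 1)) →L[ℝ] ℝ}
  {x : EuclideanSpace ℝ (Fin n)}

theorem apply_fderiv (h : IsConormalPair Ω F Θ) (hx : x ∈ Ω) (v : EuclideanSpace ℝ (Fin n)) :
    Θ x (fderiv ℝ F x v) = 0 := by
  simp [fderiv_eq_sum_pdv, h.conormal x hx]

theorem differentiableAt₂ (h : IsConormalPair Ω F Θ) (hx : x ∈ Ω) : DifferentiableAt ℝ Θ x :=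
  differentiableAt_of_contDiffOn h.isOpen h.smooth₂ hx

theorem differentiableAt_fderiv₁ (h : IsConormalPair Ω F Θ) (hx : x ∈ Ω) :
    DifferentiableAt ℝ (fderiv ℝ F) x :=
  differentiableAt_of_contDiffOn h.isOpen (h.smooth₁.fderiv_of_isOpen h.isOpen (by simp)) hx

theorem differentiableAt_fderiv₂ (h : IsConormalPair Ω F Θ) (hx : x ∈ Ω) :
    DifferentiableAt ℝ (fderiv ℝ Θ) x :=
  differentiableAt_of_contDiffOn h.isOpen (h.smooth₂.fderiv_of_isOpen h.isOpen (by simp)) hx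

theorem apply_fderiv_fderiv (h : IsConormalPair Ω F Θ) (hx : x ∈ Ω)
    (u v : EuclideanSpace ℝ (Fin n)) :
    Θ x (fderiv ℝ (fderiv ℝ F) x u v) = -(fderiv ℝ Θ x u (fderiv ℝ F x v)) := by
  have e : fderiv ℝ (fun y => Θ y (fderiv ℝ F y v)) x = 0 := by
    have : (fun y => Θ y (fderiv ℝ F y v)) =ᶠ[nhds x] fun _ => 0 :=
      Filter.eventuallyEq_of_mem (h.isOpen.mem_nhds hx) fun y hy => h.apply_fderiv hy v
    rw [this.fderiv_eq]
    simp
  have e₁ := congrArg (fun L => L u) e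
  rw [fderiv_clm_apply_apply (h.differentiableAt₂ hx)
    ((h.differentiableAt_fderiv₁ hx).clm_apply (differentiableAt_const v)),
    fderiv_clm_apply_apply (h.differentiableAt_fderiv₁ hx) (differentiableAt_const v)] at e₁
  simp only [fderiv_fun_const, Pi.zero_apply, _root_.zero_apply, map_zero,
    add_zero] at e₁
  linarith

theorem fderiv_apply_fderiv_symm (h : IsConormalPair Ω F Θ) (hx : x ∈ Ω)
    (u v : EuclideanSpace ℝ (Fin n)) :
    fderiv ℝ Θ x u (fderiv ℝ F x v) = fderiv ℝ Θ x v (fderiv ℝ F x u) := by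
  have h₁ := h.apply_fderiv_fderiv hx u v
  rw [fderiv_fderiv_comm h.isOpen h.smooth₁ hx, h.apply_fderiv_fderiv hx] at h₁
  linarith

theorem fderiv_fderiv_apply_symm (h : IsConormalPair Ω F Θ) (hx : x ∈ Ω)
    (u v w : EuclideanSpace ℝ (Fin n)) :
    fderiv ℝ (fderiv ℝ Θ) x u v (fderiv ℝ F x w) - fderiv ℝ Θ x w (fderiv ℝ (fderiv ℝ F) x u v) =
      fderiv ℝ (fderiv ℝ Θ) x u w (fderiv ℝ F x v)
        - fderiv ℝ Θ x v (fderiv ℝ (fderiv ℝ F) x u w) := by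
  have e : fderiv ℝ (fun y => fderiv ℝ Θ y v (fderiv ℝ F y w)) x =
      fderiv ℝ (fun y => fderiv ℝ Θ y w (fderiv ℝ F y v)) x :=
    Filter.EventuallyEq.fderiv_eq (Filter.eventuallyEq_of_mem (h.isOpen.mem_nhds hx) fun y hy =>
      h.fderiv_apply_fderiv_symm hy v w)
  have e₁ := congrArg (fun L => L u) e
  have hF (v) : DifferentiableAt ℝ (fun y => fderiv ℝ F y v) x :=
    (h.differentiableAt_fderiv₁ hx).clm_apply (differentiableAt_const v)
  have hΘ (v) : DifferentiableAt ℝ (fun y => fderiv ℝ Θ y v) x :=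
    (h.differentiableAt_fderiv₂ hx).clm_apply (differentiableAt_const v)
  rw [fderiv_clm_apply_apply (hΘ v) (hF w), fderiv_clm_apply_apply (hΘ w) (hF v)] at e₁
  simp only [fderiv_clm_apply_apply (h.differentiableAt_fderiv₁ hx) (differentiableAt_const _),
    fderiv_clm_apply_apply (h.differentiableAt_fderiv₂ hx) (differentiableAt_const _),
    fderiv_fun_const, Pi.zero_apply, _root_.zero_apply, map_zero, add_zero] at e₁
  linarith

/-- The kernel of `Θ` is the tangent space: in the adapted frame a vector has transversal component
`Θ w`. The preimage is read off the frame expansion. -/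
theorem exists_fderiv_eq (h : IsConormalPair Ω F Θ) (hx : x ∈ Ω)
    {w : EuclideanSpace ℝ (Fin (n + 1))} (hw : Θ x w = 0) : ∃ v, fderiv ℝ F x v = w := by
  have hg := h.isMetricOn
  obtain ⟨ξ, hξ, hξ'⟩ := exists_transversal (v := fun j => pdv j F x) (θ' := fun i => pdv i Θ x)
    (g := localMetric F Θ x) (h.ne_zero x hx) (h.conormal x hx) (fun i j => by simp [localMetric])
    (h.det x hx)
  refine ⟨WithLp.toLp 2 fun a => -∑ b, (localMetric F Θ x)⁻¹ a b * pdv b Θ x w, ?_⟩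
  ext c
  have e := apply_eq_of_transversal (v := fun j => pdv j F x) (hg.symm x hx) (h.ne_zero x hx)
    (h.conormal x hx) (fun i j => by simp [localMetric]) (h.det x hx) hξ hξ'
    (EuclideanSpace.proj c) w
  rw [hw, zero_mul, add_zero] at e
  refine Eq.trans ?_ e.symm
  rw [fderiv_eq_sum_pdv]
  simp only [PiLp.proj_apply, neg_smul, Finset.sum_neg_distrib, ip, tr₂, PiLp.neg_apply,
    neg_inj, WithLp.ofLp_sum, Finset.sum_apply, PiLp.smul_apply, smul_eq_mul, Finset.sum_mul]
  exact Finset.sum_congr rfl fun _ _ => Finset.sum_congr rfl fun _ _ => by ring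

end IsConormalPair

/-! ### Metric, transversal field and induced connection in a chart. -/

section Manifold

variable {M : Type*} [TopologicalSpace M] [ChartedSpace (EuclideanSpace ℝ (Fin n)) M]
  {f : M → EuclideanSpace ℝ (Fin (n + 1))} {Ξ : M → EuclideanSpace ℝ (Fin (n + 1)) →L[ℝ] ℝ}
  {e : OpenPartialHomeomorph M (EuclideanSpace ℝ (Fin n))} {x : EuclideanSpace ℝ (Fin n)}

theorem exists_mfderiv_symm_eq (he : e ∈ IsManifold.maximalAtlas (𝓡 n) ∞ M) (hx : x ∈ e.target)
    (X : TangentSpace (𝓡 n) (e.symm x)) :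
    ∃ v : EuclideanSpace ℝ (Fin n), mfderiv (𝓡 n) (𝓡 n) e.symm x v = X :=
  ⟨_, mfderiv_symm_mfderiv he hx X⟩

namespace IsCoNormalisation

theorem mdifferentiableAt_f (h : IsCoNormalisation f Ξ) (p : M) :
    MDifferentiableAt (𝓡 n) 𝓘(ℝ, EuclideanSpace ℝ (Fin (n + 1))) f p :=
  h.smooth_f.mdifferentiable (by simp) p

theorem mdifferentiableAt_Ξ (h : IsCoNormalisation f Ξ) (p : M) :
    MDifferentiableAt (𝓡 n) 𝓘(ℝ, EuclideanSpace ℝ (Fin (n + 1)) →L[ℝ] ℝ) Ξ p :=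
  h.smooth_Ξ.mdifferentiable (by simp) p

theorem mvfderiv_f (h : IsCoNormalisation f Ξ) (he : e ∈ IsManifold.maximalAtlas (𝓡 n) ∞ M)
    (hx : x ∈ e.target) (v : EuclideanSpace ℝ (Fin n)) :
    mvfderiv (𝓡 n) f (e.symm x) (mfderiv (𝓡 n) (𝓡 n) e.symm x v) = fderiv ℝ (f ∘ e.symm) x v :=
  mvfderiv_mfderiv_symm he hx (h.mdifferentiableAt_f _) v

theorem mvfderiv_Ξ (h : IsCoNormalisation f Ξ) (he : e ∈ IsManifold.maximalAtlas (𝓡 n) ∞ M)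
    (hx : x ∈ e.target) (v : EuclideanSpace ℝ (Fin n)) :
    mvfderiv (𝓡 n) Ξ (e.symm x) (mfderiv (𝓡 n) (𝓡 n) e.symm x v) = fderiv ℝ (Ξ ∘ e.symm) x v :=
  mvfderiv_mfderiv_symm he hx (h.mdifferentiableAt_Ξ _) v

theorem affineMetric_apply (h : IsCoNormalisation f Ξ)
    (he : e ∈ IsManifold.maximalAtlas (𝓡 n) ∞ M) (hx : x ∈ e.target)
    (v w : EuclideanSpace ℝ (Fin n)) :
    affineMetric f Ξ (e.symm x) (mfderiv (𝓡 n) (𝓡 n) e.symm x v)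
      (mfderiv (𝓡 n) (𝓡 n) e.symm x w) =
      -(fderiv ℝ (Ξ ∘ e.symm) x v (fderiv ℝ (f ∘ e.symm) x w)) := by
  rw [affineMetric, h.mvfderiv_Ξ he hx, h.mvfderiv_f he hx]

theorem comp₂_affineMetric (h : IsCoNormalisation f Ξ)
    (he : e ∈ IsManifold.maximalAtlas (𝓡 n) ∞ M) (hx : x ∈ e.target) :
    comp₂ (affineMetric f Ξ) e x = localMetric (f ∘ e.symm) (Ξ ∘ e.symm) x := by
  ext i j
  exact h.affineMetric_apply he hx _ _

theorem isConormalPair (h : IsCoNormalisation f Ξ) (he : e ∈ IsManifold.maximalAtlas (𝓡 n) ∞ M) :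
    IsConormalPair e.target (f ∘ e.symm) (Ξ ∘ e.symm) where
  isOpen := e.open_target
  smooth₁ := contDiffOn_comp_symm he h.smooth_f
  smooth₂ := contDiffOn_comp_symm he h.smooth_Ξ
  ne_zero _ _ := h.ne_zero _
  conormal x hx i := by
    rw [pdv, ← h.mvfderiv_f he hx]
    exact h.conormal _ _
  det x hx := by
    rw [isUnit_iff_ne_zero]
    intro h0
    obtain ⟨c, hc, hcz⟩ := Matrix.exists_vecMul_eq_zero_iff.2 h0
    have hv : (mfderiv (𝓡 n) (𝓡 n) e.symm x (WithLp.toLp 2 c) : TangentSpace (𝓡 n) (e.symm x)) =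
        0 := by
      refine h.nondegenerate _ _ fun Y => ?_
      obtain ⟨w, rfl⟩ := exists_mfderiv_symm_eq he hx Y
      rw [h.affineMetric_apply he hx, fderiv_eq_sum_pdv, fderiv_eq_sum_pdv]
      have := congrArg (fun r => r ⬝ᵥ w.ofLp) hcz
      simp only [zero_dotProduct] at this
      rw [← this]
      simp only [dotProduct, Matrix.vecMul, localMetric, Matrix.of_apply, Finset.sum_mul, map_sum,
        map_smul, _root_.sum_apply, _root_.smul_apply, smul_eq_mul,
        mul_neg, neg_mul, Finset.sum_neg_distrib, neg_inj, Finset.mul_sum]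
      exact Finset.sum_congr rfl fun _ _ => Finset.sum_congr rfl fun _ _ => by ring
    have h₁ := mfderiv_mfderiv_symm he hx (WithLp.toLp 2 c)
    rw [hv, map_zero] at h₁
    exact hc (congrArg WithLp.ofLp h₁).symm

theorem affineMetric_linear (f : M → EuclideanSpace ℝ (Fin (n + 1)))
    (Ξ : M → EuclideanSpace ℝ (Fin (n + 1)) →L[ℝ] ℝ) (p : M) (X : TangentSpace (𝓡 n) p) :
    IsLinearMap ℝ (affineMetric f Ξ p X) :=
  ⟨fun Y Z => by simp [affineMetric]; ring, fun c Y => by simp [affineMetric]⟩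

variable [IsManifold (𝓡 n) ∞ M]

theorem transversal_spec (h : IsCoNormalisation f Ξ) (p : M) :
    Ξ p (transversal Ξ p) = 1 ∧ ∀ X, mvfderiv (𝓡 n) Ξ p X (transversal Ξ p) = 0 := by
  refine Classical.epsilon_spec (p := fun v => Ξ p v = 1 ∧ ∀ X, mvfderiv (𝓡 n) Ξ p X v = 0) ?_
  obtain ⟨e, he, hp⟩ : ∃ e ∈ IsManifold.maximalAtlas (𝓡 n) ∞ M, p ∈ e.source :=
    ⟨_, IsManifold.chart_mem_maximalAtlas p, mem_chart_source _ p⟩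
  obtain ⟨x, hx, rfl⟩ : ∃ x ∈ e.target, p = e.symm x := ⟨e p, e.map_source hp, (e.left_inv hp).symm⟩
  have hc := h.isConormalPair he
  obtain ⟨ξ, hξ, hξ'⟩ := exists_transversal (v := fun j => pdv j (f ∘ e.symm) x)
    (θ' := fun i => pdv i (Ξ ∘ e.symm) x) (g := localMetric (f ∘ e.symm) (Ξ ∘ e.symm) x)
    (hc.ne_zero x hx) (hc.conormal x hx) (fun i j => by simp [localMetric]) (hc.det x hx)
  refine ⟨ξ, hξ, fun X => ?_⟩
  obtain ⟨v, rfl⟩ := exists_mfderiv_symm_eq he hx X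
  rw [h.mvfderiv_Ξ he hx, fderiv_eq_sum_pdv]
  simp [hξ']

theorem mvfderiv_mvfderiv_extendVec {V : Type*} [NormedAddCommGroup V] [NormedSpace ℝ V]
    {k : M → V} (he : e ∈ IsManifold.maximalAtlas (𝓡 n) ∞ M) (hx : x ∈ e.target)
    (hk : ContMDiff (𝓡 n) 𝓘(ℝ, V) ∞ k) (u v : EuclideanSpace ℝ (Fin n)) :
    mvfderiv (𝓡 n) (fun q => mvfderiv (𝓡 n) k q
        (extendVec (p := e.symm x) (mfderiv (𝓡 n) (𝓡 n) e.symm x v) q)) (e.symm x)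
        (mfderiv (𝓡 n) (𝓡 n) e.symm x u) =
      fderiv ℝ (fderiv ℝ (k ∘ e.symm)) x u v + fderiv ℝ (k ∘ e.symm) x
        (fderiv ℝ (extendRep e (p := e.symm x) (mfderiv (𝓡 n) (𝓡 n) e.symm x v)) x u) := by
  set Y : TangentSpace (𝓡 n) (e.symm x) := mfderiv (𝓡 n) (𝓡 n) e.symm x v with hY
  have hK := contDiffOn_comp_symm he hk
  have hd : DifferentiableAt ℝ (fderiv ℝ (k ∘ e.symm)) x :=
    differentiableAt_of_contDiffOn e.open_target (hK.fderiv_of_isOpen e.open_target (by simp)) hx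
  have hc := differentiableAt_extendRep he hx Y
  have hev : ((fun q => mvfderiv (𝓡 n) k q (extendVec Y q)) ∘ e.symm) =ᶠ[nhds x]
      fun y => fderiv ℝ (k ∘ e.symm) y (extendRep e Y y) :=
    Filter.eventuallyEq_of_mem (e.open_target.mem_nhds hx) fun y hy =>
      mvfderiv_extendVec he hy (hk.mdifferentiable (by simp) _) Y
  rw [mvfderiv_mfderiv_symm he hx (mdifferentiableAt_of_comp_symm he hx
    ((hd.clm_apply hc).congr_of_eventuallyEq hev)), hev.fderiv_eq, fderiv_clm_apply_apply hd hc,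
    hY, extendRep_self he hx]

/-- The choice in `inducedConnection` is meaningful since `D_X (df Y) - G(X, Y) ξ` is annihilated by
`Ξ`, hence tangent to the hypersurface. -/
theorem inducedConnection_spec (h : IsCoNormalisation f Ξ)
    (he : e ∈ IsManifold.maximalAtlas (𝓡 n) ∞ M) (hx : x ∈ e.target)
    (u v : EuclideanSpace ℝ (Fin n)) :
    mvfderiv (𝓡 n) f (e.symm x) (inducedConnection f Ξ (e.symm x)
        (mfderiv (𝓡 n) (𝓡 n) e.symm x u)
        (extendVec (p := e.symm x) (mfderiv (𝓡 n) (𝓡 n) e.symm x v))) =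
      fderiv ℝ (fderiv ℝ (f ∘ e.symm)) x u v + fderiv ℝ (f ∘ e.symm) x
        (fderiv ℝ (extendRep e (p := e.symm x) (mfderiv (𝓡 n) (𝓡 n) e.symm x v)) x u)
      + fderiv ℝ (Ξ ∘ e.symm) x u (fderiv ℝ (f ∘ e.symm) x v) • transversal Ξ (e.symm x) := by
  have hc := h.isConormalPair he
  have hG := h.affineMetric_apply he hx u v
  have hD := mvfderiv_mvfderiv_extendVec he hx h.smooth_f u v
  set Y : TangentSpace (𝓡 n) (e.symm x) := mfderiv (𝓡 n) (𝓡 n) e.symm x v with hY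
  set X : TangentSpace (𝓡 n) (e.symm x) := mfderiv (𝓡 n) (𝓡 n) e.symm x u with hX
  have hex : ∃ V : TangentSpace (𝓡 n) (e.symm x),
      mvfderiv (𝓡 n) (fun q => mvfderiv (𝓡 n) f q (extendVec Y q)) (e.symm x) X =
        mvfderiv (𝓡 n) f (e.symm x) V
          + affineMetric f Ξ (e.symm x) X Y • transversal Ξ (e.symm x) := by
    obtain ⟨w, hw⟩ := hc.exists_fderiv_eq hx
      (w := mvfderiv (𝓡 n) (fun q => mvfderiv (𝓡 n) f q (extendVec Y q)) (e.symm x) X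
        - affineMetric f Ξ (e.symm x) X Y • transversal Ξ (e.symm x)) (by
      have ht := (h.transversal_spec (e.symm x)).1
      rw [hD, hG]
      simp only [Function.comp_apply, map_sub, map_add, map_smul, ht, smul_eq_mul, mul_one]
      have e₁ := hc.apply_fderiv_fderiv hx u v
      have e₂ := hc.apply_fderiv hx (fderiv ℝ (extendRep e Y) x u)
      simp only [Function.comp_apply] at e₁ e₂
      rw [e₁, e₂]
      ring)
    refine ⟨mfderiv (𝓡 n) (𝓡 n) e.symm x w, ?_⟩
    rw [h.mvfderiv_f he hx, hw]
    abel
  have hs : mvfderiv (𝓡 n) f (e.symm x) (inducedConnection f Ξ (e.symm x) X (extendVec Y)) =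
      mvfderiv (𝓡 n) (fun q => mvfderiv (𝓡 n) f q (extendVec Y q)) (e.symm x) X
        - affineMetric f Ξ (e.symm x) X Y • transversal Ξ (e.symm x) := by
    simp only [inducedConnection, extendVec_self]
    exact eq_sub_of_add_eq (Classical.epsilon_spec hex).symm
  rw [hs, hD, hG, neg_smul, sub_neg_eq_add]

end IsCoNormalisation

end Manifold

/-! ### The cubic form in a chart and its tensorial properties. -/

section Manifold

variable {M : Type*} [TopologicalSpace M] [ChartedSpace (EuclideanSpace ℝ (Fin n)) M]
  [IsManifold (𝓡 n) ∞ M]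
  {f : M → EuclideanSpace ℝ (Fin (n + 1))} {Ξ : M → EuclideanSpace ℝ (Fin (n + 1)) →L[ℝ] ℝ}
  {e : OpenPartialHomeomorph M (EuclideanSpace ℝ (Fin n))} {x : EuclideanSpace ℝ (Fin n)}

theorem exists_chart (p : M) : ∃ e ∈ IsManifold.maximalAtlas (𝓡 n) ∞ M, ∃ x ∈ e.target,
    p = e.symm x := by
  set e := chartAt (EuclideanSpace ℝ (Fin n)) p with he
  have hp : p ∈ e.source := mem_chart_source _ p
  exact ⟨e, IsManifold.chart_mem_maximalAtlas p, e p, e.map_source hp, (e.left_inv hp).symm⟩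

namespace IsCoNormalisation

theorem affineMetric_symm (h : IsCoNormalisation f Ξ) (p : M) (X Y : TangentSpace (𝓡 n) p) :
    affineMetric f Ξ p X Y = affineMetric f Ξ p Y X := by
  obtain ⟨e, he, x, hx, rfl⟩ := exists_chart (n := n) p
  obtain ⟨u, rfl⟩ := exists_mfderiv_symm_eq he hx X
  obtain ⟨v, rfl⟩ := exists_mfderiv_symm_eq he hx Y
  rw [h.affineMetric_apply he hx, h.affineMetric_apply he hx,
    (h.isConormalPair he).fderiv_apply_fderiv_symm hx]

/-- The derivatives of the extended vector fields in `X (G(Y, Z))` cancel against those in the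
induced connection, and the `ξ`-components vanish because `D Ξ` annihilates `ξ`. So the cubic is
tensorial, and equal to its coordinate expression. -/
theorem cubicForm_apply (h : IsCoNormalisation f Ξ)
    (he : e ∈ IsManifold.maximalAtlas (𝓡 n) ∞ M) (hx : x ∈ e.target)
    (u v w : EuclideanSpace ℝ (Fin n)) :
    cubicForm f Ξ (e.symm x) (mfderiv (𝓡 n) (𝓡 n) e.symm x u) (mfderiv (𝓡 n) (𝓡 n) e.symm x v)
      (mfderiv (𝓡 n) (𝓡 n) e.symm x w) =
      1 / 2 * (fderiv ℝ (fderiv ℝ (Ξ ∘ e.symm)) x u v (fderiv ℝ (f ∘ e.symm) x w)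
        - fderiv ℝ (Ξ ∘ e.symm) x w (fderiv ℝ (fderiv ℝ (f ∘ e.symm)) x u v)) := by
  have hc := h.isConormalPair he
  have hIv := h.inducedConnection_spec he hx u v
  have hIw := h.inducedConnection_spec he hx u w
  have hYs := extendRep_self he hx v
  have hZs := extendRep_self he hx w
  have hcv := differentiableAt_extendRep he hx (mfderiv (𝓡 n) (𝓡 n) e.symm x v)
  have hcw := differentiableAt_extendRep he hx (mfderiv (𝓡 n) (𝓡 n) e.symm x w)
  have hΞv := h.mvfderiv_Ξ he hx v
  have hΞw := h.mvfderiv_Ξ he hx w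
  set X : TangentSpace (𝓡 n) (e.symm x) := mfderiv (𝓡 n) (𝓡 n) e.symm x u with hX
  set Y : TangentSpace (𝓡 n) (e.symm x) := mfderiv (𝓡 n) (𝓡 n) e.symm x v with hY
  set Z : TangentSpace (𝓡 n) (e.symm x) := mfderiv (𝓡 n) (𝓡 n) e.symm x w with hZ
  have hF := hc.differentiableAt_fderiv₁ hx
  have hΘ := hc.differentiableAt_fderiv₂ hx
  have hev : ((fun q => affineMetric f Ξ q (extendVec Y q) (extendVec Z q)) ∘ e.symm) =ᶠ[nhds x]
      fun y => -(fderiv ℝ (Ξ ∘ e.symm) y (extendRep e Y y)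
        (fderiv ℝ (f ∘ e.symm) y (extendRep e Z y))) :=
    Filter.eventuallyEq_of_mem (e.open_target.mem_nhds hx) fun y hy => by
      simp only [Function.comp_apply, affineMetric]
      rw [mvfderiv_extendVec he hy (h.mdifferentiableAt_Ξ _),
        mvfderiv_extendVec he hy (h.mdifferentiableAt_f _)]
  have hG : mvfderiv (𝓡 n) (fun q => affineMetric f Ξ q (extendVec Y q) (extendVec Z q))
      (e.symm x) X =
      -(fderiv ℝ (fderiv ℝ (Ξ ∘ e.symm)) x u v (fderiv ℝ (f ∘ e.symm) x w)
        + fderiv ℝ (Ξ ∘ e.symm) x (fderiv ℝ (extendRep e Y) x u) (fderiv ℝ (f ∘ e.symm) x w)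
        + fderiv ℝ (Ξ ∘ e.symm) x v (fderiv ℝ (fderiv ℝ (f ∘ e.symm)) x u w)
        + fderiv ℝ (Ξ ∘ e.symm) x v (fderiv ℝ (f ∘ e.symm) x (fderiv ℝ (extendRep e Z) x u))) := by
    have hd := (hΘ.clm_apply hcv).clm_apply (hF.clm_apply hcw)
    rw [hX, mvfderiv_mfderiv_symm he hx (mdifferentiableAt_of_comp_symm he hx
      (hd.fun_neg.congr_of_eventuallyEq hev)), hev.fderiv_eq, fderiv_fun_neg,
      neg_apply, fderiv_clm_apply_apply (hΘ.clm_apply hcv) (hF.clm_apply hcw),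
      fderiv_clm_apply_apply hΘ hcv, fderiv_clm_apply_apply hF hcw, hYs, hZs]
    simp only [map_add, add_apply]
    ring
  have hξ := (h.transversal_spec (e.symm x)).2
  have hξv := hξ Y
  have hξw := hξ Z
  rw [hΞv] at hξv
  rw [hΞw] at hξw
  rw [cubicForm, nablaMetric, hG, h.affineMetric_symm _ _ Z, affineMetric, affineMetric, hIv, hIw,
    hΞv, hΞw]
  simp only [map_add, map_smul, hξv, hξw, smul_eq_mul, mul_zero, add_zero]
  rw [hc.fderiv_apply_fderiv_symm hx w]
  ring

theorem comp₃_cubicForm (h : IsCoNormalisation f Ξ)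
    (he : e ∈ IsManifold.maximalAtlas (𝓡 n) ∞ M) (hx : x ∈ e.target) :
    comp₃ (cubicForm f Ξ) e x = localCubic (f ∘ e.symm) (Ξ ∘ e.symm) x := by
  have hc := h.isConormalPair he
  funext i j k
  rw [localCubic, pdv_pdv hc.isOpen hc.smooth₁ hx, pdv_pdv hc.isOpen hc.smooth₂ hx]
  exact h.cubicForm_apply he hx _ _ _

theorem cubicForm_symm₁₂ (h : IsCoNormalisation f Ξ) (p : M) (X Y Z : TangentSpace (𝓡 n) p) :
    cubicForm f Ξ p X Y Z = cubicForm f Ξ p Y X Z := by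
  obtain ⟨e, he, x, hx, rfl⟩ := exists_chart (n := n) p
  obtain ⟨u, rfl⟩ := exists_mfderiv_symm_eq he hx X
  obtain ⟨v, rfl⟩ := exists_mfderiv_symm_eq he hx Y
  obtain ⟨w, rfl⟩ := exists_mfderiv_symm_eq he hx Z
  have hc := h.isConormalPair he
  rw [h.cubicForm_apply he hx, h.cubicForm_apply he hx, fderiv_fderiv_comm hc.isOpen hc.smooth₁ hx,
    fderiv_fderiv_comm hc.isOpen hc.smooth₂ hx]

theorem cubicForm_symm₂₃ (h : IsCoNormalisation f Ξ) (p : M) (X Y Z : TangentSpace (𝓡 n) p) :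
    cubicForm f Ξ p X Y Z = cubicForm f Ξ p X Z Y := by
  obtain ⟨e, he, x, hx, rfl⟩ := exists_chart (n := n) p
  obtain ⟨u, rfl⟩ := exists_mfderiv_symm_eq he hx X
  obtain ⟨v, rfl⟩ := exists_mfderiv_symm_eq he hx Y
  obtain ⟨w, rfl⟩ := exists_mfderiv_symm_eq he hx Z
  rw [h.cubicForm_apply he hx, h.cubicForm_apply he hx,
    (h.isConormalPair he).fderiv_fderiv_apply_symm hx]

theorem cubicForm_linear (h : IsCoNormalisation f Ξ) (p : M) (X Y : TangentSpace (𝓡 n) p) :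
    IsLinearMap ℝ (cubicForm f Ξ p X Y) := by
  obtain ⟨e, he, x, hx, rfl⟩ := exists_chart (n := n) p
  obtain ⟨u, rfl⟩ := exists_mfderiv_symm_eq he hx X
  obtain ⟨v, rfl⟩ := exists_mfderiv_symm_eq he hx Y
  constructor
  · intro Z W
    obtain ⟨w, rfl⟩ := exists_mfderiv_symm_eq he hx Z
    obtain ⟨z, rfl⟩ := exists_mfderiv_symm_eq he hx W
    have e₁ := h.cubicForm_apply he hx u v (w + z)
    have e₂ : mfderiv (𝓡 n) (𝓡 n) e.symm x (w + z) = mfderiv (𝓡 n) (𝓡 n) e.symm x w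
      + mfderiv (𝓡 n) (𝓡 n) e.symm x z := (mfderiv (𝓡 n) (𝓡 n) e.symm x).map_add w z
    rw [← e₂, e₁, h.cubicForm_apply he hx, h.cubicForm_apply he hx]
    simp only [map_add, add_apply]
    ring
  · intro c Z
    obtain ⟨w, rfl⟩ := exists_mfderiv_symm_eq he hx Z
    have e₁ := h.cubicForm_apply he hx u v (c • w)
    have e₂ : mfderiv (𝓡 n) (𝓡 n) e.symm x (c • w) = c • mfderiv (𝓡 n) (𝓡 n) e.symm x w :=
      (mfderiv (𝓡 n) (𝓡 n) e.symm x).map_smul c w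
    rw [← e₂, e₁, h.cubicForm_apply he hx]
    simp only [map_smul, _root_.smul_apply, smul_eq_mul]
    ring

end IsCoNormalisation

end Manifold

/-! ### Change of frame. -/

section Frames

open Matrix

/-- The matrix whose columns are the given vectors. -/
def frameMatrix (v : Fin n → EuclideanSpace ℝ (Fin n)) : Matrix (Fin n) (Fin n) ℝ :=
  Matrix.of fun a i => v i a

theorem gram_frame {β : EuclideanSpace ℝ (Fin n) → EuclideanSpace ℝ (Fin n) → ℝ}
    (h₁ : ∀ X, IsLinearMap ℝ (β X)) (h₂ : ∀ Y, IsLinearMap ℝ fun X => β X Y)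
    (v : Fin n → EuclideanSpace ℝ (Fin n)) :
    (Matrix.of fun i j => β (v i) (v j)) = (frameMatrix v)ᵀ *
      (Matrix.of fun i j => β (EuclideanSpace.single i 1) (EuclideanSpace.single j 1)) *
      frameMatrix v := by
  ext i j
  have e₁ (X) : β X (v j) = ∑ b, v j b * β X (EuclideanSpace.single b 1) := by
    have := congrArg ((h₁ X).mk' (β X)) (sum_smul_single (v j))
    rw [map_sum] at this
    simpa using this.symm
  have e₂ (Y) : β (v i) Y = ∑ a, v i a * β (EuclideanSpace.single a 1) Y := by
    have := congrArg ((h₂ Y).mk' fun X => β X Y) (sum_smul_single (v i))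
    rw [map_sum] at this
    simpa using this.symm
  simp only [Matrix.of_apply, Matrix.mul_apply, Matrix.transpose_apply, frameMatrix, e₁ (v i), e₂,
    Finset.mul_sum, Finset.sum_mul]
  exact Finset.sum_congr rfl fun _ _ => Finset.sum_congr rfl fun _ _ => by ring

theorem tr₂_eq_trace (g B : Matrix (Fin n) (Fin n) ℝ) :
    tr₂ g (fun i j => B i j) = (g⁻¹ * Bᵀ).trace := by
  simp [tr₂, Matrix.trace, Matrix.mul_apply]

/-- Traces on the manifold are taken in the standard basis of the model space, those in a chart in
the coordinate frame. Both Gram matrices change by `Jᵀ · J`, and the trace is cyclic. -/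
theorem tr₂_frame {γ β : EuclideanSpace ℝ (Fin n) → EuclideanSpace ℝ (Fin n) → ℝ}
    (h₁ : ∀ X, IsLinearMap ℝ (γ X)) (h₂ : ∀ Y, IsLinearMap ℝ fun X => γ X Y)
    (h₃ : ∀ X, IsLinearMap ℝ (β X)) (h₄ : ∀ Y, IsLinearMap ℝ fun X => β X Y)
    (v : Fin n → EuclideanSpace ℝ (Fin n))
    (hd : IsUnit (Matrix.of fun i j => γ (v i) (v j)).det) :
    tr₂ (Matrix.of fun i j => γ (v i) (v j)) (fun i j => β (v i) (v j)) =
      tr₂ (Matrix.of fun i j => γ (EuclideanSpace.single i 1) (EuclideanSpace.single j 1))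
        fun i j => β (EuclideanSpace.single i 1) (EuclideanSpace.single j 1) := by
  have hB := gram_frame h₃ h₄ v
  change tr₂ _ (fun i j => (Matrix.of fun i j => β (v i) (v j)) i j) = tr₂ _
    (fun i j => (Matrix.of fun i j =>
      β (EuclideanSpace.single i 1) (EuclideanSpace.single j 1)) i j)
  rw [tr₂_eq_trace, tr₂_eq_trace, hB]
  rw [gram_frame h₁ h₂ v] at hd ⊢
  set J := frameMatrix v
  have hJ : IsUnit J.det := by
    rw [Matrix.det_mul] at hd
    exact isUnit_of_mul_isUnit_right hd
  have hJ' : IsUnit Jᵀ.det := by rwa [Matrix.det_transpose]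
  simp only [Matrix.mul_inv_rev, Matrix.transpose_mul, Matrix.transpose_transpose]
  rw [Matrix.mul_assoc, Matrix.trace_mul_comm]
  simp only [Matrix.mul_assoc, Matrix.mul_nonsing_inv _ hJ, Matrix.mul_one]
  rw [← Matrix.mul_assoc Jᵀ⁻¹, Matrix.nonsing_inv_mul _ hJ', Matrix.one_mul]

/-- The change of frame acts on the coframe by the block matrix with blocks `1` and the transpose of
`frameMatrix v`. -/
theorem det_coframeMatrix_frame (θ : EuclideanSpace ℝ (Fin (n + 1)) →L[ℝ] ℝ)
    (A : EuclideanSpace ℝ (Fin n) →L[ℝ] EuclideanSpace ℝ (Fin (n + 1)) →L[ℝ] ℝ)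
    (v : Fin n → EuclideanSpace ℝ (Fin n)) :
    (coframeMatrix θ fun i => A (v i)).det = (frameMatrix v).det *
      (coframeMatrix θ fun i => A (EuclideanSpace.single i 1)).det := by
  set K : Matrix (Fin (n + 1)) (Fin (n + 1)) ℝ := Matrix.of fun a b =>
    Fin.cases (Fin.cases 1 (fun _ => 0) b) (fun i => Fin.cases 0 (fun c => v i c) b) a with hK
  have hdet : K.det = (frameMatrix v).det := by
    rw [Matrix.det_succ_row_zero, Fin.sum_univ_succ]
    simp only [hK, Matrix.of_apply, Fin.cases_zero, Fin.cases_succ, mul_zero, zero_mul,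
      Finset.sum_const_zero, add_zero, Fin.val_zero, pow_zero, one_mul]
    rw [← Matrix.det_transpose]
    congr 1
  rw [← hdet, ← Matrix.det_mul]
  congr 1
  ext a c
  rw [Matrix.mul_apply, Fin.sum_univ_succ]
  refine Fin.cases ?_ (fun i => ?_) a
  · simp [hK, coframeMatrix]
  · have := congrArg (fun w => A w (EuclideanSpace.single c 1)) (sum_smul_single (v i))
    simp only [map_sum, map_smul, _root_.sum_apply, _root_.smul_apply, smul_eq_mul] at this
    simp [hK, coframeMatrix, this]

end Frames

/-! ### Trace and trace-free part of the cubic on the manifold. -/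

section Manifold

variable {M : Type*} [TopologicalSpace M] [ChartedSpace (EuclideanSpace ℝ (Fin n)) M]
  [IsManifold (𝓡 n) ∞ M]
  {f : M → EuclideanSpace ℝ (Fin (n + 1))} {Ξ : M → EuclideanSpace ℝ (Fin (n + 1)) →L[ℝ] ℝ}
  {e : OpenPartialHomeomorph M (EuclideanSpace ℝ (Fin n))} {x : EuclideanSpace ℝ (Fin n)}

namespace IsCoNormalisation

theorem affineMetric_linear_left (h : IsCoNormalisation f Ξ) (p : M) (Y : TangentSpace (𝓡 n) p) :
    IsLinearMap ℝ fun X => affineMetric f Ξ p X Y := by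
  simp only [h.affineMetric_symm p _ Y]
  exact affineMetric_linear f Ξ p Y

theorem cubicForm_linear_mid (h : IsCoNormalisation f Ξ) (p : M) (X Z : TangentSpace (𝓡 n) p) :
    IsLinearMap ℝ fun Y => cubicForm f Ξ p X Y Z := by
  simp only [h.cubicForm_symm₂₃ p X _ Z]
  exact h.cubicForm_linear p X Z

theorem cubicForm_linear_left (h : IsCoNormalisation f Ξ) (p : M) (Y Z : TangentSpace (𝓡 n) p) :
    IsLinearMap ℝ fun X => cubicForm f Ξ p X Y Z := by
  simp only [h.cubicForm_symm₁₂ p _ Y]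
  exact h.cubicForm_linear_mid p Y Z

theorem trAt_eq (h : IsCoNormalisation f Ξ) (he : e ∈ IsManifold.maximalAtlas (𝓡 n) ∞ M)
    (hx : x ∈ e.target)
    {B : TangentSpace (𝓡 n) (e.symm x) → TangentSpace (𝓡 n) (e.symm x) → ℝ}
    (h₁ : ∀ X, IsLinearMap ℝ (B X)) (h₂ : ∀ Y, IsLinearMap ℝ fun X => B X Y) :
    trAt (affineMetric f Ξ) (e.symm x) B = tr₂ (localMetric (f ∘ e.symm) (Ξ ∘ e.symm) x)
      fun i j => B (coordVec e x i) (coordVec e x j) := by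
  have hd := (h.isConormalPair he).det x hx
  rw [← h.comp₂_affineMetric he hx] at hd ⊢
  exact (tr₂_frame (affineMetric_linear f Ξ (e.symm x)) (h.affineMetric_linear_left (e.symm x))
    h₁ h₂ (fun i => coordVec e x i) hd).symm

theorem comp₁_cubicTrace (h : IsCoNormalisation f Ξ)
    (he : e ∈ IsManifold.maximalAtlas (𝓡 n) ∞ M) (hx : x ∈ e.target) :
    comp₁ (cubicTrace f Ξ) e x = localTrace (f ∘ e.symm) (Ξ ∘ e.symm) x := by
  funext i
  rw [comp₁, cubicTrace, h.trAt_eq he hx (h.cubicForm_linear _ _) (h.cubicForm_linear_mid _ _),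
    localTrace, ← h.comp₃_cubicForm he hx]
  rfl

theorem comp₃_cubicTraceFree (h : IsCoNormalisation f Ξ)
    (he : e ∈ IsManifold.maximalAtlas (𝓡 n) ∞ M) (hx : x ∈ e.target) :
    comp₃ (cubicTraceFree f Ξ) e x = localTraceFree (f ∘ e.symm) (Ξ ∘ e.symm) x := by
  funext i j k
  rw [localTraceFree, ← h.comp₃_cubicForm he hx, ← h.comp₁_cubicTrace he hx,
    ← h.comp₂_affineMetric he hx]
  rfl

theorem cubicTrace_linear (h : IsCoNormalisation f Ξ) (p : M) :
    IsLinearMap ℝ (cubicTrace f Ξ p) := by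
  constructor
  · intro X Y
    have e : cubicForm f Ξ p (X + Y) =
        fun Z W => cubicForm f Ξ p X Z W + cubicForm f Ξ p Y Z W := by
      funext Z W
      exact (h.cubicForm_linear_left p Z W).map_add X Y
    simp only [cubicTrace, trAt, e, tr₂_add, mul_add]
  · intro c X
    have e : cubicForm f Ξ p (c • X) = fun Z W => c * cubicForm f Ξ p X Z W := by
      funext Z W
      exact (h.cubicForm_linear_left p Z W).map_smul c X
    simp only [cubicTrace, trAt, e, tr₂_const_mul, smul_eq_mul]
    ring

theorem cubicTraceFree_symm₁₂ (h : IsCoNormalisation f Ξ) (p : M)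
    (X Y Z : TangentSpace (𝓡 n) p) :
    cubicTraceFree f Ξ p X Y Z = cubicTraceFree f Ξ p Y X Z := by
  rw [cubicTraceFree, cubicTraceFree, h.cubicForm_symm₁₂, h.affineMetric_symm p Y X]
  ring

theorem cubicTraceFree_symm₂₃ (h : IsCoNormalisation f Ξ) (p : M)
    (X Y Z : TangentSpace (𝓡 n) p) :
    cubicTraceFree f Ξ p X Y Z = cubicTraceFree f Ξ p X Z Y := by
  rw [cubicTraceFree, cubicTraceFree, h.cubicForm_symm₂₃, h.affineMetric_symm p Z Y]
  ring

theorem cubicTraceFree_linear (h : IsCoNormalisation f Ξ) (p : M) (X Y : TangentSpace (𝓡 n) p) :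
    IsLinearMap ℝ (cubicTraceFree f Ξ p X Y) := by
  constructor
  · intro Z W
    simp only [cubicTraceFree, (h.cubicForm_linear p X Y).map_add, (h.cubicTrace_linear p).map_add,
      (affineMetric_linear f Ξ p _).map_add]
    ring
  · intro c Z
    simp only [cubicTraceFree, (h.cubicForm_linear p X Y).map_smul,
      (h.cubicTrace_linear p).map_smul, (affineMetric_linear f Ξ p _).map_smul, smul_eq_mul]
    ring

theorem trAt_cubicTraceFree (h : IsCoNormalisation f Ξ) (p : M) (X : TangentSpace (𝓡 n) p) :
    trAt (affineMetric f Ξ) p (cubicTraceFree f Ξ p X) = 0 := by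
  obtain ⟨e, he, x, hx, rfl⟩ := exists_chart (n := n) p
  have hmid (X Z : TangentSpace (𝓡 n) (e.symm x)) :
      IsLinearMap ℝ fun Y => cubicTraceFree f Ξ (e.symm x) X Y Z := by
    simp only [h.cubicTraceFree_symm₂₃ _ X _ Z]
    exact h.cubicTraceFree_linear _ X Z
  obtain ⟨u, rfl⟩ := exists_mfderiv_symm_eq he hx X
  rw [h.trAt_eq he hx (h.cubicTraceFree_linear _ _) (hmid _)]
  have e₁ (j k : Fin n) : cubicTraceFree f Ξ (e.symm x) (mfderiv (𝓡 n) (𝓡 n) e.symm x u)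
      (coordVec e x j) (coordVec e x k) =
      ∑ i, u i * localTraceFree (f ∘ e.symm) (Ξ ∘ e.symm) x i j k := by
    have hl : IsLinearMap ℝ fun X => cubicTraceFree f Ξ (e.symm x) X (coordVec e x j)
        (coordVec e x k) := by
      simp only [h.cubicTraceFree_symm₁₂ _ _ (coordVec e x j)]
      exact hmid _ _
    let L : EuclideanSpace ℝ (Fin n) →ₗ[ℝ] ℝ :=
      (hl.mk' _).comp (mfderiv (𝓡 n) (𝓡 n) e.symm x).toLinearMap
    have := congrArg L (sum_smul_single u)
    rw [map_sum] at this
    refine this.symm.trans (Finset.sum_congr rfl fun i _ => ?_)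
    rw [← h.comp₃_cubicTraceFree he hx]
    exact L.map_smul (u i) _
  simp only [e₁]
  rw [tr₂_sum]
  refine Finset.sum_eq_zero fun i _ => ?_
  have := (h.isConormalPair he).tr₂_localTraceFree hx i
  rw [tr₂_const_mul, this, mul_zero]

end IsCoNormalisation

theorem IsAbundantCoNormalisation.isAbundantPair (hn : 3 ≤ n)
    (h : IsAbundantCoNormalisation f Ξ) (he : e ∈ IsManifold.maximalAtlas (𝓡 n) ∞ M) :
    IsAbundantPair e.target (f ∘ e.symm) (Ξ ∘ e.symm) := by
  have hc := h.coNormalisation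
  have hg : ∀ y ∈ e.target, comp₂ (affineMetric f Ξ) e y = _ := fun y => hc.comp₂_affineMetric he
  have hu : ∀ y ∈ e.target, comp₁ (cubicTrace f Ξ) e y = _ := fun y => hc.comp₁_cubicTrace he
  have hU : ∀ y ∈ e.target, comp₃ (cubicTraceFree f Ξ) e y = _ :=
    fun y => hc.comp₃_cubicTraceFree he
  refine ⟨hc.isConormalPair he, hn, fun x hx i j k l => ?_, fun x hx i j k l => ?_,
    fun x hx i j => ?_⟩
  · rw [← weyl_congr e.open_target hg hx]
    exact h.weylFlat e he x hx i j k l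
  · have h₁ := h.covDeriv_U e he x hx i j k l
    have h₂ := funext fun a => funext fun b => funext fun c => funext fun d =>
      covDeriv₃_congr_metric e.open_target hg hU hx a b c d
    simp only [h₂, hg x hx, hU x hx, hu x hx] at h₁
    exact h₁
  · have h₁ := h.covDeriv_u e he x hx i j
    simp only [covDeriv₁_congr_metric e.open_target hg hu hx,
      schouten_congr e.open_target hg hx, hg x hx, hU x hx, hu x hx] at h₁
    exact h₁

end Manifold

/-! ### Scaling of `u` and `U` by a constant. -/

section Scaling

variable (g : Matrix (Fin n) (Fin n) ℝ) (c : ℝ)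

theorem normSq₁_const_mul (u : Fin n → ℝ) :
    normSq₁ g (fun i => c * u i) = c ^ 2 * normSq₁ g u := by
  rw [normSq₁, normSq₁, ← tr₂_const_mul]
  congr 1
  funext i j
  ring

theorem endo_const_mul (U : Fin n → Fin n → Fin n → ℝ) (i : Fin n) :
    endo g (fun i j k => c * U i j k) i = c • endo g U i := by
  ext a b
  simp only [endo, Matrix.of_apply, Matrix.smul_apply, smul_eq_mul, Finset.mul_sum]
  exact Finset.sum_congr rfl fun _ _ => by ring

theorem trEndo_const_mul (U : Fin n → Fin n → Fin n → ℝ) (i j : Fin n) :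
    trEndo g (fun i j k => c * U i j k) i j = c ^ 2 * trEndo g U i j := by
  simp only [trEndo, endo_const_mul, Matrix.smul_mul, Matrix.mul_smul, Matrix.trace_smul,
    smul_eq_mul]
  ring

theorem normSq₃_const_mul (U : Fin n → Fin n → Fin n → ℝ) :
    normSq₃ g (fun i j k => c * U i j k) = c ^ 2 * normSq₃ g U := by
  simp only [normSq₃, Finset.mul_sum]
  refine Finset.sum_congr rfl fun _ _ => Finset.sum_congr rfl fun _ _ => Finset.sum_congr rfl
    fun _ _ => Finset.sum_congr rfl fun _ _ => Finset.sum_congr rfl fun _ _ =>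
      Finset.sum_congr rfl fun _ _ => by ring

theorem covDeriv₁_const_mul {Ω : Set (EuclideanSpace ℝ (Fin n))} (hΩ : IsOpen Ω)
    {γ : EuclideanSpace ℝ (Fin n) → Matrix (Fin n) (Fin n) ℝ}
    {u : EuclideanSpace ℝ (Fin n) → Fin n → ℝ} {x : EuclideanSpace ℝ (Fin n)} (hx : x ∈ Ω)
    (hu : ∀ i, ContDiffOn ℝ ∞ (fun y => u y i) Ω) (i j : Fin n) :
    covDeriv₁ γ (fun y i => c * u y i) x i j = c * covDeriv₁ γ u x i j := by
  rw [covDeriv₁, covDeriv₁, pd_const_mul (differentiableAt_of_contDiffOn hΩ (hu j) hx), mul_sub,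
    Finset.mul_sum]
  congr 1
  exact Finset.sum_congr rfl fun _ _ => by ring

theorem covDeriv₃_const_mul {Ω : Set (EuclideanSpace ℝ (Fin n))} (hΩ : IsOpen Ω)
    {γ : EuclideanSpace ℝ (Fin n) → Matrix (Fin n) (Fin n) ℝ}
    {T : EuclideanSpace ℝ (Fin n) → Fin n → Fin n → Fin n → ℝ} {x : EuclideanSpace ℝ (Fin n)}
    (hx : x ∈ Ω) (hT : ∀ i j k, ContDiffOn ℝ ∞ (fun y => T y i j k) Ω) (i j k l : Fin n) :
    covDeriv₃ γ (fun y i j k => c * T y i j k) x i j k l = c * covDeriv₃ γ T x i j k l := by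
  rw [covDeriv₃, covDeriv₃, pd_const_mul (differentiableAt_of_contDiffOn hΩ (hT i j k) hx), mul_sub,
    Finset.mul_sum]
  congr 1
  exact Finset.sum_congr rfl fun _ _ => by ring

end Scaling

/-! ### The global potential and the abundant structure. -/

section Manifold

variable {M : Type*} [TopologicalSpace M] [ChartedSpace (EuclideanSpace ℝ (Fin n)) M]
  {f : M → EuclideanSpace ℝ (Fin (n + 1))} {Ξ : M → EuclideanSpace ℝ (Fin (n + 1)) →L[ℝ] ℝ}
  {e : OpenPartialHomeomorph M (EuclideanSpace ℝ (Fin n))} {x : EuclideanSpace ℝ (Fin n)}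

/-- A function whose differential is three times the trace part of the cubic form: up to a factor,
the logarithm of the quotient of the volume densities induced by the metric and by the co-normal
field. -/
def potential (f : M → EuclideanSpace ℝ (Fin (n + 1)))
    (Ξ : M → EuclideanSpace ℝ (Fin (n + 1)) →L[ℝ] ℝ) (p : M) : ℝ :=
  let b : Fin n → TangentSpace (𝓡 n) p := fun i => EuclideanSpace.single i (1 : ℝ)
  3 / ((n : ℝ) + 2) * (1 / 2 * Real.log (Matrix.of fun i j => affineMetric f Ξ p (b i) (b j)).det
    - Real.log (coframeMatrix (Ξ p) fun i => mvfderiv (𝓡 n) Ξ p (b i)).det)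

variable [IsManifold (𝓡 n) ∞ M]

namespace IsCoNormalisation

/-- A change of frame `J` multiplies the determinant of `G` by `(det J)²` and that of the coframe by
`det J`. These cancel in the difference of logarithms, so the local potentials are restrictions of
one function. -/
theorem potential_symm (h : IsCoNormalisation f Ξ)
    (he : e ∈ IsManifold.maximalAtlas (𝓡 n) ∞ M) (hx : x ∈ e.target) :
    potential f Ξ (e.symm x) = localPotential (f ∘ e.symm) (Ξ ∘ e.symm) x := by
  have hc := h.isConormalPair he
  have h₁ := (hc.det x hx).ne_zero
  have h₂ := hc.det_coframeMatrix_ne_zero hx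
  rw [localPotential]
  have e₁ : localMetric (f ∘ e.symm) (Ξ ∘ e.symm) x = _ :=
    (h.comp₂_affineMetric he hx).symm.trans (gram_frame (affineMetric_linear f Ξ (e.symm x))
      (h.affineMetric_linear_left (e.symm x)) fun i => coordVec e x i)
  have e₂ : (coframeMatrix ((Ξ ∘ e.symm) x) fun i => pdv i (Ξ ∘ e.symm) x).det = _ :=
    (congrArg (fun θ => (coframeMatrix ((Ξ ∘ e.symm) x) θ).det)
      (funext fun i => (h.mvfderiv_Ξ he hx (EuclideanSpace.single i 1)).symm)).trans
      (det_coframeMatrix_frame (Ξ (e.symm x)) (mvfderiv (𝓡 n) Ξ (e.symm x))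
        fun i => coordVec e x i)
  rw [e₁, Matrix.det_mul, Matrix.det_mul, Matrix.det_transpose] at h₁ ⊢
  rw [e₂] at h₂ ⊢
  have hJ := right_ne_zero_of_mul h₁
  have hG := right_ne_zero_of_mul (left_ne_zero_of_mul h₁)
  rw [Real.log_mul (mul_ne_zero hJ hG) hJ, Real.log_mul hJ hG,
    Real.log_mul hJ (right_ne_zero_of_mul h₂), potential]
  ring_nf
  rfl

theorem contMDiff_potential (h : IsCoNormalisation f Ξ) :
    ContMDiff (𝓡 n) 𝓘(ℝ, ℝ) ∞ (potential f Ξ) := by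
  intro p
  obtain ⟨e, he, x, hx, rfl⟩ := exists_chart (n := n) p
  have hs : ContMDiffAt (𝓡 n) 𝓘(ℝ, ℝ) ∞ (localPotential (f ∘ e.symm) (Ξ ∘ e.symm)) (e (e.symm x))
      := by
    rw [e.right_inv hx]
    exact ((h.isConormalPair he).contDiffOn_localPotential.contDiffAt
      (e.open_target.mem_nhds hx)).contMDiffAt
  refine (hs.comp (e.symm x) (contMDiffAt_of_mem_maximalAtlas he
    (e.map_target hx))).congr_of_eventuallyEq ?_
  filter_upwards [e.open_source.mem_nhds (e.map_target hx)] with q hq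
  rw [Function.comp_apply, ← h.potential_symm he (e.map_source hq), e.left_inv hq]

theorem mvfderiv_potential (h : IsCoNormalisation f Ξ) (p : M) (X : TangentSpace (𝓡 n) p) :
    mvfderiv (𝓡 n) (potential f Ξ) p X = 3 * cubicTrace f Ξ p X := by
  obtain ⟨e, he, x, hx, rfl⟩ := exists_chart (n := n) p
  obtain ⟨u, rfl⟩ := exists_mfderiv_symm_eq he hx X
  have hev : (potential f Ξ ∘ e.symm) =ᶠ[nhds x] localPotential (f ∘ e.symm) (Ξ ∘ e.symm) :=
    Filter.eventuallyEq_of_mem (e.open_target.mem_nhds hx) fun y hy => h.potential_symm he hy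
  rw [mvfderiv_mfderiv_symm he hx (h.contMDiff_potential.mdifferentiable (by simp) _),
    hev.fderiv_eq, fderiv_eq_sum_pdv]
  let L : EuclideanSpace ℝ (Fin n) →ₗ[ℝ] ℝ := ((h.cubicTrace_linear (e.symm x)).mk' _).comp
    (mfderiv (𝓡 n) (𝓡 n) e.symm x).toLinearMap
  have hL : cubicTrace f Ξ (e.symm x) (mfderiv (𝓡 n) (𝓡 n) e.symm x u) =
      ∑ i, u i * localTrace (f ∘ e.symm) (Ξ ∘ e.symm) x i := by
    have := congrArg L (sum_smul_single u)
    rw [map_sum] at this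
    refine this.symm.trans (Finset.sum_congr rfl fun i _ => ?_)
    rw [← h.comp₁_cubicTrace he hx]
    exact L.map_smul (u i) _
  rw [hL, Finset.mul_sum]
  refine Finset.sum_congr rfl fun i _ => ?_
  have := (h.isConormalPair he).pd_localPotential hx i
  rw [smul_eq_mul]
  change _ * pd i _ x = _
  rw [this]
  ring

end IsCoNormalisation

namespace IsAbundantCoNormalisation

theorem isConformallyFlat (hn : 3 ≤ n) (h : IsAbundantCoNormalisation f Ξ) :
    IsConformallyFlat (affineMetric f Ξ) := by
  intro p
  obtain ⟨e, he, x, hx, rfl⟩ := exists_chart (n := n) p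
  have hp := h.isAbundantPair hn he
  obtain ⟨r, hr, hb, φ, hφ, hflat⟩ := hp.isMetricOn.exists_conformal_flat
    (fun y hy => hp.schouten_symm hy) (fun y hy => hp.riemannLower_eq hy)
    (fun y hy => hp.covDeriv_schouten_symm hy) hx
  -- The conformal factor exists only on a ball, so the chart is restricted to the preimage of that
  -- ball.
  have hs : IsOpen (e.source ∩ e ⁻¹' Metric.ball x r) :=
    e.isOpen_inter_preimage Metric.isOpen_ball
  have ht : (e.restr (e.source ∩ e ⁻¹' Metric.ball x r)).target ⊆ Metric.ball x r := by
    intro y hy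
    rw [e.restr_target, hs.interior_eq] at hy
    simpa [e.right_inv hy.1] using hy.2.2
  refine ⟨e.restr (e.source ∩ e ⁻¹' Metric.ball x r),
    restr_mem_maximalAtlas (contDiffGroupoid ∞ (𝓡 n)) he hs, ?_, φ, hφ.mono ht,
    fun y hy l k i j => ?_⟩
  · rw [e.restr_source, hs.interior_eq]
    exact ⟨e.map_target hx, e.map_target hx, by simpa [e.right_inv hx] using hr⟩
  · rw [← hflat y (ht hy) l k i j]
    refine riemann_congr Metric.isOpen_ball (fun z hz => ?_) (ht hy) l k i j
    have e₁ : comp₂ (affineMetric f Ξ) e z = _ := h.coNormalisation.comp₂_affineMetric he (hb hz)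
    exact congrArg (fun m => Real.exp (2 * φ z) • m) e₁

theorem isAbundantManifold (hn : 3 ≤ n) (h : IsAbundantCoNormalisation f Ξ) :
    IsAbundantManifold (affineMetric f Ξ) (fun p X Y Z => 3 * cubicTraceFree f Ξ p X Y Z)
      (potential f Ξ) := by
  have hc := h.coNormalisation
  have hg {e : OpenPartialHomeomorph M (EuclideanSpace ℝ (Fin n))}
      (he : e ∈ IsManifold.maximalAtlas (𝓡 n) ∞ M) :
      ∀ y ∈ e.target, comp₂ (affineMetric f Ξ) e y = _ := fun y => hc.comp₂_affineMetric he
  have hS {e : OpenPartialHomeomorph M (EuclideanSpace ℝ (Fin n))}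
      (he : e ∈ IsManifold.maximalAtlas (𝓡 n) ∞ M) : ∀ y ∈ e.target,
      comp₃ (fun p X Y Z => 3 * cubicTraceFree f Ξ p X Y Z) e y =
        fun i j k => 3 * localTraceFree (f ∘ e.symm) (Ξ ∘ e.symm) y i j k := by
    intro y hy
    rw [← hc.comp₃_cubicTraceFree he hy]
    rfl
  have hτ {e : OpenPartialHomeomorph M (EuclideanSpace ℝ (Fin n))}
      (he : e ∈ IsManifold.maximalAtlas (𝓡 n) ∞ M) : ∀ y ∈ e.target,
      comp₁ (fun p => mvfderiv (𝓡 n) (potential f Ξ) p) e y =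
        fun i => 3 * localTrace (f ∘ e.symm) (Ξ ∘ e.symm) y i := by
    intro y hy
    rw [← hc.comp₁_cubicTrace he hy]
    funext i
    exact hc.mvfderiv_potential _ _
  refine ⟨⟨IsCoNormalisation.affineMetric_linear f Ξ, hc.affineMetric_symm, hc.nondegenerate, fun e
      he i j => ?_⟩,
    h.isConformallyFlat hn, ⟨fun p X Y => ?_, fun p X Y Z => ?_, fun p X Y Z => ?_,
      fun e he i j k => ?_⟩, fun p X => ?_, hc.contMDiff_potential, fun e he x hx i j => ?_,
    fun e he x hx i j k l => ?_, fun e he x hx i j k l => ?_⟩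
  · exact ((hc.isConormalPair he).isMetricOn.smooth i j).congr fun y hy => by rw [hg he y hy]
  · have hl := hc.cubicTraceFree_linear p X Y
    refine ⟨fun Z W => ?_, fun c Z => ?_⟩
    · rw [hl.map_add, mul_add]
    · rw [hl.map_smul, smul_eq_mul, smul_eq_mul]
      ring
  · rw [hc.cubicTraceFree_symm₁₂]
  · rw [hc.cubicTraceFree_symm₂₃]
  · exact (contDiffOn_const.mul ((hc.isConormalPair he).contDiffOn_localTraceFree i j k)).congr
      fun y hy => by rw [hS he y hy]
  · have := hc.trAt_cubicTraceFree p X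
    rw [trAt] at this ⊢
    rw [tr₂_const_mul, this, mul_zero]
  · have hp := h.isAbundantPair hn he
    have hn' : (3 : ℝ) ≤ n := by exact_mod_cast hn
    have h₂ : (n : ℝ) - 2 ≠ 0 := by linarith
    have h₁ : (n : ℝ) - 1 ≠ 0 := by linarith
    have h₀ : (n : ℝ) + 2 ≠ 0 := by linarith
    simp only [covDeriv₁_congr_metric e.open_target (hg he) (hτ he) hx,
      schouten_congr e.open_target (hg he) hx, hg he x hx, hS he x hx, hτ he x hx,
      normSq₁_const_mul, normSq₃_const_mul, trEndo_const_mul]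
    -- Three times the equation for `∇u`: the quadratic terms are `9` times those of `u` and `U`,
    -- which the factors `1 / 3` reduce to `3`.
    rw [covDeriv₁_const_mul 3 e.open_target hx hp.contDiffOn_localTrace, hp.covDeriv_u x hx]
    field_simp
    ring
  · have hp := h.isAbundantPair hn he
    simp only [covDeriv₃_congr_metric e.open_target (hg he) (hS he) hx, hg he x hx, hS he x hx,
      hτ he x hx]
    rw [covDeriv₃_const_mul 3 e.open_target hx hp.contDiffOn_localTraceFree,
      (hp.commutator_and_covDeriv_U hx).2, sym₃TraceFree_S₁ hn (hp.isMetricOn.symm x hx)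
      (hp.det x hx) (hp.localTraceFree_symm₁₂ hx) (hp.localTraceFree_symm₂₃ hx)
      (hp.tr₂_localTraceFree hx)]
    ring
  · have hp := h.isAbundantPair hn he
    simp only [hg he x hx, hS he x hx]
    obtain ⟨Q, hQ⟩ := (hp.commutator_and_covDeriv_U hx).1
    exact weylPart_pairEndo hn (hp.isMetricOn.symm x hx) (hp.det x hx)
      (hp.localTraceFree_symm₁₂ hx) hQ i j k l

end IsAbundantCoNormalisation

end Manifold

end Abundant

end

theorem mainTheorem2 (n : ℕ) (hn : 3 ≤ n) (M : Type*) [TopologicalSpace M]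
    [ChartedSpace (EuclideanSpace ℝ (Fin n)) M] [IsManifold (𝓡 n) ∞ M]
    [SimplyConnectedSpace M]
    (f : M → EuclideanSpace ℝ (Fin (n + 1)))
    (Ξ : M → EuclideanSpace ℝ (Fin (n + 1)) →L[ℝ] ℝ)
    (h : Abundant.IsAbundantCoNormalisation f Ξ) :
    ∃ t : M → ℝ,
      (∀ (p : M) (X : TangentSpace (𝓡 n) p),
        3 * Abundant.cubicTrace f Ξ p X = mvfderiv (𝓡 n) t p X) ∧
      Abundant.IsAbundantManifold (Abundant.affineMetric f Ξ)
        (fun p X Y Z => 3 * Abundant.cubicTraceFree f Ξ p X Y Z) t := by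
  exact ⟨Abundant.potential f Ξ, fun p X => (h.coNormalisation.mvfderiv_potential p X).symm,
    h.isAbundantManifold hn⟩
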